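/- For a real function $S$, a complex-valued $C^\infty$ function $\chi$ of compact support in $\mathbb R^2$ such that $S$ is smooth on $\operatorname{supp}\chi$, and $\lambda>0$, let $T_\lambda$ be the operator on $L^2(\mathbb R)$ given by $$T_\lambda f(x)=\int_{-\infty}^{\infty}e^{i\lambda S(x,y)}\chi(x,y)f(y)\,dy .$$ Write $G^{(a,b)}=\partial_x^a\partial_y^bG$, and write $\|T_\lambda\|\lesssim\lambda^{-\delta}$ if there is a constant $C$, independent of $\lambda$, such that for every $\lambda>0$ the operator $T_\lambda$ is bounded on $L^2(\mathbb R)$ with operator norm at most $C\lambda^{-\delta}$. **Theorem.** Let $Q=[0,1]^2$, let $S$ be a real function that is $C^\infty$ on $Q$ (with one-sided derivatives at the boundary), let $\chi\in C^\infty(\mathbb R^2)$ have $\operatorname{supp}\chi\subset Q$, and set $F=S''_{xy}$. (I) Let $B\ge 0$ be an integer. If $F^{(1,0)}\ne0$ and $F^{(0,B)}\neq 0$ everywhere on $Q$, then $$\|T_\lambda\|\lesssim\lambda^{-\frac{B+1}{2(2B+1)}}.$$ (II) If $F^{(2,0)}\ne0$ and $F^{(0,2)}\ne0$ everywhere on $Q$,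 then $\|T_\lambda\|\lesssim\lambda^{-1/4}$. (III) In particular, the bound $\lambda^{-1/4}$ holds, without logarithmic loss, and is sharp in the following case. Let $S$ be a real function that is $C^\infty$ in an open neighbourhood of the origin, and suppose that the formal Taylor series of $S''_{xy}$ at the origin factors in $\mathbb R[[x,y]]$ as $U(x,y)\,(y-f(x))^2$, where $U$ is invertible and $f(x)=cx+\cdots\in\mathbb R[[x]]$ with zero constant term and $c\ne0$. Then there is a neighbourhood $V$ of the origin such that, for every $\chi\in C_c^\infty(\mathbb R^2)$ with $\operatorname{supp}\chi\subset V$, $\|T_\lambda\|\lesssim\lambda^{-1/4}$; and if moreover $\chi(0,0)\ne0$, then there is $c_0>0$ with $\|T_\lambda\|\ge c_0\lambda^{-1/4}$ for all $\lambda\ge1$. -/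

import Mathlib

open Set Filter Topology MeasureTheory
open scoped ContDiff PowerSeries

noncomputable section

/-- The partial derivative in the first variable. The first variable is restricted to `J`, so that
for `J = [0,1]` the derivatives at the endpoints are one-sided, and for `J = univ` this is the
ordinary partial derivative. -/
def partialX (J : Set ℝ) (G : ℝ × ℝ → ℝ) : ℝ × ℝ → ℝ :=
  fun p => derivWithin (fun t => G (t, p.2)) J p.1

/-- The partial derivative in the second variable, restricted to `J`. -/
def partialY (J : Set ℝ) (G : ℝ × ℝ → ℝ) : ℝ × ℝ → ℝ :=
  fun p => derivWithin (fun t => G (p.1, t)) J p.2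

/-- `G^{(a,b)} = ∂_x^a ∂_y^b G`, on the square `J × J`. -/
def mixedPartial (J : Set ℝ) (a b : ℕ) (G : ℝ × ℝ → ℝ) : ℝ × ℝ → ℝ :=
  (partialX J)^[a] ((partialY J)^[b] G)

/-- `S''_{xy}`, on the square `J × J`. -/
def mixedHessian (J : Set ℝ) (S : ℝ × ℝ → ℝ) : ℝ × ℝ → ℝ :=
  partialX J (partialY J S)

/-- The unit square `Q = [0,1]²`. -/
def unitSquare : Set (ℝ × ℝ) := Icc (0 : ℝ) 1 ×ˢ Icc (0 : ℝ) 1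

/-- The kernel `e^{iλS(x,y)} χ(x,y)`. -/
def oscKernel (S : ℝ × ℝ → ℝ) (χ : ℝ × ℝ → ℂ) (lam : ℝ) : ℝ × ℝ → ℂ :=
  fun p => Complex.exp (Complex.I * (lam : ℂ) * (S p : ℂ)) * χ p

/-- The bounded operator `T` on `L²(ℝ)` is the integral operator with kernel `K`:
`T f (x) = ∫ K(x,y) f(y) dy`, where the integral converges absolutely for every `x`. -/
def IsIntegralOperator (K : ℝ × ℝ → ℂ)
    (T : Lp ℂ 2 (volume : Measure ℝ) →L[ℂ] Lp ℂ 2 (volume : Measure ℝ)) : Prop :=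
  ∀ f : Lp ℂ 2 (volume : Measure ℝ),
    (∀ x : ℝ, Integrable (fun y : ℝ => K (x, y) * f y)) ∧
    (T f : ℝ → ℂ) =ᵐ[volume] fun x : ℝ => ∫ y : ℝ, K (x, y) * f y

/-- `‖T_λ‖ ≲ λ^{-δ}`: for every `λ > 0` the operator `T_λ` is bounded on `L²(ℝ)`, and its operator
norm is at most `C λ^{-δ}`, with `C` independent of `λ`. -/
def NormDecay (S : ℝ × ℝ → ℝ) (χ : ℝ × ℝ → ℂ) (δ : ℝ) : Prop :=
  ∃ C : ℝ, ∀ lam : ℝ, 0 < lam →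
    ∃ T : Lp ℂ 2 (volume : Measure ℝ) →L[ℂ] Lp ℂ 2 (volume : Measure ℝ),
      IsIntegralOperator (oscKernel S χ lam) T ∧ ‖T‖ ≤ C * lam ^ (-δ)

/-- `‖T_λ‖ ≳ λ^{-δ}` for `λ ≥ 1`: the reverse inequality with a positive constant. -/
def NormLowerBound (S : ℝ × ℝ → ℝ) (χ : ℝ × ℝ → ℂ) (δ : ℝ) : Prop :=
  ∃ c : ℝ, 0 < c ∧ ∀ lam : ℝ, 1 ≤ lam →
    ∀ T : Lp ℂ 2 (volume : Measure ℝ) →L[ℂ] Lp ℂ 2 (volume : Measure ℝ),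
      IsIntegralOperator (oscKernel S χ lam) T → c * lam ^ (-δ) ≤ ‖T‖

/-- The formal Taylor series `∑ c_{pq} x^p y^q`, `c_{pq} = ∂_x^p ∂_y^q G(0,0) / (p! q!)`, at the
origin, as an element of `ℝ[[x]][[y]] = ℝ[[x,y]]`: the outer variable is `y`, the inner one `x`. -/
def formalTaylor (G : ℝ × ℝ → ℝ) : ℝ⟦X⟧⟦X⟧ :=
  PowerSeries.mk fun q => PowerSeries.mk fun p =>
    mixedPartial univ p q G (0, 0) / ((Nat.factorial p : ℝ) * (Nat.factorial q : ℝ))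

/-- `G` is exceptionally degenerate of order `N`: its formal Taylor series at the origin factors as
`U(x,y) (y - f(x))^N` with `N ≥ 2`, `U` invertible, and `f(x) = c x + …`, `c ≠ 0`. -/
def ExceptionallyDegenerate (G : ℝ × ℝ → ℝ) (N : ℕ) : Prop :=
  2 ≤ N ∧ ∃ (U : ℝ⟦X⟧⟦X⟧) (f : ℝ⟦X⟧), IsUnit U ∧
    PowerSeries.coeff 0 f = 0 ∧ PowerSeries.coeff 1 f ≠ 0 ∧
    formalTaylor G = U * (PowerSeries.X - PowerSeries.C f) ^ N

end

/-! Write F = S''_{xy}. The operator is cut along the level sets of F into a core |F| < a₀ and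
dyadic shells a ≤ |F| < 2a. If F has nonvanishing pure derivatives of order A in x and B in y, with
A and B positive, then every section of {|F| ≤ a} has length O(a^ρ) in x and O(a^τ) in y, where ρ =
1/A and τ = 1/B. Schur's test therefore bounds the core by a₀^{σ/2}, where σ = ρ + τ
(`exists_sublevel_measure`, `core_bound_of_sections`).

On a shell, the kernel of T T* is an oscillatory integral in y whose phase has derivative S_y(x,y) -
S_y(x',y), the integral of F(·,y) from x' to x. Where this is at least of order a|x - x'|, van der
Corput's first derivative test gives O((λa|x - x'|)⁻¹), while the trivial bound is O(a^τ). Their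
geometric mean with weights 3/4 and 1/4 has the integrable singularity |x - x'|^{-3/4}; over |x -
x'| ≲ a^ρ it integrates to O((λa)⁻¹(λa^{1+σ})^{1/4}), which bounds the squared norm
(`exists_opBound_piece`). With λa₀^{1+σ} = 1 the first shell matches the core, and later shells
decay geometrically because σ ≤ 2. So the sum costs no logarithm and the decay is λ^{-σ/(2(1+σ))}
(`normDecay_of_pieces`): σ = 1 + 1/B in (I) with B ≥ 1, σ = 1 in (II). Sharp cutoffs are harmless
because, in y, both F and the phase derivative are monotone on a number of intervals controlled by B
alone (`exists_sign_partition`).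

The cases differ in the lower bound for the phase derivative. In (I), F is monotone in x, so between
two points of a one-signed shell F stays in the shell. In (II), F is strictly convex or concave in x
and may leave the shell. If |x - x'| is a small multiple of √a, then F still keeps size a/2 in
between (`half_le_abs_of_endpoints`). If it is a large multiple, curvature dominates the endpoint
values and the trapezoidal error gives a derivative of order |x - x'|³ (`cube_le_abs_sub`), whose
contribution |x - x'|^{-3} is integrable beyond √a. Intermediate distances are removed by splitting
the x-axis into residue classes of a grid of mesh comparable to √a. The case B = 0 of (I) is
nondegenerate and follows from two integrations by parts.

In (III) the 2-jet of F at the origin is u(y - cx)² with u, c ≠ 0, so (II) applies on a small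
square. Moreover F = O(t²) on |x|, |y| ≤ t, so the mixed difference of S there is O(t⁴). Hence for t
= ελ^{-1/4} the operator applied to e^{-iλS(0,y)} on [-t,t] does not oscillate, which gives the
lower bound. -/

/-! ### Integral operators on L², the T T* method -/

/-- The integral operator with kernel `K` is bounded on `L²(μ)` with norm at most `A`. -/
def OpBound (μ : Measure ℝ) (K : ℝ → ℝ → ℂ) (A : ℝ) : Prop :=
  ∀ f : ℝ → ℂ, MemLp f 2 μ →
    eLpNorm (fun x => ∫ y, K x y * f y ∂μ) 2 μ ≤ ENNReal.ofReal A * eLpNorm f 2 μ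

/-- A jointly measurable bounded kernel. -/
structure BddKernel (K : ℝ → ℝ → ℂ) : Prop where
  meas : Measurable (Function.uncurry K)
  bdd : ∃ M : ℝ, ∀ x y, ‖K x y‖ ≤ M

section Operators

set_option linter.unusedSectionVars false

variable {μ : Measure ℝ} [IsFiniteMeasure μ] {K : ℝ → ℝ → ℂ}

lemma BddKernel.integrable_left (hK : BddKernel K) (x : ℝ) {f : ℝ → ℂ} (hf : Integrable f μ) :
    Integrable (fun y => K x y * f y) μ := by
  obtain ⟨M, hM⟩ := hK.bdd
  exact hf.bdd_mul (hK.meas.comp measurable_prodMk_left).aestronglyMeasurable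
    (Eventually.of_forall (hM x))

lemma BddKernel.aestronglyMeasurable_integral (hK : BddKernel K) {f : ℝ → ℂ}
    (hf : AEStronglyMeasurable f μ) :
    AEStronglyMeasurable (fun x => ∫ y, K x y * f y ∂μ) μ := by
  have h : AEStronglyMeasurable (fun p : ℝ × ℝ => K p.1 p.2 * f p.2) (μ.prod μ) :=
    (hK.meas.aestronglyMeasurable (μ := μ.prod μ)).mul hf.comp_snd
  exact h.integral_prod_right'

lemma BddKernel.conj_swap (hK : BddKernel K) :
    BddKernel (fun y x => (starRingEnd ℂ) (K x y)) := by
  refine ⟨?_, ?_⟩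
  · exact Complex.continuous_conj.measurable.comp (hK.meas.comp measurable_swap)
  · obtain ⟨M, hM⟩ := hK.bdd
    exact ⟨M, fun x y => by simpa using hM y x⟩

lemma BddKernel.add {K' : ℝ → ℝ → ℂ} (hK : BddKernel K) (hK' : BddKernel K') :
    BddKernel (fun x y => K x y + K' x y) := by
  obtain ⟨M, hM⟩ := hK.bdd
  obtain ⟨M', hM'⟩ := hK'.bdd
  exact ⟨hK.meas.add hK'.meas, M + M', fun x y => (norm_add_le _ _).trans
    (add_le_add (hM x y) (hM' x y))⟩

lemma BddKernel.indicator (hK : BddKernel K) {R : Set (ℝ × ℝ)} (hR : MeasurableSet R) :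
    BddKernel (fun x y => R.indicator (Function.uncurry K) (x, y)) := by
  obtain ⟨M, hM⟩ := hK.bdd
  refine ⟨hK.meas.indicator hR, M, fun x y => ?_⟩
  exact (norm_indicator_le_norm_self _ _).trans (hM x y)

lemma OpBound.add {K' : ℝ → ℝ → ℂ} {A A' : ℝ} (hK : BddKernel K) (hK' : BddKernel K')
    (hA : 0 ≤ A) (hA' : 0 ≤ A') (h : OpBound μ K A) (h' : OpBound μ K' A') :
    OpBound μ (fun x y => K x y + K' x y) (A + A') := by
  intro f hf
  have hi : Integrable f μ := hf.integrable (by norm_num)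
  have e : (fun x => ∫ y, (K x y + K' x y) * f y ∂μ) =
      (fun x => ∫ y, K x y * f y ∂μ) + (fun x => ∫ y, K' x y * f y ∂μ) := by
    funext x
    simp only [Pi.add_apply, add_mul]
    exact integral_add (hK.integrable_left x hi) (hK'.integrable_left x hi)
  rw [e, ENNReal.ofReal_add hA hA', add_mul]
  exact (eLpNorm_add_le (hK.aestronglyMeasurable_integral hf.1)
    (hK'.aestronglyMeasurable_integral hf.1) (by norm_num)).trans (add_le_add (h f hf) (h' f hf))

lemma OpBound.mono {A A' : ℝ} (h : OpBound μ K A) (hA : A ≤ A') : OpBound μ K A' := fun f hf =>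
  (h f hf).trans (mul_le_mul_left (ENNReal.ofReal_le_ofReal hA) _)

lemma OpBound.congr {K' : ℝ → ℝ → ℂ} {A : ℝ} (h : OpBound μ K A) (e : ∀ x y, K' x y = K x y) :
    OpBound μ K' A := by
  have : K' = K := by funext x y; exact e x y
  rwa [this]

lemma BddKernel.finset_sum {ι : Type*} (s : Finset ι) (k : ι → ℝ → ℝ → ℂ)
    (hk : ∀ i ∈ s, BddKernel (k i)) : BddKernel (fun x y => ∑ i ∈ s, k i x y) := by
  classical
  induction s using Finset.induction_on with
  | empty => simpa using (⟨measurable_const, 0, fun x y => by simp⟩ : BddKernel fun _ _ => 0)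
  | insert i s hi ih =>
    simp only [Finset.sum_insert hi]
    exact (hk i (Finset.mem_insert_self _ _)).add
      (ih fun j hj => hk j (Finset.mem_insert_of_mem hj))

lemma OpBound.finset_sum {ι : Type*} (s : Finset ι) (k : ι → ℝ → ℝ → ℂ) (A : ι → ℝ)
    (hk : ∀ i ∈ s, BddKernel (k i)) (hA : ∀ i ∈ s, 0 ≤ A i) (h : ∀ i ∈ s, OpBound μ (k i) (A i)) :
    OpBound μ (fun x y => ∑ i ∈ s, k i x y) (∑ i ∈ s, A i) := by
  classical
  induction s using Finset.induction_on with
  | empty => intro f _; simp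
  | insert i s hi ih =>
    simp only [Finset.sum_insert hi]
    refine OpBound.add (hk i (Finset.mem_insert_self _ _))
      (BddKernel.finset_sum s k fun j hj => hk j (Finset.mem_insert_of_mem hj))
      (hA i (Finset.mem_insert_self _ _))
      (Finset.sum_nonneg fun j hj => hA j (Finset.mem_insert_of_mem hj))
      (h i (Finset.mem_insert_self _ _)) ?_
    exact ih (fun j hj => hk j (Finset.mem_insert_of_mem hj))
      (fun j hj => hA j (Finset.mem_insert_of_mem hj))
      (fun j hj => h j (Finset.mem_insert_of_mem hj))

/-- The kernel of `T T*`. -/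
noncomputable def ttStar (μ : Measure ℝ) (K : ℝ → ℝ → ℂ) (x x' : ℝ) : ℂ :=
  ∫ y, K x y * (starRingEnd ℂ) (K x' y) ∂μ

lemma norm_ttStar_comm (x x' : ℝ) : ‖ttStar μ K x x'‖ = ‖ttStar μ K x' x‖ := by
  have : ttStar μ K x x' = (starRingEnd ℂ) (ttStar μ K x' x) := by
    unfold ttStar
    rw [← integral_conj]
    congr 1; funext y; simp [mul_comm]
  rw [this]; simp

lemma BddKernel.ttStar (hK : BddKernel K) : BddKernel (ttStar μ K) := by
  obtain ⟨M, hM⟩ := hK.bdd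
  refine ⟨?_, M * M * μ.real univ, fun x x' => ?_⟩
  · have h : StronglyMeasurable (fun q : (ℝ × ℝ) × ℝ => K q.1.1 q.2 * (starRingEnd ℂ) (K q.1.2 q.2)) := by
      refine Measurable.stronglyMeasurable ?_
      refine Measurable.mul ?_ (Complex.continuous_conj.measurable.comp ?_)
      · exact hK.meas.comp (measurable_fst.fst.prodMk measurable_snd)
      · exact hK.meas.comp (measurable_fst.snd.prodMk measurable_snd)
    exact (h.integral_prod_right' (ν := μ)).measurable
  · refine norm_integral_le_of_norm_le_const (Eventually.of_forall fun y => ?_)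
    rw [norm_mul, RCLike.norm_conj]
    exact mul_le_mul (hM x y) (hM x' y) (norm_nonneg _) ((norm_nonneg _).trans (hM x y))

lemma sq_eLpNorm_two {f : ℝ → ℂ} (hf : MemLp f 2 μ) :
    eLpNorm f 2 μ = ENNReal.ofReal (Real.sqrt (∫ x, ‖f x‖ ^ 2 ∂μ)) := by
  rw [hf.eLpNorm_eq_integral_rpow_norm (by norm_num) (by norm_num)]
  congr 1
  rw [Real.sqrt_eq_rpow]
  simp

lemma norm_integral_mul_le_sqrt {f g : ℝ → ℂ} (hf : MemLp f 2 μ) (hg : MemLp g 2 μ) :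
    ‖∫ x, f x * g x ∂μ‖ ≤ Real.sqrt (∫ x, ‖f x‖ ^ 2 ∂μ) * Real.sqrt (∫ x, ‖g x‖ ^ 2 ∂μ) := by
  refine (norm_integral_le_integral_norm _).trans ?_
  simp only [norm_mul]
  have := integral_mul_norm_le_Lp_mul_Lq (μ := μ) (f := f) (g := g) (p := 2) (q := 2)
    (by constructor <;> norm_num) (by simpa using hf) (by simpa using hg)
  simpa [Real.sqrt_eq_rpow] using this

/-- The `TT*` method: Schur's test for the kernel of `T T*`. -/
theorem opBound_of_ttStar (hK : BddKernel K) {M : ℝ}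
    (h : ∀ x, ∫ x', ‖ttStar μ K x x'‖ ∂μ ≤ M) : OpBound μ K (Real.sqrt M) := by
  intro f hf
  have hM0 : 0 ≤ M := (integral_nonneg fun _ => norm_nonneg _).trans (h 0)
  have hi : Integrable f μ := hf.integrable (by norm_num)
  obtain ⟨M₁, hM₁⟩ := hK.bdd
  have hM₁0 : 0 ≤ M₁ := (norm_nonneg _).trans (hM₁ 0 0)
  -- With g = Tf and h' = T*g, duality gives ‖g‖² = ⟨f, h'⟩ ≤ ‖f‖‖h'‖, and ‖h'‖² = ⟨g, T T*g⟩ ≤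
  -- M‖g‖². Eliminating h' leaves ‖g‖² ≤ M‖f‖². The a priori bounds on g and h' serve only to
  -- justify Fubini.
  set g : ℝ → ℂ := fun x => ∫ y, K x y * f y ∂μ with hgdef
  have gmeas : AEStronglyMeasurable g μ := hK.aestronglyMeasurable_integral hf.1
  have gb : ∀ x, ‖g x‖ ≤ M₁ * ∫ y, ‖f y‖ ∂μ := fun x => by
    rw [← integral_const_mul]
    refine norm_integral_le_of_norm_le (hi.norm.const_mul _) (Eventually.of_forall fun y => ?_)
    rw [norm_mul]
    exact mul_le_mul_of_nonneg_right (hM₁ x y) (norm_nonneg _)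
  have gL : MemLp g 2 μ := MemLp.of_bound gmeas _ (Eventually.of_forall gb)
  have gi : Integrable g μ := gL.integrable (by norm_num)
  set h' : ℝ → ℂ := fun y => ∫ x, (starRingEnd ℂ) (K x y) * g x ∂μ with hhdef
  have hmeas : AEStronglyMeasurable h' μ := hK.conj_swap.aestronglyMeasurable_integral gL.1
  have hb : ∀ y, ‖h' y‖ ≤ M₁ * ∫ x, ‖g x‖ ∂μ := fun y => by
    rw [← integral_const_mul]
    refine norm_integral_le_of_norm_le (gi.norm.const_mul _) (Eventually.of_forall fun x => ?_)
    rw [norm_mul, RCLike.norm_conj]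
    exact mul_le_mul_of_nonneg_right (hM₁ x y) (norm_nonneg _)
  have hL : MemLp h' 2 μ := MemLp.of_bound hmeas _ (Eventually.of_forall hb)
  have hhi : Integrable h' μ := hL.integrable (by norm_num)
  -- duality
  have key : ∀ u v : ℝ → ℂ, Integrable u μ → Integrable v μ →
      ∫ x, (starRingEnd ℂ) (u x) * (∫ y, K x y * v y ∂μ) ∂μ =
        ∫ y, v y * (starRingEnd ℂ) (∫ x, (starRingEnd ℂ) (K x y) * u x ∂μ) ∂μ := by
    intro u v hu hv
    have hint : Integrable (Function.uncurry fun x y => (starRingEnd ℂ) (u x) * (K x y * v y))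
        (μ.prod μ) := by
      have h1 : Integrable (fun p : ℝ × ℝ => (starRingEnd ℂ) (u p.1) * v p.2) (μ.prod μ) :=
        Integrable.mul_prod (f := fun x => (starRingEnd ℂ) (u x)) (g := v)
          ((LinearIsometryEquiv.integrable_comp_iff Complex.conjLIE).2 hu) hv
      have h2 := h1.bdd_mul (f := fun p : ℝ × ℝ => K p.1 p.2) (c := M₁)
        hK.meas.aestronglyMeasurable (Eventually.of_forall fun p => hM₁ p.1 p.2)
      refine h2.congr (Eventually.of_forall fun p => ?_)
      simp only [Function.uncurry]; ring
    calc _ = ∫ x, ∫ y, (starRingEnd ℂ) (u x) * (K x y * v y) ∂μ ∂μ := by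
          congr 1; funext x; rw [integral_const_mul]
      _ = ∫ y, ∫ x, (starRingEnd ℂ) (u x) * (K x y * v y) ∂μ ∂μ := integral_integral_swap hint
      _ = _ := by
          congr 1; funext y
          rw [← integral_conj, ← integral_const_mul]
          congr 1; funext x; simp; ring
  have sq : ∀ u : ℝ → ℂ, ∫ x, (starRingEnd ℂ) (u x) * u x ∂μ = ((∫ x, ‖u x‖ ^ 2 ∂μ : ℝ) : ℂ) := by
    intro u
    rw [← integral_complex_ofReal]
    congr 1; funext x
    rw [RCLike.conj_mul]; simp
  set G : ℝ := ∫ x, ‖g x‖ ^ 2 ∂μ with hG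
  set H : ℝ := ∫ x, ‖h' x‖ ^ 2 ∂μ with hH
  set Φ : ℝ := ∫ x, ‖f x‖ ^ 2 ∂μ with hΦ
  have G0 : 0 ≤ G := integral_nonneg fun _ => by positivity
  have H0 : 0 ≤ H := integral_nonneg fun _ => by positivity
  have Φ0 : 0 ≤ Φ := integral_nonneg fun _ => by positivity
  have e1 : G ≤ Real.sqrt Φ * Real.sqrt H := by
    have h1 : ((G : ℝ) : ℂ) = ∫ y, f y * (starRingEnd ℂ) (h' y) ∂μ := by
      rw [hG, ← sq g]; exact key g f gi hi
    have h2 := norm_integral_mul_le_sqrt (μ := μ) hf (g := fun y => (starRingEnd ℂ) (h' y))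
      (hL.congr_norm (Complex.continuous_conj.comp_aestronglyMeasurable hmeas)
        (Eventually.of_forall fun x => by simp))
    rw [← h1] at h2
    simpa [abs_of_nonneg G0] using h2
  -- `T h' = (T T*) g`
  have e2 : ∀ x, ∫ y, K x y * h' y ∂μ = ∫ x', ttStar μ K x x' * g x' ∂μ := by
    intro x
    have hint : Integrable (Function.uncurry fun y x' => K x y * ((starRingEnd ℂ) (K x' y) * g x'))
        (μ.prod μ) := by
      have h1 : Integrable (fun p : ℝ × ℝ => g p.2) (μ.prod μ) := gi.comp_snd μ
      have h2 := h1.bdd_mul (f := fun p : ℝ × ℝ => K x p.1 * (starRingEnd ℂ) (K p.2 p.1))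
        (c := M₁ * M₁) ((hK.meas.comp (measurable_const.prodMk measurable_fst)).mul
          (Complex.continuous_conj.measurable.comp
            (hK.meas.comp measurable_swap))).aestronglyMeasurable
          (Eventually.of_forall fun p => by
            rw [norm_mul, RCLike.norm_conj]
            exact mul_le_mul (hM₁ _ _) (hM₁ _ _) (norm_nonneg _) hM₁0)
      refine h2.congr (Eventually.of_forall fun p => ?_)
      simp only [Function.uncurry]; ring
    calc _ = ∫ y, ∫ x', K x y * ((starRingEnd ℂ) (K x' y) * g x') ∂μ ∂μ := by
          congr 1; funext y; rw [integral_const_mul]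
      _ = ∫ x', ∫ y, K x y * ((starRingEnd ℂ) (K x' y) * g x') ∂μ ∂μ := integral_integral_swap hint
      _ = _ := by
          congr 1; funext x'
          unfold ttStar
          rw [← integral_mul_const]
          congr 1; funext y; ring
  have hT := hK.ttStar (μ := μ)
  have e3 : H ≤ M * G := by
    have h1 : ((H : ℝ) : ℂ) = (starRingEnd ℂ)
        (∫ x, (starRingEnd ℂ) (g x) * (∫ x', ttStar μ K x x' * g x' ∂μ) ∂μ) := by
      rw [hH, ← sq h', ← Complex.conj_conj (∫ x, (starRingEnd ℂ) (h' x) * h' x ∂μ)]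
      congr 1
      rw [← integral_conj]
      simp only [← e2]
      rw [key g h' gi hhi]
      congr 1; funext y; simp [hhdef]
    have hLm : Measurable (Function.uncurry (ttStar μ K)) := hT.meas
    obtain ⟨M₂, hM₂⟩ := hT.bdd
    have gsq : Integrable (fun x => ‖g x‖ ^ 2) μ := gL.integrable_norm_pow (by norm_num)
    have i1 : Integrable (fun p : ℝ × ℝ => ‖ttStar μ K p.1 p.2‖ * ‖g p.1‖ ^ 2) (μ.prod μ) :=
      (gsq.comp_fst μ).bdd_mul (c := M₂) hLm.norm.aestronglyMeasurable
        (Eventually.of_forall fun p => by simpa using hM₂ p.1 p.2)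
    have i2 : Integrable (fun p : ℝ × ℝ => ‖ttStar μ K p.1 p.2‖ * ‖g p.2‖ ^ 2) (μ.prod μ) :=
      (gsq.comp_snd μ).bdd_mul (c := M₂) hLm.norm.aestronglyMeasurable
        (Eventually.of_forall fun p => by simpa using hM₂ p.1 p.2)
    have b1 : ∫ p, ‖ttStar μ K p.1 p.2‖ * ‖g p.1‖ ^ 2 ∂(μ.prod μ) ≤ M * G := by
      rw [integral_prod _ i1, hG, ← integral_const_mul]
      refine integral_mono i1.integral_prod_left (gsq.const_mul M) fun x => ?_
      simp only
      rw [integral_mul_const]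
      exact mul_le_mul_of_nonneg_right (h x) (by positivity)
    have b2 : ∫ p, ‖ttStar μ K p.1 p.2‖ * ‖g p.2‖ ^ 2 ∂(μ.prod μ) =
        ∫ p, ‖ttStar μ K p.1 p.2‖ * ‖g p.1‖ ^ 2 ∂(μ.prod μ) := by
      rw [← integral_prod_swap]
      congr 1; funext p
      simp only [Prod.fst_swap, Prod.snd_swap]
      rw [norm_ttStar_comm]
    have h2 : H = ‖∫ x, (starRingEnd ℂ) (g x) * (∫ x', ttStar μ K x x' * g x' ∂μ) ∂μ‖ := by
      have := congrArg norm h1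
      simpa [abs_of_nonneg H0] using this
    rw [h2]
    have i3 : Integrable (fun p : ℝ × ℝ =>
        (starRingEnd ℂ) (g p.1) * (ttStar μ K p.1 p.2 * g p.2)) (μ.prod μ) := by
      have h1 : Integrable (fun p : ℝ × ℝ => (starRingEnd ℂ) (g p.1) * g p.2) (μ.prod μ) :=
        Integrable.mul_prod (f := fun x => (starRingEnd ℂ) (g x)) (g := g)
          ((LinearIsometryEquiv.integrable_comp_iff Complex.conjLIE).2 gi) gi
      refine (h1.bdd_mul (c := M₂) hLm.aestronglyMeasurable
        (Eventually.of_forall fun p => hM₂ p.1 p.2)).congr (Eventually.of_forall fun p => ?_)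
      simp only [Function.uncurry]; ring
    have h3 : ∫ x, (starRingEnd ℂ) (g x) * (∫ x', ttStar μ K x x' * g x' ∂μ) ∂μ =
        ∫ p, (starRingEnd ℂ) (g p.1) * (ttStar μ K p.1 p.2 * g p.2) ∂(μ.prod μ) := by
      rw [integral_prod _ i3]
      congr 1; funext x; exact (integral_const_mul _ _).symm
    rw [h3]
    -- The bound |g(x)g(x')| ≤ (|g(x)|² + |g(x')|²)/2 is used here. The two halves agree because |T
    -- T*(x,x')| is symmetric, so a bound on one marginal suffices.
    refine (norm_integral_le_of_norm_le ((i1.add i2).const_mul (1 / 2))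
      (Eventually.of_forall fun p => ?_)).trans ?_
    · simp only [norm_mul, RCLike.norm_conj, Pi.add_apply]
      nlinarith [mul_nonneg (norm_nonneg (ttStar μ K p.1 p.2)) (sq_nonneg (‖g p.1‖ - ‖g p.2‖))]
    · rw [integral_const_mul]
      simp only [Pi.add_apply]
      rw [integral_add i1 i2, b2]
      linarith
  have e4 : G ≤ M * Φ := by
    have h1 : G ^ 2 ≤ Φ * H := by
      calc G ^ 2 ≤ (Real.sqrt Φ * Real.sqrt H) ^ 2 := by gcongr
        _ = Φ * H := by rw [mul_pow, Real.sq_sqrt Φ0, Real.sq_sqrt H0]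
    have h2 : G * G ≤ (M * Φ) * G := by nlinarith [mul_le_mul_of_nonneg_left e3 Φ0]
    rcases G0.eq_or_lt with h0 | h0
    · rw [← h0]; positivity
    · exact le_of_mul_le_mul_right h2 h0
  change eLpNorm g 2 μ ≤ _
  rw [sq_eLpNorm_two gL, sq_eLpNorm_two hf, ← ENNReal.ofReal_mul (Real.sqrt_nonneg _),
    ← Real.sqrt_mul hM0]
  exact ENNReal.ofReal_le_ofReal (Real.sqrt_le_sqrt e4)

lemma memLp_two_restrict (I : Set ℝ) (f : Lp ℂ 2 (volume : Measure ℝ)) :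
    MemLp f 2 (volume.restrict I) := (Lp.memLp f).restrict I

/-- Since K lives on I × I, an estimate for the measure restricted to I is an estimate on the whole
line. This is the passage from `OpBound` to the continuous linear map that `NormDecay` asks for. -/
theorem exists_isIntegralOperator {I : Set ℝ} (hIm : MeasurableSet I)
    [IsFiniteMeasure (volume.restrict I)] (hK : BddKernel K)
    (hs : ∀ x y, K x y ≠ 0 → x ∈ I ∧ y ∈ I) {A : ℝ} (hA : 0 ≤ A)
    (h : OpBound (volume.restrict I) K A) :
    ∃ T : Lp ℂ 2 (volume : Measure ℝ) →L[ℂ] Lp ℂ 2 (volume : Measure ℝ),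
      IsIntegralOperator (fun p => K p.1 p.2) T ∧ ‖T‖ ≤ A := by
  have hz : ∀ x y, y ∉ I → K x y = 0 := fun x y hy => by
    by_contra hne; exact hy (hs x y hne).2
  have hzx : ∀ x y, x ∉ I → K x y = 0 := fun x y hy => by
    by_contra hne; exact hy (hs x y hne).1
  have hrestr : ∀ (f : ℝ → ℂ) x, ∫ y, K x y * f y = ∫ y in I, K x y * f y := fun f x =>
    (setIntegral_eq_integral_of_forall_compl_eq_zero fun y hy => by rw [hz x y hy, zero_mul]).symm
  have hint : ∀ (f : Lp ℂ 2 (volume : Measure ℝ)) x, Integrable (fun y => K x y * f y) := by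
    intro f x
    have hi : Integrable f (volume.restrict I) := (memLp_two_restrict I f).integrable (by norm_num)
    have h1 : IntegrableOn (fun y => K x y * f y) I := hK.integrable_left x hi
    exact (integrableOn_iff_integrable_of_support_subset (fun y hy => by
      by_contra hne; exact hy (by simp [hz x y hne]))).1 h1
  have hind : ∀ f : ℝ → ℂ, (fun x => ∫ y, K x y * f y) =
      I.indicator (fun x => ∫ y in I, K x y * f y) := by
    intro f; funext x
    by_cases hx : x ∈ I
    · rw [indicator_of_mem hx, hrestr]
    · rw [indicator_of_notMem hx]; simp [hzx x _ hx]
  have hmeas : ∀ f : Lp ℂ 2 (volume : Measure ℝ),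
      AEStronglyMeasurable (fun x => ∫ y, K x y * f y) volume := by
    intro f
    rw [hind, aestronglyMeasurable_indicator_iff hIm]
    exact hK.aestronglyMeasurable_integral (memLp_two_restrict I f).1
  have hnorm : ∀ f : Lp ℂ 2 (volume : Measure ℝ),
      eLpNorm (fun x => ∫ y, K x y * f y) 2 volume ≤ ENNReal.ofReal A * eLpNorm f 2 volume := by
    intro f
    rw [hind, eLpNorm_indicator_eq_eLpNorm_restrict hIm]
    refine (h f (memLp_two_restrict I f)).trans ?_
    gcongr
    exact Measure.restrict_le_self
  have hmem : ∀ f : Lp ℂ 2 (volume : Measure ℝ), MemLp (fun x => ∫ y, K x y * f y) 2 volume :=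
    fun f => ⟨hmeas f, (hnorm f).trans_lt (ENNReal.mul_lt_top ENNReal.ofReal_lt_top
      (Lp.memLp f).2)⟩
  let T₀ : Lp ℂ 2 (volume : Measure ℝ) →ₗ[ℂ] Lp ℂ 2 (volume : Measure ℝ) :=
    { toFun := fun f => (hmem f).toLp _
      map_add' := fun f g => by
        rw [← MemLp.toLp_add]
        refine MemLp.toLp_congr _ _ (Eventually.of_forall fun x => ?_)
        simp only [Pi.add_apply]
        rw [← integral_add (hint f x) (hint g x)]
        refine integral_congr_ae ?_
        filter_upwards [Lp.coeFn_add f g] with y hy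
        rw [hy]; simp [mul_add]
      map_smul' := fun c f => by
        rw [RingHom.id_apply, ← MemLp.toLp_const_smul]
        refine MemLp.toLp_congr _ _ (Eventually.of_forall fun x => ?_)
        simp only [Pi.smul_apply]
        rw [← integral_smul]
        refine integral_congr_ae ?_
        filter_upwards [Lp.coeFn_smul c f] with y hy
        rw [hy]; simp; ring }
  have hT : ∀ f, ‖T₀ f‖ ≤ A * ‖f‖ := by
    intro f
    have h1 : ‖T₀ f‖ = (eLpNorm (fun x => ∫ y, K x y * f y) 2 volume).toReal :=
      Lp.norm_toLp _ (hmem f)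
    rw [h1, Lp.norm_def, ← ENNReal.toReal_ofReal hA, ← ENNReal.toReal_mul]
    exact ENNReal.toReal_mono (ENNReal.mul_ne_top ENNReal.ofReal_ne_top (Lp.memLp f).2.ne)
      (hnorm f)
  refine ⟨T₀.mkContinuous A hT, fun f => ⟨fun x => hint f x, ?_⟩, T₀.mkContinuous_norm_le hA hT⟩
  exact (hmem f).coeFn_toLp

end Operators

/-! ### Functions with a nonvanishing higher derivative -/

/-- `H (i + 1)` is the derivative of `H i` on `I`, for every `i`. -/
def DerivChain (I : Set ℝ) (H : ℕ → ℝ → ℝ) : Prop :=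
  ∀ i, ∀ y ∈ I, HasDerivAt (H i) (H (i + 1) y) y

/-- `f` is everywhere `≥ c` or everywhere `≤ -c` on `J`. -/
def Away {X : Type*} (J : Set X) (f : X → ℝ) (c : ℝ) : Prop :=
  (∀ y ∈ J, c ≤ f y) ∨ (∀ y ∈ J, f y ≤ -c)

lemma Away.subset {X : Type*} {J J' : Set X} {f : X → ℝ} {c : ℝ} (h : Away J f c) (hJ : J' ⊆ J) :
    Away J' f c :=
  h.imp (fun h y hy => h y (hJ hy)) (fun h y hy => h y (hJ hy))

lemma Away.weaken {X : Type*} {J : Set X} {f : X → ℝ} {c c' : ℝ} (h : Away J f c) (hc : c' ≤ c) :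
    Away J f c' :=
  h.imp (fun h y hy => hc.trans (h y hy)) (fun h y hy => (h y hy).trans (neg_le_neg hc))

lemma Away.le_abs {X : Type*} {J : Set X} {f : X → ℝ} {c : ℝ} (h : Away J f c) {y : X}
    (hy : y ∈ J) : c ≤ |f y| := by
  rcases h with h | h
  · exact (h y hy).trans (le_abs_self _)
  · have := h y hy
    exact (by linarith : c ≤ -f y).trans (neg_le_abs _)

/-- With constant 0, `Away` is just the weak statement that the derivative keeps one sign; most
partition arguments use it in this form. -/
lemma monotoneOn_or_antitoneOn {J : Set ℝ} (hJ : OrdConnected J) {f f' : ℝ → ℝ}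
    (hf : ∀ y ∈ J, HasDerivAt f (f' y) y) (h : Away J f' 0) : MonotoneOn f J ∨ AntitoneOn f J := by
  have hc : ContinuousOn f J := fun y hy => (hf y hy).continuousAt.continuousWithinAt
  refine h.imp (fun h => ?_) (fun h => ?_)
  · exact monotoneOn_of_hasDerivWithinAt_nonneg hJ.convex hc
      (fun y hy => (hf y (interior_subset hy)).hasDerivWithinAt) fun y hy => h y (interior_subset hy)
  · exact antitoneOn_of_hasDerivWithinAt_nonpos hJ.convex hc
      (fun y hy => (hf y (interior_subset hy)).hasDerivWithinAt)
      fun y hy => by simpa using h y (interior_subset hy)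

/-- This is what makes sharp cutoffs usable: where a function is monotone, confining its values to
an interval leaves an interval of integration. -/
lemma ordConnected_inter_preimage {J T : Set ℝ} (hJ : OrdConnected J) (hT : OrdConnected T)
    {f : ℝ → ℝ} (h : MonotoneOn f J ∨ AntitoneOn f J) : OrdConnected (J ∩ f ⁻¹' T) := by
  refine ⟨fun a ha b hb y hy => ?_⟩
  have hyJ : y ∈ J := hJ.out ha.1 hb.1 hy
  refine ⟨hyJ, ?_⟩
  rcases h with h | h
  · exact hT.out ha.2 hb.2 ⟨h ha.1 hyJ hy.1, h hyJ hb.1 hy.2⟩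
  · exact hT.out hb.2 ha.2 ⟨h hyJ hb.1 hy.2, h ha.1 hyJ hy.1⟩

/-- If the derivative of order `n + 1` has constant sign on an interval, the interval splits into at
most `2 ^ n` intervals on which the first derivative has constant sign. -/
lemma exists_sign_partition {I : Set ℝ} (hI : OrdConnected I) (n : ℕ) :
    ∀ H : ℕ → ℝ → ℝ, DerivChain I H → Away I (H (n + 1)) 0 →
      ∃ l : ℝ → ℕ, (∀ y, l y < 2 ^ n) ∧
        ∀ k, OrdConnected (I ∩ l ⁻¹' {k}) ∧ Away (I ∩ l ⁻¹' {k}) (H 1) 0 := by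
  induction n with
  | zero =>
    intro H _ hs
    refine ⟨fun _ => 0, fun _ => by simp, fun k => ⟨?_, hs.subset inter_subset_left⟩⟩
    by_cases hk : k = 0
    · subst hk
      simpa using hI
    · have : I ∩ (fun _ : ℝ => 0) ⁻¹' {k} = ∅ := by
        ext y; simp [Ne.symm hk]
      rw [this]; exact ordConnected_empty
  | succ n ih =>
    intro H hH hs
    obtain ⟨l, hl, hk⟩ := ih (fun i => H (i + 1)) (fun i y hy => hH (i + 1) y hy) hs
    classical
    -- Induction on the shifted chain makes H 2 of one sign on each piece, so H 1 is monotone there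
    -- and the piece splits once, where H 1 changes sign. The label appends that sign as a binary
    -- digit, whence 2 ^ n.
    refine ⟨fun y => 2 * l y + if 0 ≤ H 1 y then 1 else 0, fun y => ?_, fun k => ?_⟩
    · have := hl y
      rw [pow_succ]
      dsimp only
      split_ifs <;> omega
    · have hm : MonotoneOn (H 1) (I ∩ l ⁻¹' {k / 2}) ∨ AntitoneOn (H 1) (I ∩ l ⁻¹' {k / 2}) :=
        monotoneOn_or_antitoneOn (hk (k / 2)).1 (fun y hy => hH 1 y hy.1) (hk (k / 2)).2
      rcases Nat.even_or_odd' k with ⟨j, rfl | rfl⟩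
      · have e : I ∩ (fun y => 2 * l y + if 0 ≤ H 1 y then 1 else 0) ⁻¹' {2 * j} =
            (I ∩ l ⁻¹' {(2 * j) / 2}) ∩ H 1 ⁻¹' Iio 0 := by
          ext y
          simp only [mem_inter_iff, mem_preimage, mem_singleton_iff, mem_Iio]
          by_cases h0 : 0 ≤ H 1 y
          · simp only [h0, if_true, not_lt.2 h0, and_false, iff_false]
            rintro ⟨_, h⟩; omega
          · have : 2 * l y + 0 = 2 * j ↔ l y = 2 * j / 2 := by omega
            simp only [h0, if_false, not_le.1 h0, and_true, this]
        rw [e]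
        exact ⟨ordConnected_inter_preimage (hk _).1 ordConnected_Iio hm,
          Or.inr fun y hy => by simpa using (mem_Iio.1 hy.2).le⟩
      · have e : I ∩ (fun y => 2 * l y + if 0 ≤ H 1 y then 1 else 0) ⁻¹' {2 * j + 1} =
            (I ∩ l ⁻¹' {(2 * j + 1) / 2}) ∩ H 1 ⁻¹' Ici 0 := by
          ext y
          simp only [mem_inter_iff, mem_preimage, mem_singleton_iff, mem_Ici]
          by_cases h0 : 0 ≤ H 1 y
          · have : 2 * l y + 1 = 2 * j + 1 ↔ l y = (2 * j + 1) / 2 := by omega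
            simp only [h0, if_true, and_true, this]
          · simp only [h0, if_false, and_false, iff_false]
            rintro ⟨_, h⟩; omega
        rw [e]
        exact ⟨ordConnected_inter_preimage (hk _).1 ordConnected_Ici hm, Or.inl fun y hy => hy.2⟩

/-- On an interval where `|h| ≤ a` and `|h⁽ⁿ⁾| ≥ c`, the length is `O((a / c) ^ (1 / n))`. -/
lemma exists_sublevel_length (n : ℕ) : ∃ K : ℝ, 0 < K ∧ ∀ (H : ℕ → ℝ → ℝ) (p q a c : ℝ), p < q →
    0 < c → DerivChain (Icc p q) H → Away (Icc p q) (H n) c → (∀ y ∈ Icc p q, |H 0 y| ≤ a) →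
      c * (q - p) ^ n ≤ K * a := by
  induction n with
  | zero =>
    refine ⟨1, one_pos, fun H p q a c hpq hc hH hA ha => ?_⟩
    have hp : p ∈ Icc p q := left_mem_Icc.2 hpq.le
    simpa using (hA.le_abs hp).trans (ha p hp)
  | succ n ih =>
    obtain ⟨K, hK, h⟩ := ih
    refine ⟨2 ^ (n + 2) * K, by positivity, fun H p q a c hpq hc hH hA ha => ?_⟩
    -- The induction runs on the difference H(· + s) - H on the left half of the interval. By the
    -- mean value theorem its derivative of order n is at least cs in size, and the difference
    -- itself is at most 2a. Each step thus costs a factor depending only on n.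
    set s := (q - p) / 2 with hs
    have hs0 : 0 < s := by rw [hs]; linarith
    have hmem : ∀ y ∈ Icc p (q - s), y ∈ Icc p q ∧ y + s ∈ Icc p q := fun y hy =>
      ⟨⟨hy.1, hy.2.trans (by linarith)⟩, ⟨by linarith [hy.1], by linarith [hy.2]⟩⟩
    have hslope : ∀ y ∈ Icc p (q - s), ∃ ξ ∈ Icc p q,
        H n (y + s) - H n y = s * H (n + 1) ξ := by
      intro y hy
      have hsub : Icc y (y + s) ⊆ Icc p q := Icc_subset_Icc (hmem y hy).1.1 (hmem y hy).2.2
      obtain ⟨ξ, hξ, e⟩ := exists_hasDerivAt_eq_slope (H n) (H (n + 1)) (by linarith : y < y + s)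
        (fun z hz => (hH n z (hsub hz)).continuousAt.continuousWithinAt)
        (fun z hz => hH n z (hsub (Ioo_subset_Icc_self hz)))
      refine ⟨ξ, hsub (Ioo_subset_Icc_self hξ), ?_⟩
      rw [e, add_sub_cancel_left]; field_simp
    have key := h (fun i y => H i (y + s) - H i y) p (q - s) (2 * a) (c * s) (by linarith)
      (by positivity) ?_ ?_ ?_
    · have e : q - s - p = s := by rw [hs]; ring
      have e2 : q - p = 2 * s := by rw [hs]; ring
      rw [e] at key
      rw [e2, mul_pow]
      calc c * (2 ^ (n + 1) * s ^ (n + 1)) = 2 ^ (n + 1) * (c * s * s ^ n) := by ring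
        _ ≤ 2 ^ (n + 1) * (K * (2 * a)) := by gcongr
        _ = 2 ^ (n + 2) * K * a := by ring
    · intro i y hy
      exact ((hH i _ (hmem y hy).2).comp_add_const y s).sub (hH i y (hmem y hy).1)
    · rcases hA with hA | hA
      · refine Or.inl fun y hy => ?_
        obtain ⟨ξ, hξ, e⟩ := hslope y hy
        simp only [e]
        rw [mul_comm]
        exact mul_le_mul_of_nonneg_left (hA ξ hξ) hs0.le
      · refine Or.inr fun y hy => ?_
        obtain ⟨ξ, hξ, e⟩ := hslope y hy
        simp only [e]
        nlinarith [hA ξ hξ]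
    · intro y hy
      have h1 := abs_le.1 (ha y (hmem y hy).1)
      have h2 := abs_le.1 (ha _ (hmem y hy).2)
      exact abs_le.2 ⟨by linarith [h1.2, h2.1], by linarith [h1.1, h2.2]⟩

/-- The measure of a sublevel set of a function with a nonvanishing derivative of order `n + 1`. -/
lemma exists_sublevel_measure (n : ℕ) (c : ℝ) (hc : 0 < c) : ∃ C : ℝ, 0 < C ∧
    ∀ (I : Set ℝ) (H : ℕ → ℝ → ℝ), OrdConnected I → DerivChain I H → Away I (H (n + 1)) c →
      ∀ a, 0 < a → volume (I ∩ {y | |H 0 y| ≤ a}) ≤ ENNReal.ofReal (C * a ^ ((n + 1 : ℝ)⁻¹)) := by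
  obtain ⟨K, hK, h⟩ := exists_sublevel_length (n + 1)
  refine ⟨2 ^ n * (K / c) ^ ((n + 1 : ℝ)⁻¹), by positivity, fun I H hI hH hA a ha => ?_⟩
  obtain ⟨l, hl, hk⟩ := exists_sign_partition hI n H hH (hA.weaken hc.le)
  have e : I ∩ {y | |H 0 y| ≤ a} ⊆
      ⋃ k ∈ Finset.range (2 ^ n), I ∩ l ⁻¹' {k} ∩ {y | |H 0 y| ≤ a} := by
    intro y hy
    simp only [mem_iUnion, Finset.mem_range]
    exact ⟨l y, hl y, ⟨hy.1, rfl⟩, hy.2⟩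
  have hpiece : ∀ k, volume (I ∩ l ⁻¹' {k} ∩ {y | |H 0 y| ≤ a}) ≤
      ENNReal.ofReal ((K / c * a) ^ ((n + 1 : ℝ)⁻¹)) := by
    intro k
    -- On a piece H 0 is monotone, so the sublevel set is an interval there and the length bound
    -- applies to any two of its points.
    have hm := monotoneOn_or_antitoneOn (hk k).1 (fun y hy => hH 0 y hy.1) (hk k).2
    have hoc : OrdConnected (I ∩ l ⁻¹' {k} ∩ {y | |H 0 y| ≤ a}) := by
      have : {y | |H 0 y| ≤ a} = H 0 ⁻¹' Icc (-a) a := by ext y; simp [abs_le]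
      rw [this]
      exact ordConnected_inter_preimage (hk k).1 ordConnected_Icc hm
    have hle : ∀ x ∈ I ∩ l ⁻¹' {k} ∩ {y | |H 0 y| ≤ a}, ∀ y ∈ I ∩ l ⁻¹' {k} ∩ {y | |H 0 y| ≤ a},
        x < y → y - x ≤ (K / c * a) ^ ((n + 1 : ℝ)⁻¹) := by
      intro x hx y hy hxy
      have hsub : Icc x y ⊆ I ∩ l ⁻¹' {k} ∩ {y | |H 0 y| ≤ a} := hoc.out hx hy
      have := h H x y a c hxy hc (fun i z hz => hH i z (hsub hz).1.1)
        (hA.subset fun z hz => (hsub hz).1.1) fun z hz => (hsub hz).2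
      rw [Real.le_rpow_inv_iff_of_pos (by linarith) (by positivity) (by positivity)]
      have e : (y - x) ^ ((n : ℝ) + 1) = (y - x) ^ (n + 1) := by
        rw [← Real.rpow_natCast]; push_cast; rfl
      rw [e, div_mul_eq_mul_div, le_div_iff₀ hc]
      linarith
    refine (Real.volume_le_diam _).trans (Metric.ediam_le fun x hx y hy => ?_)
    rw [edist_dist]
    refine ENNReal.ofReal_le_ofReal ?_
    rw [Real.dist_eq]
    rcases lt_trichotomy x y with hxy | hxy | hxy
    · rw [abs_sub_comm, abs_of_pos (by linarith)]; exact hle x hx y hy hxy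
    · subst hxy; simp; positivity
    · rw [abs_of_pos (by linarith)]; exact hle y hy x hx hxy
  calc volume (I ∩ {y | |H 0 y| ≤ a}) ≤ _ := measure_mono e
    _ ≤ ∑ k ∈ Finset.range (2 ^ n), volume (I ∩ l ⁻¹' {k} ∩ {y | |H 0 y| ≤ a}) :=
        measure_biUnion_finset_le _ _
    _ ≤ ∑ _k ∈ Finset.range (2 ^ n), ENNReal.ofReal ((K / c * a) ^ ((n + 1 : ℝ)⁻¹)) :=
        Finset.sum_le_sum fun k _ => hpiece k
    _ = ENNReal.ofReal (2 ^ n * (K / c) ^ ((n + 1 : ℝ)⁻¹) * a ^ ((n + 1 : ℝ)⁻¹)) := by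
        rw [Finset.sum_const, Finset.card_range, nsmul_eq_mul,
          Real.mul_rpow (by positivity) ha.le, mul_assoc (2 ^ n : ℝ),
          ENNReal.ofReal_mul (by positivity : (0 : ℝ) ≤ 2 ^ n)]
        congr 1
        rw [ENNReal.ofReal_pow (by norm_num)]; simp

/-! ### Oscillatory integrals in one variable -/

/-- The integral over a bounded interval, approximated by integrals over compact subintervals. -/
lemma norm_setIntegral_le_of_compact {J : Set ℝ} (hJ : OrdConnected J) {α β : ℝ}
    (hb : J ⊆ Icc α β) {f : ℝ → ℂ} (hf : ContinuousOn f J) {M B : ℝ} (hM : ∀ y ∈ J, ‖f y‖ ≤ M)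
    (hB0 : 0 ≤ B) (hB : ∀ η > 0, ∃ η' ∈ Ioc 0 η, ∀ p ∈ J, ∀ q ∈ J, p ≤ q → p = sInf J + η' →
      q = sSup J - η' → ‖∫ y in p..q, f y‖ ≤ B + η) :
    ‖∫ y in J, f y‖ ≤ B := by
  rcases J.eq_empty_or_nonempty with rfl | ⟨y₀, hy₀⟩
  · simpa using hB0
  have hM0 : 0 ≤ M := (norm_nonneg _).trans (hM y₀ hy₀)
  have hbb : BddBelow J := bddBelow_Icc.mono hb
  have hba : BddAbove J := bddAbove_Icc.mono hb
  have hJm := hJ.measurableSet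
  have hfin : volume J ≠ ⊤ := (measure_mono hb).trans_lt (by simp) |>.ne
  have hint : IntegrableOn f J := by
    refine ⟨hf.aestronglyMeasurable hJm, ?_⟩
    exact HasFiniteIntegral.restrict_of_bounded M hfin.lt_top
      ((ae_restrict_iff' hJm).2 (Eventually.of_forall hM))
  set s := sInf J
  set t := sSup J
  have hsub : J ⊆ Icc s t := fun y hy => ⟨csInf_le hbb hy, le_csSup hba hy⟩
  have hst : s ≤ t := (hsub hy₀).1.trans (hsub hy₀).2
  rcases hst.eq_or_lt with hst | hst
  · have : volume J = 0 := measure_mono_null hsub (by rw [hst]; simp)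
    rw [setIntegral_measure_zero _ this]; simpa using hB0
  refine le_of_forall_pos_le_add fun ε hε => ?_
  -- The first condition keeps the two cut points in order. The second absorbs the slack η in the
  -- hypothesis together with the two discarded margins, which contribute at most 2ηM.
  obtain ⟨η, hη0, hη1, hη2⟩ : ∃ η > 0, η < (t - s) / 2 ∧ η + 2 * η * M ≤ ε := by
    refine ⟨min ((t - s) / 4) (ε / (1 + 2 * M)), lt_min (by linarith) (by positivity), ?_, ?_⟩
    · exact (min_le_left _ _).trans_lt (by linarith)
    · have : min ((t - s) / 4) (ε / (1 + 2 * M)) ≤ ε / (1 + 2 * M) := min_le_right _ _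
      rw [le_div_iff₀ (by positivity)] at this
      linarith
  obtain ⟨η', ⟨hη'0, hη'⟩, hBη⟩ := hB η hη0
  have hmem : ∀ y, s < y → y < t → y ∈ J := fun y h1 h2 => by
    obtain ⟨z, hz, hzy⟩ := exists_lt_of_csInf_lt ⟨y₀, hy₀⟩ h1
    obtain ⟨w, hw, hyw⟩ := exists_lt_of_lt_csSup ⟨y₀, hy₀⟩ h2
    exact hJ.out hz hw ⟨hzy.le, hyw.le⟩
  have hp : s + η' ∈ J := hmem _ (by linarith) (by linarith)
  have hq : t - η' ∈ J := hmem _ (by linarith) (by linarith)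
  have hpq : s + η' ≤ t - η' := by linarith
  have h1 := hBη _ hp _ hq hpq rfl rfl
  have hIJ : Icc (s + η') (t - η') ⊆ J := hJ.out hp hq
  have hsplit : ∫ y in J, f y = (∫ y in Icc (s + η') (t - η'), f y) +
      ∫ y in J \ Icc (s + η') (t - η'), f y := by
    rw [← setIntegral_union disjoint_sdiff_right (hJm.diff measurableSet_Icc)
      (hint.mono_set hIJ) (hint.mono_set sdiff_subset), union_sdiff_cancel hIJ]
  rw [intervalIntegral.integral_of_le hpq, ← integral_Icc_eq_integral_Ioc] at h1
  have hvol : volume.real (J \ Icc (s + η') (t - η')) ≤ 2 * η' := by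
    have hsub2 : J \ Icc (s + η') (t - η') ⊆ Icc s (s + η') ∪ Icc (t - η') t := by
      intro y hy
      have h3 := hsub hy.1
      by_cases h4 : y ≤ s + η'
      · exact Or.inl ⟨h3.1, h4⟩
      · refine Or.inr ⟨?_, h3.2⟩
        by_contra h5
        exact hy.2 ⟨(not_le.1 h4).le, (not_le.1 h5).le⟩
    refine (measureReal_mono hsub2 (by simp)).trans ((measureReal_union_le _ _).trans ?_)
    rw [Real.volume_real_Icc_of_le (by linarith), Real.volume_real_Icc_of_le (by linarith)]
    linarith
  have h2 : ‖∫ y in J \ Icc (s + η') (t - η'), f y‖ ≤ M * (2 * η') := by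
    refine (norm_setIntegral_le_of_norm_le_const
      ((measure_mono sdiff_subset).trans_lt hfin.lt_top) fun y hy => hM y hy.1).trans ?_
    gcongr
  rw [hsplit]
  refine (norm_add_le _ _).trans ?_
  nlinarith

lemma norm_exp_phase (l s : ℝ) : ‖Complex.exp (Complex.I * (l : ℂ) * (s : ℂ))‖ = 1 := by
  have := Complex.norm_exp_I_mul_ofReal (l * s)
  rwa [Complex.ofReal_mul, ← mul_assoc] at this

/-- Integration by parts against an oscillating exponential. -/
lemma norm_integral_exp_mul_le {p q : ℝ} (hpq : p ≤ q) {φ g : ℝ → ℝ} {u u₁ : ℝ → ℂ}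
    (hφ : ∀ y ∈ Icc p q, HasDerivAt φ (g y) y) (hg : ContinuousOn g (Icc p q))
    (hu : ∀ y ∈ Icc p q, HasDerivAt u (u₁ y) y) (hu₁ : ContinuousOn u₁ (Icc p q))
    {l : ℝ} (hl : 0 < l) :
    ‖∫ y in p..q, Complex.exp (Complex.I * (l : ℂ) * (φ y : ℂ)) * ((g y : ℂ) * u y)‖ ≤
      (‖u p‖ + ‖u q‖ + ‖∫ y in p..q, Complex.exp (Complex.I * (l : ℂ) * (φ y : ℂ)) * u₁ y‖) / l := by
  set E : ℝ → ℂ := fun y => Complex.exp (Complex.I * (l : ℂ) * (φ y : ℂ)) with hE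
  have hEd : ∀ y ∈ Icc p q, HasDerivAt E (E y * (Complex.I * l * g y)) y := fun y hy =>
    ((hφ y hy).ofReal_comp.const_mul (Complex.I * (l : ℂ))).cexp
  have hEc : ContinuousOn E (Icc p q) := fun y hy => (hEd y hy).continuousAt.continuousWithinAt
  have hgc : ContinuousOn (fun y => (g y : ℂ)) (Icc p q) :=
    Complex.continuous_ofReal.comp_continuousOn hg
  have hl' : (Complex.I * (l : ℂ)) ≠ 0 := by simp [hl.ne']
  have key := intervalIntegral.integral_mul_deriv_eq_deriv_mul (a := p) (b := q) (u := u) (v := E)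
    (u' := u₁) (v' := fun y => E y * (Complex.I * l * g y))
    (by rwa [uIcc_of_le hpq]) (by rwa [uIcc_of_le hpq])
    (ContinuousOn.intervalIntegrable (by rwa [uIcc_of_le hpq]))
    (ContinuousOn.intervalIntegrable (by
      rw [uIcc_of_le hpq]; exact hEc.mul (continuousOn_const.mul hgc)))
  have e1 : ∫ y in p..q, u y * (E y * (Complex.I * l * g y)) =
      (Complex.I * l) * ∫ y in p..q, E y * ((g y : ℂ) * u y) := by
    rw [← intervalIntegral.integral_const_mul]
    congr 1; funext y; ring
  have e2 : ∫ y in p..q, u₁ y * E y = ∫ y in p..q, E y * u₁ y := by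
    congr 1; funext y; ring
  rw [e1, e2] at key
  have h3 := congrArg norm key
  rw [norm_mul, norm_mul, Complex.norm_I, one_mul, Complex.norm_real, Real.norm_of_nonneg hl.le] at h3
  rw [le_div_iff₀ hl, mul_comm, h3]
  refine (norm_sub_le _ _).trans (add_le_add_left ?_ _)
  refine (norm_sub_le _ _).trans ?_
  rw [norm_mul, norm_mul, hE]
  simp only [norm_exp_phase]
  linarith

/-- The first derivative test of van der Corput for oscillatory integrals with an amplitude. -/
lemma norm_setIntegral_exp_le {J : Set ℝ} (hJ : OrdConnected J) {α β : ℝ} (hb : J ⊆ Icc α β)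
    {φ g g₁ : ℝ → ℝ} (hφ : ∀ y ∈ J, HasDerivAt φ (g y) y) (hg : ∀ y ∈ J, HasDerivAt g (g₁ y) y)
    (hg₁ : ContinuousOn g₁ J) (hs : Away J g₁ 0) {m : ℝ} (hm : 0 < m) (hgm : ∀ y ∈ J, m ≤ |g y|)
    {ψ ψ₁ : ℝ → ℂ} (hψ : ∀ y, HasDerivAt ψ (ψ₁ y) y) (hψ₁ : Continuous ψ₁) {M : ℝ}
    (hM : ∀ y, ‖ψ y‖ ≤ M) (hM₁ : ∀ y, ‖ψ₁ y‖ ≤ M) (hαβ : α ≤ β) {l : ℝ} (hl : 0 < l) :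
    ‖∫ y in J, Complex.exp (Complex.I * (l : ℂ) * (φ y : ℂ)) * ψ y‖ ≤
      (4 + (β - α)) * M / (l * m) := by
  have hM0 : 0 ≤ M := (norm_nonneg _).trans (hM 0)
  have hψc : Continuous ψ := continuous_iff_continuousAt.2 fun y => (hψ y).continuousAt
  refine norm_setIntegral_le_of_compact hJ hb ?_ (M := M) (fun y _ => ?_) ?_ ?_
  · refine ContinuousOn.mul (fun y hy => ?_) hψc.continuousOn
    exact ((hφ y hy).ofReal_comp.const_mul (Complex.I * (l : ℂ))).cexp.continuousAt.continuousWithinAt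
  · rw [norm_mul, norm_exp_phase, one_mul]; exact hM y
  · have : 0 ≤ β - α := sub_nonneg.2 hαβ
    positivity
  intro η hη
  refine ⟨η, ⟨hη, le_rfl⟩, fun p hp q hq hpq _ _ => ?_⟩
  suffices h : ‖∫ y in p..q, Complex.exp (Complex.I * (l : ℂ) * (φ y : ℂ)) * ψ y‖ ≤
      (4 + (β - α)) * M / (l * m) by linarith
  have hsub : Icc p q ⊆ J := hJ.out hp hq
  have hg0 : ∀ y ∈ J, g y ≠ 0 := fun y hy h0 => by
    have := hgm y hy; rw [h0, abs_zero] at this; linarith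
  have hgc : ContinuousOn g (Icc p q) := fun y hy =>
    (hg y (hsub hy)).continuousAt.continuousWithinAt
  have hgC : ContinuousOn (fun y => (g y : ℂ)) (Icc p q) :=
    Complex.continuous_ofReal.comp_continuousOn hgc
  have hg₁C : ContinuousOn (fun y => (g₁ y : ℂ)) (Icc p q) :=
    Complex.continuous_ofReal.comp_continuousOn (hg₁.mono hsub)
  have hg0' : ∀ y ∈ Icc p q, (g y : ℂ) ≠ 0 := fun y hy => by
    exact_mod_cast hg0 y (hsub hy)
  -- Dividing the amplitude by g makes the integrand exact. The constant 4 + (β - α) collects 2 from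
  -- the boundary terms, 2 from the total variation of 1/g, which telescopes because g₁ has one
  -- sign, and the length from ψ₁/g.
  set u : ℝ → ℂ := fun y => ψ y / g y with hu
  set u₁ : ℝ → ℂ := fun y => (ψ₁ y * g y - ψ y * g₁ y) / (g y : ℂ) ^ 2 with hu₁
  have hud : ∀ y ∈ Icc p q, HasDerivAt u (u₁ y) y := fun y hy =>
    (hψ y).div (hg y (hsub hy)).ofReal_comp (hg0' y hy)
  have hu₁c : ContinuousOn u₁ (Icc p q) :=
    ((hψ₁.continuousOn.mul hgC).sub (hψc.continuousOn.mul hg₁C)).div (hgC.pow 2)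
      fun y hy => pow_ne_zero 2 (hg0' y hy)
  have ibp := norm_integral_exp_mul_le hpq (fun y hy => hφ y (hsub hy)) hgc hud hu₁c hl
  have e : ∫ y in p..q, Complex.exp (Complex.I * (l : ℂ) * (φ y : ℂ)) * ((g y : ℂ) * u y) =
      ∫ y in p..q, Complex.exp (Complex.I * (l : ℂ) * (φ y : ℂ)) * ψ y := by
    refine intervalIntegral.integral_congr fun y hy => ?_
    rw [uIcc_of_le hpq] at hy
    simp only [hu]
    rw [mul_div_cancel₀ _ (hg0' y hy)]
  rw [e] at ibp
  have hub : ∀ y ∈ Icc p q, ‖u y‖ ≤ M / m := fun y hy => by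
    rw [hu, norm_div, Complex.norm_real]
    exact div_le_div₀ hM0 (hM y) hm (hgm y (hsub hy))
  -- the total variation of `1 / g`
  obtain ⟨σ, hσ, hσg⟩ : ∃ σ : ℝ, |σ| = 1 ∧ ∀ y ∈ J, |g₁ y| = σ * g₁ y := by
    rcases hs with hs | hs
    · exact ⟨1, by simp, fun y hy => by rw [one_mul, abs_of_nonneg (hs y hy)]⟩
    · exact ⟨-1, by simp, fun y hy => by
        rw [neg_one_mul, abs_of_nonpos (by simpa using hs y hy)]⟩
  have hcv : ContinuousOn (fun y => g₁ y / g y ^ 2) (Icc p q) :=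
    (hg₁.mono hsub).div (hgc.pow 2) fun y hy => pow_ne_zero 2 (hg0 y (hsub hy))
  have htv : ∫ y in p..q, |g₁ y| / g y ^ 2 ≤ 2 / m := by
    have h1 : ∫ y in p..q, g₁ y / g y ^ 2 = -(g q)⁻¹ - -(g p)⁻¹ := by
      refine intervalIntegral.integral_eq_sub_of_hasDerivAt (f := fun y => -(g y)⁻¹)
        (fun y hy => ?_) ?_
      · rw [uIcc_of_le hpq] at hy
        have := ((hg y (hsub hy)).inv (hg0 y (hsub hy))).neg
        have e : -(-g₁ y / g y ^ 2) = g₁ y / g y ^ 2 := by ring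
        rwa [e] at this
      · exact ContinuousOn.intervalIntegrable (by rwa [uIcc_of_le hpq])
    have h2 : ∫ y in p..q, |g₁ y| / g y ^ 2 = σ * ∫ y in p..q, g₁ y / g y ^ 2 := by
      rw [← intervalIntegral.integral_const_mul]
      refine intervalIntegral.integral_congr fun y hy => ?_
      rw [uIcc_of_le hpq] at hy
      rw [hσg y (hsub hy)]; ring
    have hinv : ∀ y ∈ J, |(g y)⁻¹| ≤ 1 / m := fun y hy => by
      rw [abs_inv, ← one_div]
      exact one_div_le_one_div_of_le hm (hgm y hy)
    rw [h2, h1]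
    refine (le_abs_self _).trans ?_
    rw [abs_mul, hσ, one_mul]
    have := abs_sub (-(g q)⁻¹) (-(g p)⁻¹)
    rw [abs_neg, abs_neg] at this
    have h3 := hinv p hp
    have h4 := hinv q hq
    calc _ ≤ _ := this
      _ ≤ 1 / m + 1 / m := add_le_add h4 h3
      _ = 2 / m := by ring
  have hrest : ‖∫ y in p..q, Complex.exp (Complex.I * (l : ℂ) * (φ y : ℂ)) * u₁ y‖ ≤
      M / m * (q - p) + M * (2 / m) := by
    have hiv : IntervalIntegrable (fun y => |g₁ y| / g y ^ 2) volume p q :=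
      ContinuousOn.intervalIntegrable (by
        rw [uIcc_of_le hpq]
        exact (hg₁.mono hsub).abs.div (hgc.pow 2) fun y hy => pow_ne_zero 2 (hg0 y (hsub hy)))
    have hic : IntervalIntegrable (fun _ : ℝ => M / m) volume p q := by simp
    have h1 : ‖∫ y in p..q, Complex.exp (Complex.I * (l : ℂ) * (φ y : ℂ)) * u₁ y‖ ≤
        ∫ y in p..q, (M / m + M * (|g₁ y| / g y ^ 2)) := by
      refine intervalIntegral.norm_integral_le_of_norm_le hpq
        (Eventually.of_forall fun y hy => ?_) (hic.add (hiv.const_mul M))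
      have hy' : y ∈ J := hsub (Ioc_subset_Icc_self hy)
      have hgy := hgm y hy'
      have hgpos : 0 < |g y| := hm.trans_le hgy
      rw [norm_mul, norm_exp_phase, one_mul]
      have h5 : u₁ y = ψ₁ y / g y - ψ y * (g₁ y / (g y : ℂ) ^ 2) := by
        have := hg0' y (Ioc_subset_Icc_self hy)
        simp only [hu₁]; field_simp
      rw [h5]
      refine (norm_sub_le _ _).trans (add_le_add ?_ ?_)
      · rw [norm_div, Complex.norm_real]
        exact div_le_div₀ hM0 (hM₁ y) hm hgy
      · rw [norm_mul, norm_div, norm_pow, Complex.norm_real, Complex.norm_real, Real.norm_eq_abs,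
          Real.norm_eq_abs, sq_abs]
        gcongr
        exact hM y
    refine h1.trans ?_
    rw [intervalIntegral.integral_add hic (hiv.const_mul M), intervalIntegral.integral_const_mul,
      intervalIntegral.integral_const]
    have : (q - p) • (M / m) = M / m * (q - p) := by rw [smul_eq_mul]; ring
    rw [this]
    gcongr
  have hqp : q - p ≤ β - α := by
    have h1 := (hb hp).1
    have h2 := (hb hq).2
    linarith
  refine ibp.trans ?_
  rw [← div_div, div_right_comm]
  gcongr
  have h1 := hub p (left_mem_Icc.2 hpq)
  have h2 := hub q (right_mem_Icc.2 hpq)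
  have h3 : M / m * (q - p) ≤ M / m * (β - α) := by gcongr
  calc _ ≤ M / m + M / m + (M / m * (β - α) + M * (2 / m)) := by linarith
    _ = (4 + (β - α)) * M / m := by ring

/-- Oscillatory integrals without stationary points, integrated by parts twice. -/
lemma norm_setIntegral_exp_le_sq {α β : ℝ} (hαβ : α < β) {φ g g₁ g₂ : ℝ → ℝ}
    (hφ : ∀ y ∈ Ioo α β, HasDerivAt φ (g y) y) (hg : ∀ y ∈ Ioo α β, HasDerivAt g (g₁ y) y)
    (hg₁ : ∀ y ∈ Ioo α β, HasDerivAt g₁ (g₂ y) y) (hg₂ : ContinuousOn g₂ (Ioo α β))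
    {c C : ℝ} (hc : 0 < c) (hgc : ∀ y ∈ Ioo α β, c ≤ |g y|) (hgC₁ : ∀ y ∈ Ioo α β, |g₁ y| ≤ C)
    (hgC₂ : ∀ y ∈ Ioo α β, |g₂ y| ≤ C) {ψ ψ₁ ψ₂ : ℝ → ℂ} (hψ : ∀ y, HasDerivAt ψ (ψ₁ y) y)
    (hψ₁ : ∀ y, HasDerivAt ψ₁ (ψ₂ y) y) (hψ₂ : Continuous ψ₂) (hψα : ψ α = 0) (hψβ : ψ β = 0)
    {M : ℝ} (hM : ∀ y, ‖ψ y‖ ≤ M) (hM₁ : ∀ y, ‖ψ₁ y‖ ≤ M) (hM₂ : ∀ y, ‖ψ₂ y‖ ≤ M)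
    {l : ℝ} (hl : 0 < l) :
    ‖∫ y in Ioo α β, Complex.exp (Complex.I * (l : ℂ) * (φ y : ℂ)) * ψ y‖ ≤
      (4 + 6 * (β - α)) * M * (1 / c + C / c ^ 2 + 2 * C ^ 2 / c ^ 3) ^ 2 / l ^ 2 := by
  have hM0 : 0 ≤ M := (norm_nonneg _).trans (hM 0)
  have hC0 : 0 ≤ C := by
    obtain ⟨y, hy⟩ := nonempty_Ioo.2 hαβ
    exact (abs_nonneg _).trans (hgC₁ y hy)
  -- R is a common bound for 1/g and its first two derivatives.
  set R := 1 / c + C / c ^ 2 + 2 * C ^ 2 / c ^ 3 with hR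
  have hR0 : 0 < R := by positivity
  have hβα : 0 < β - α := sub_pos.2 hαβ
  have hψc : Continuous ψ := continuous_iff_continuousAt.2 fun y => (hψ y).continuousAt
  have hψ₁c : Continuous ψ₁ := continuous_iff_continuousAt.2 fun y => (hψ₁ y).continuousAt
  have hlip : ∀ x y, ‖ψ x - ψ y‖ ≤ M * |x - y| := fun x y => by
    have := Convex.norm_image_sub_le_of_norm_hasDerivWithin_le (f := ψ) (f' := ψ₁) (s := univ)
      (fun z _ => (hψ z).hasDerivWithinAt) (fun z _ => hM₁ z) convex_univ (mem_univ y) (mem_univ x)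
    rwa [Real.norm_eq_abs] at this
  refine norm_setIntegral_le_of_compact ordConnected_Ioo Ioo_subset_Icc_self ?_ (M := M)
    (fun y _ => ?_) (by positivity) ?_
  · refine ContinuousOn.mul (fun y hy => ?_) hψc.continuousOn
    exact ((hφ y hy).ofReal_comp.const_mul (Complex.I * (l : ℂ))).cexp.continuousAt.continuousWithinAt
  · rw [norm_mul, norm_exp_phase, one_mul]; exact hM y
  intro η hη
  -- The phase is controlled only inside the open interval, so the first boundary terms do not
  -- vanish exactly. But ψ is M-Lipschitz and zero at α and β, so at distance η' they total at most
  -- 2MRη'/l ≤ η. The summand 1 prevents a zero denominator.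
  refine ⟨min η (η * l / (2 * M * R + 1)), ⟨lt_min hη (by positivity), min_le_left _ _⟩,
    fun p hp q hq hpq hp' hq' => ?_⟩
  set η' := min η (η * l / (2 * M * R + 1)) with hη'
  have hη'0 : 0 < η' := lt_min hη (by positivity)
  have hη'R : 2 * M * R * η' ≤ η * l := by
    have h1 : η' ≤ η * l / (2 * M * R + 1) := min_le_right _ _
    rw [le_div_iff₀ (by positivity)] at h1
    nlinarith
  rw [csInf_Ioo hαβ] at hp'
  rw [csSup_Ioo hαβ] at hq'
  have hsub : Icc p q ⊆ Ioo α β := ordConnected_Ioo.out hp hq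
  set r : ℝ → ℝ := fun y => (g y)⁻¹ with hr
  set r₁ : ℝ → ℝ := fun y => -g₁ y / g y ^ 2 with hr₁
  set r₂ : ℝ → ℝ := fun y => ((-g₂ y) * g y ^ 2 - (-g₁ y) * (2 * g y * g₁ y)) / (g y ^ 2) ^ 2 with hr₂
  have hg0 : ∀ y ∈ Ioo α β, g y ≠ 0 := fun y hy h0 => by
    have := hgc y hy; rw [h0, abs_zero] at this; linarith
  have hrd : ∀ y ∈ Ioo α β, HasDerivAt r (r₁ y) y := fun y hy => (hg y hy).inv (hg0 y hy)
  have hr₁d : ∀ y ∈ Ioo α β, HasDerivAt r₁ (r₂ y) y := fun y hy => by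
    have h2 : HasDerivAt (fun y => g y ^ 2) (2 * g y * g₁ y) y := by
      simpa using (hg y hy).fun_pow 2
    exact (hg₁ y hy).neg.div h2 (pow_ne_zero 2 (hg0 y hy))
  have hrR : ∀ y ∈ Ioo α β, |r y| ≤ R := fun y hy => by
    rw [hr, abs_inv, ← one_div]
    calc 1 / |g y| ≤ 1 / c := one_div_le_one_div_of_le hc (hgc y hy)
      _ ≤ R := by
        rw [hR, add_assoc]; exact le_add_of_nonneg_right (by positivity)
  have hr₁R : ∀ y ∈ Ioo α β, |r₁ y| ≤ R := fun y hy => by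
    rw [hr₁, abs_div, abs_neg, abs_pow]
    calc |g₁ y| / |g y| ^ 2 ≤ C / c ^ 2 :=
          div_le_div₀ hC0 (hgC₁ y hy) (by positivity) (pow_le_pow_left₀ hc.le (hgc y hy) 2)
      _ ≤ R := by
        have h1 : 0 ≤ 1 / c := by positivity
        have h2 : 0 ≤ 2 * C ^ 2 / c ^ 3 := by positivity
        rw [hR]; linarith
  have hr₂R : ∀ y ∈ Ioo α β, |r₂ y| ≤ R := fun y hy => by
    have hgp : 0 < |g y| := hc.trans_le (hgc y hy)
    have e : r₂ y = -g₂ y / g y ^ 2 + 2 * g₁ y ^ 2 / g y ^ 3 := by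
      have := hg0 y hy
      simp only [hr₂]; field_simp; ring
    rw [e]
    refine (abs_add_le _ _).trans ?_
    rw [abs_div, abs_neg, abs_pow, abs_div, abs_mul, abs_pow, abs_pow, abs_two]
    have h3 : |g₂ y| / |g y| ^ 2 ≤ C / c ^ 2 :=
      div_le_div₀ hC0 (hgC₂ y hy) (by positivity) (pow_le_pow_left₀ hc.le (hgc y hy) 2)
    have h4 : 2 * |g₁ y| ^ 2 / |g y| ^ 3 ≤ 2 * C ^ 2 / c ^ 3 :=
      div_le_div₀ (by positivity)
        (mul_le_mul_of_nonneg_left (pow_le_pow_left₀ (abs_nonneg _) (hgC₁ y hy) 2) (by norm_num))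
        (by positivity) (pow_le_pow_left₀ hc.le (hgc y hy) 3)
    have h5 : 0 ≤ 1 / c := by positivity
    rw [hR]; linarith
  have hgcont : ContinuousOn g (Icc p q) := fun y hy =>
    (hg y (hsub hy)).continuousAt.continuousWithinAt
  have hg₁cont : ContinuousOn g₁ (Icc p q) := fun y hy =>
    (hg₁ y (hsub hy)).continuousAt.continuousWithinAt
  have hrc : ContinuousOn (fun y => (r y : ℂ)) (Icc p q) := fun y hy =>
    (hrd y (hsub hy)).ofReal_comp.continuousAt.continuousWithinAt
  have hr₁c : ContinuousOn (fun y => (r₁ y : ℂ)) (Icc p q) := fun y hy =>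
    (hr₁d y (hsub hy)).ofReal_comp.continuousAt.continuousWithinAt
  have hr₂c : ContinuousOn (fun y => (r₂ y : ℂ)) (Icc p q) := by
    refine Complex.continuous_ofReal.comp_continuousOn ?_
    refine ContinuousOn.div ?_ ((hgcont.pow 2).pow 2) fun y hy =>
      pow_ne_zero 2 (pow_ne_zero 2 (hg0 y (hsub hy)))
    exact ((hg₂.mono hsub).neg.mul (hgcont.pow 2)).sub
      (hg₁cont.neg.mul ((continuousOn_const.mul hgcont).mul hg₁cont))
  -- The functions u and w are the amplitudes after one and two divisions by the phase derivative.
  -- Boundary terms of w are merely bounded, which is enough since they already carry l⁻².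
  set u : ℝ → ℂ := fun y => ψ y * r y with hu
  set u₁ : ℝ → ℂ := fun y => ψ₁ y * r y + ψ y * r₁ y with hu₁
  set w : ℝ → ℂ := fun y => u₁ y * r y with hw
  set w₁ : ℝ → ℂ := fun y => ((ψ₂ y * r y + ψ₁ y * r₁ y) + (ψ₁ y * r₁ y + ψ y * r₂ y)) * r y +
    u₁ y * r₁ y with hw₁
  have hud : ∀ y ∈ Icc p q, HasDerivAt u (u₁ y) y := fun y hy =>
    (hψ y).mul (hrd y (hsub hy)).ofReal_comp
  have hu₁d : ∀ y ∈ Icc p q, HasDerivAt u₁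
      ((ψ₂ y * r y + ψ₁ y * r₁ y) + (ψ₁ y * r₁ y + ψ y * r₂ y)) y := fun y hy =>
    ((hψ₁ y).mul (hrd y (hsub hy)).ofReal_comp).add ((hψ y).mul (hr₁d y (hsub hy)).ofReal_comp)
  have hwd : ∀ y ∈ Icc p q, HasDerivAt w (w₁ y) y := fun y hy =>
    (hu₁d y hy).mul (hrd y (hsub hy)).ofReal_comp
  have hu₁c : ContinuousOn u₁ (Icc p q) := fun y hy =>
    (hu₁d y hy).continuousAt.continuousWithinAt
  have hw₁c : ContinuousOn w₁ (Icc p q) :=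
    ((((hψ₂.continuousOn.mul hrc).add (hψ₁c.continuousOn.mul hr₁c)).add
      ((hψ₁c.continuousOn.mul hr₁c).add (hψc.continuousOn.mul hr₂c))).mul hrc).add (hu₁c.mul hr₁c)
  have hgr : ∀ y ∈ Icc p q, (g y : ℂ) * r y = 1 := fun y hy => by
    have := hg0 y (hsub hy)
    simp only [hr, Complex.ofReal_inv]
    exact mul_inv_cancel₀ (by exact_mod_cast this)
  have ibp1 := norm_integral_exp_mul_le hpq (fun y hy => hφ y (hsub hy)) hgcont hud hu₁c hl
  have ibp2 := norm_integral_exp_mul_le hpq (fun y hy => hφ y (hsub hy)) hgcont hwd hw₁c hl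
  have e1 : ∫ y in p..q, Complex.exp (Complex.I * (l : ℂ) * (φ y : ℂ)) * ((g y : ℂ) * u y) =
      ∫ y in p..q, Complex.exp (Complex.I * (l : ℂ) * (φ y : ℂ)) * ψ y := by
    refine intervalIntegral.integral_congr fun y hy => ?_
    rw [uIcc_of_le hpq] at hy
    simp only [hu]
    rw [mul_left_comm (g y : ℂ), hgr y hy, mul_one]
  have e2 : ∫ y in p..q, Complex.exp (Complex.I * (l : ℂ) * (φ y : ℂ)) * ((g y : ℂ) * w y) =
      ∫ y in p..q, Complex.exp (Complex.I * (l : ℂ) * (φ y : ℂ)) * u₁ y := by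
    refine intervalIntegral.integral_congr fun y hy => ?_
    rw [uIcc_of_le hpq] at hy
    simp only [hw]
    rw [mul_left_comm (g y : ℂ), hgr y hy, mul_one]
  rw [e1] at ibp1
  rw [e2] at ibp2
  have nrm : ∀ (z : ℂ) (s Z : ℝ), ‖z‖ ≤ Z → |s| ≤ R → ‖z * (s : ℂ)‖ ≤ Z * R := fun z s Z hz hs => by
    rw [norm_mul, Complex.norm_real, Real.norm_eq_abs]
    exact mul_le_mul hz hs (abs_nonneg _) ((norm_nonneg _).trans hz)
  have bu₁ : ∀ y ∈ Icc p q, ‖u₁ y‖ ≤ 2 * M * R := fun y hy => by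
    have h1 := nrm _ _ _ (hM₁ y) (hrR y (hsub hy))
    have h2 := nrm _ _ _ (hM y) (hr₁R y (hsub hy))
    refine (norm_add_le _ _).trans ?_
    linarith
  have bw : ∀ y ∈ Icc p q, ‖w y‖ ≤ 2 * M * R * R := fun y hy =>
    nrm _ _ _ (bu₁ y hy) (hrR y (hsub hy))
  have bw₁ : ∀ y ∈ Icc p q, ‖w₁ y‖ ≤ 6 * M * R * R := fun y hy => by
    have h1 := nrm _ _ _ (hM₂ y) (hrR y (hsub hy))
    have h2 := nrm _ _ _ (hM₁ y) (hr₁R y (hsub hy))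
    have h3 := nrm _ _ _ (hM y) (hr₂R y (hsub hy))
    have h4 : ‖(ψ₂ y * r y + ψ₁ y * r₁ y) + (ψ₁ y * r₁ y + ψ y * r₂ y)‖ ≤ 4 * M * R := by
      refine (norm_add_le _ _).trans ?_
      have h5 := norm_add_le (ψ₂ y * r y) (ψ₁ y * r₁ y)
      have h6 := norm_add_le (ψ₁ y * r₁ y) (ψ y * r₂ y)
      linarith
    have h7 := nrm _ _ _ h4 (hrR y (hsub hy))
    have h8 := nrm _ _ _ (bu₁ y hy) (hr₁R y (hsub hy))
    refine (norm_add_le _ _).trans ?_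
    linarith
  have bint : ‖∫ y in p..q, Complex.exp (Complex.I * (l : ℂ) * (φ y : ℂ)) * w₁ y‖ ≤
      6 * M * R * R * (β - α) := by
    refine (intervalIntegral.norm_integral_le_of_norm_le_const (C := 6 * M * R * R)
      fun y hy => ?_).trans ?_
    · rw [norm_mul, norm_exp_phase, one_mul]
      rw [uIoc_of_le hpq] at hy
      exact bw₁ y (Ioc_subset_Icc_self hy)
    · rw [abs_of_nonneg (by linarith)]
      have h1 := hp.1
      have h2 := hq.2
      exact mul_le_mul_of_nonneg_left (by linarith) (by positivity)
  have bup : ‖u p‖ ≤ M * η' * R := by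
    refine nrm _ _ _ ?_ (hrR p hp)
    have := hlip p α
    rwa [hψα, sub_zero, hp', add_sub_cancel_left, abs_of_pos hη'0, ← hp'] at this
  have buq : ‖u q‖ ≤ M * η' * R := by
    refine nrm _ _ _ ?_ (hrR q hq)
    have := hlip q β
    rwa [hψβ, sub_zero, hq', sub_sub_cancel_left, abs_neg, abs_of_pos hη'0, ← hq'] at this
  have bwp := bw p (left_mem_Icc.2 hpq)
  have bwq := bw q (right_mem_Icc.2 hpq)
  have h9 : ‖∫ y in p..q, Complex.exp (Complex.I * (l : ℂ) * (φ y : ℂ)) * u₁ y‖ ≤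
      (4 + 6 * (β - α)) * M * R ^ 2 / l := by
    refine ibp2.trans ?_
    gcongr
    nlinarith
  calc _ ≤ _ := ibp1
    _ ≤ (η * l + (4 + 6 * (β - α)) * M * R ^ 2 / l) / l := by
      gcongr
      linarith
    _ = _ := by field_simp; ring

/-! ### Convexity and the trapezoidal error -/

/-- A function with second derivative `≥ c` lies below its endpoint bound by a parabola. -/
lemma le_sub_parabola {x x' : ℝ} {F F₁ F₂ : ℝ → ℝ}
    (hF : ∀ u ∈ Icc x x', HasDerivAt F (F₁ u) u) (hF₁ : ∀ u ∈ Icc x x', HasDerivAt F₁ (F₂ u) u)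
    {b c : ℝ} (hc : ∀ u ∈ Icc x x', c ≤ F₂ u) (hb : F x ≤ b) (hb' : F x' ≤ b) :
    ∀ u ∈ Icc x x', F u ≤ b - c / 2 * ((u - x) * (x' - u)) := by
  intro u hu
  have hsub : interior (Icc x x') ⊆ Icc x x' := interior_subset
  have hd : ∀ v : ℝ, HasDerivAt (fun u : ℝ => c / 2 * ((u - x) * (x' - u)))
      (c / 2 * ((x' - v) - (v - x))) v := fun v => by
    have h1 : HasDerivAt (fun u : ℝ => u - x) 1 v := (hasDerivAt_id v).sub_const x
    have h2 : HasDerivAt (fun u : ℝ => x' - u) (-1) v := (hasDerivAt_id v).const_sub x'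
    exact ((h1.mul h2).const_mul (c / 2)).congr_deriv (by ring)
  have hd2 : ∀ v : ℝ, HasDerivAt (fun v : ℝ => c / 2 * ((x' - v) - (v - x))) (-c) v := fun v => by
    have h1 : HasDerivAt (fun u : ℝ => u - x) 1 v := (hasDerivAt_id v).sub_const x
    have h2 : HasDerivAt (fun u : ℝ => x' - u) (-1) v := (hasDerivAt_id v).const_sub x'
    exact ((h2.sub h1).const_mul (c / 2)).congr_deriv (by ring)
  -- The added parabola has second derivative -c and vanishes at both endpoints, so the sum is
  -- convex and at most the larger endpoint value. No sign of c is assumed; negative c is used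
  -- later.
  have hconv : ConvexOn ℝ (Icc x x') (fun u => F u + c / 2 * ((u - x) * (x' - u))) :=
    convexOn_of_hasDerivWithinAt2_nonneg (convex_Icc x x')
      (fun v hv => ((hF v hv).add (hd v)).continuousAt.continuousWithinAt)
      (fun v hv => ((hF v (hsub hv)).add (hd v)).hasDerivWithinAt)
      (fun v hv => ((hF₁ v (hsub hv)).add (hd2 v)).hasDerivWithinAt)
      (fun v hv => by linarith [hc v (hsub hv)])
  have hxx : x ≤ x' := hu.1.trans hu.2
  have := hconv.le_max_of_mem_Icc (left_mem_Icc.2 hxx) (right_mem_Icc.2 hxx) hu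
  simp only [sub_self, zero_mul, mul_zero, add_zero] at this
  have h2 := max_le hb hb'
  linarith

/-- The error term of the trapezoidal rule, one-sided. -/
lemma sub_le_trapezoid {x x' : ℝ} (hxx : x ≤ x') {G F F₁ F₂ : ℝ → ℝ}
    (hG : ∀ u ∈ Icc x x', HasDerivAt G (F u) u)
    (hF : ∀ u ∈ Icc x x', HasDerivAt F (F₁ u) u) (hF₁ : ∀ u ∈ Icc x x', HasDerivAt F₁ (F₂ u) u)
    {b c : ℝ} (hc : ∀ u ∈ Icc x x', c ≤ F₂ u) (hb : F x ≤ b) (hb' : F x' ≤ b) :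
    G x' - G x ≤ b * (x' - x) - c * (x' - x) ^ 3 / 12 := by
  have hp := le_sub_parabola hF hF₁ hc hb hb'
  have hd : ∀ v : ℝ, HasDerivAt (fun u : ℝ => b * (u - x) -
      c / 2 * ((x' - x) * (u - x) ^ 2 / 2 - (u - x) ^ 3 / 3))
      (b - c / 2 * ((v - x) * (x' - v))) v := fun v => by
    have h1 : HasDerivAt (fun u : ℝ => u - x) 1 v := (hasDerivAt_id v).sub_const x
    have h2 := ((((h1.fun_pow 2).const_mul (x' - x)).div_const 2).sub
      ((h1.fun_pow 3).div_const 3)).const_mul (c / 2)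
    have h3 := (h1.const_mul b).sub h2
    refine h3.congr_deriv ?_
    simp only [Nat.cast_ofNat]
    ring
  -- The parabola bound is integrated by comparing G with an antiderivative of it; (c/2)·d³/6 is the
  -- term c d³/12.
  have hanti : AntitoneOn (fun u => G u - (b * (u - x) -
      c / 2 * ((x' - x) * (u - x) ^ 2 / 2 - (u - x) ^ 3 / 3))) (Icc x x') :=
    antitoneOn_of_hasDerivWithinAt_nonpos (convex_Icc x x')
      (fun v hv => ((hG v hv).sub (hd v)).continuousAt.continuousWithinAt)
      (fun v hv => ((hG v (interior_subset hv)).sub (hd v)).hasDerivWithinAt)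
      (fun v hv => by linarith [hp v (interior_subset hv)])
  have := hanti (left_mem_Icc.2 hxx) (right_mem_Icc.2 hxx) hxx
  simp only [sub_self] at this
  nlinarith

/-! ### Integrable majorants for kernels of T T* -/

section Majorant

lemma integrable_comp_abs {f : ℝ → ℝ} (hf : IntegrableOn f (Ioi 0)) :
    Integrable (fun x => f |x|) := by
  have hf' : IntegrableOn (fun x => f |x|) (Ioi 0) :=
    hf.congr_fun (fun x hx => by rw [abs_of_pos (mem_Ioi.1 hx)]) measurableSet_Ioi
  have int_Iic : IntegrableOn (fun x => f |x|) (Iic 0) := by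
    rw [← Measure.map_neg_eq_self (volume : Measure ℝ)]
    let m : MeasurableEmbedding fun x : ℝ => -x := (Homeomorph.neg ℝ).measurableEmbedding
    rw [m.integrableOn_map_iff]
    simp_rw [Function.comp_def, abs_neg, neg_preimage, neg_Iic, neg_zero]
    exact Iff.mpr integrableOn_Ici_iff_integrableOn_Ioi hf'
  rw [← integrableOn_univ, ← Iic_union_Ioi (a := (0 : ℝ))]
  exact int_Iic.union hf'

/-- The exponent -3/4 comes from interpolating van der Corput's |t|⁻¹ with a bounded kernel. Any
exponent above -1 removes the logarithm; this one leaves a convergent dyadic sum. -/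
lemma integral_abs_rpow_near {l : ℝ} (hl : 0 < l) :
    Integrable (fun t : ℝ => (Iic l).indicator (fun s : ℝ => s ^ (-(3 / 4) : ℝ)) |t|) ∧
    ∫ t : ℝ, (Iic l).indicator (fun s : ℝ => s ^ (-(3 / 4) : ℝ)) |t| = 8 * l ^ (1 / 4 : ℝ) := by
  have hint : IntegrableOn ((Iic l).indicator (fun s : ℝ => s ^ (-(3 / 4) : ℝ))) (Ioi 0) := by
    rw [IntegrableOn, integrable_indicator_iff measurableSet_Iic, IntegrableOn,
      Measure.restrict_restrict measurableSet_Iic, inter_comm, Ioi_inter_Iic]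
    exact (intervalIntegral.intervalIntegrable_rpow' (by norm_num)).1
  refine ⟨integrable_comp_abs hint, ?_⟩
  rw [integral_comp_abs, setIntegral_indicator measurableSet_Iic, Ioi_inter_Iic,
    ← intervalIntegral.integral_of_le hl.le, integral_rpow (Or.inl (by norm_num)),
    Real.zero_rpow (by norm_num)]
  norm_num; ring

/-- The cubic lower bound for the phase derivative produces |t|⁻³, to be integrated beyond e = √a.
-/
lemma integral_abs_rpow_far {e : ℝ} (he : 0 < e) :
    Integrable (fun t : ℝ => (Ioi e).indicator (fun s : ℝ => s ^ (-3 : ℝ)) |t|) ∧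
    ∫ t : ℝ, (Ioi e).indicator (fun s : ℝ => s ^ (-3 : ℝ)) |t| = 1 / e ^ 2 := by
  have hinter : Ioi 0 ∩ Ioi e = Ioi e := by
    ext s; simp only [mem_inter_iff, mem_Ioi]; exact ⟨fun h => h.2, fun h => ⟨he.trans h, h⟩⟩
  have hint : IntegrableOn ((Ioi e).indicator (fun s : ℝ => s ^ (-3 : ℝ))) (Ioi 0) := by
    rw [IntegrableOn, integrable_indicator_iff measurableSet_Ioi, IntegrableOn,
      Measure.restrict_restrict measurableSet_Ioi, inter_comm, hinter]
    exact integrableOn_Ioi_rpow_of_lt (by norm_num) he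
  refine ⟨integrable_comp_abs hint, ?_⟩
  rw [integral_comp_abs, setIntegral_indicator measurableSet_Ioi, hinter,
    integral_Ioi_rpow_of_lt (by norm_num) he]
  have : e ^ ((-3 : ℝ) + 1) = (e ^ 2)⁻¹ := by
    rw [show (-3 : ℝ) + 1 = -(2 : ℕ) by norm_num, Real.rpow_neg he.le, Real.rpow_natCast]
  rw [this]; norm_num; ring

/-- Schur-type integral of a kernel majorized by a function of the distance. -/
lemma setIntegral_norm_le_of_majorant {I : Set ℝ} (hI : MeasurableSet I) {k : ℝ → ℂ} {x : ℝ}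
    {W : ℝ → ℝ} (hW : Integrable W) (hW0 : ∀ t, 0 ≤ W t)
    (h : ∀ x' ∈ I, x' ≠ x → ‖k x'‖ ≤ W (x - x')) : ∫ x' in I, ‖k x'‖ ≤ ∫ t, W t := by
  have hW' : Integrable (fun x' => W (x - x')) := hW.comp_sub_left x
  rw [← integral_sub_left_eq_self W volume x]
  refine (integral_mono_of_nonneg (Eventually.of_forall fun _ => norm_nonneg _)
    hW'.integrableOn ?_).trans (setIntegral_le_integral hW' (Eventually.of_forall fun _ => hW0 _))
  rw [EventuallyLE, ae_restrict_iff' hI]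
  have : ∀ᵐ x' : ℝ, x' ≠ x := by simp [ae_iff]
  filter_upwards [this] with x' hx' hxI using h x' hxI hx'

end Majorant

/-! ### Calculus of iterated partial derivatives -/

section Partials

variable {D : Set (ℝ × ℝ)} {G G' : ℝ × ℝ → ℝ} {p : ℝ × ℝ}

lemma hasDerivAt_mk_left (x y : ℝ) : HasDerivAt (fun t : ℝ => (t, y)) ((1, 0) : ℝ × ℝ) x :=
  (hasDerivAt_id x).prodMk (hasDerivAt_const x y)

lemma hasDerivAt_mk_right (x y : ℝ) : HasDerivAt (fun t : ℝ => (x, t)) ((0, 1) : ℝ × ℝ) y :=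
  (hasDerivAt_const y x).prodMk (hasDerivAt_id y)

lemma ContDiffOn.hasFDerivAt_of_isOpen (hD : IsOpen D) (hG : ContDiffOn ℝ ∞ G D) (hp : p ∈ D) :
    HasFDerivAt G (fderiv ℝ G p) p :=
  ((hG.contDiffAt (hD.mem_nhds hp)).differentiableAt (by simp)).hasFDerivAt

lemma partialX_univ_eq_fderiv (hD : IsOpen D) (hG : ContDiffOn ℝ ∞ G D) (hp : p ∈ D) :
    partialX univ G p = fderiv ℝ G p (1, 0) := by
  rw [partialX, derivWithin_univ]
  exact ((hG.hasFDerivAt_of_isOpen hD hp).comp_hasDerivAt p.1 (hasDerivAt_mk_left p.1 p.2)).deriv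

lemma partialY_univ_eq_fderiv (hD : IsOpen D) (hG : ContDiffOn ℝ ∞ G D) (hp : p ∈ D) :
    partialY univ G p = fderiv ℝ G p (0, 1) := by
  rw [partialY, derivWithin_univ]
  exact ((hG.hasFDerivAt_of_isOpen hD hp).comp_hasDerivAt p.2 (hasDerivAt_mk_right p.1 p.2)).deriv

lemma hasDerivAt_partialX (hD : IsOpen D) (hG : ContDiffOn ℝ ∞ G D) {x y : ℝ} (hp : (x, y) ∈ D) :
    HasDerivAt (fun t => G (t, y)) (partialX univ G (x, y)) x := by
  rw [partialX_univ_eq_fderiv hD hG hp]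
  exact (hG.hasFDerivAt_of_isOpen hD hp).comp_hasDerivAt x (hasDerivAt_mk_left x y)

lemma hasDerivAt_partialY (hD : IsOpen D) (hG : ContDiffOn ℝ ∞ G D) {x y : ℝ} (hp : (x, y) ∈ D) :
    HasDerivAt (fun t => G (x, t)) (partialY univ G (x, y)) y := by
  rw [partialY_univ_eq_fderiv hD hG hp]
  exact (hG.hasFDerivAt_of_isOpen hD hp).comp_hasDerivAt y (hasDerivAt_mk_right x y)

lemma contDiffOn_fderiv_apply (hD : IsOpen D) (hG : ContDiffOn ℝ ∞ G D) (v : ℝ × ℝ) :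
    ContDiffOn ℝ ∞ (fun p => fderiv ℝ G p v) D :=
  (hG.fderiv_of_isOpen hD (by norm_num)).clm_apply contDiffOn_const

lemma contDiffOn_partialX (hD : IsOpen D) (hG : ContDiffOn ℝ ∞ G D) :
    ContDiffOn ℝ ∞ (partialX univ G) D :=
  (contDiffOn_fderiv_apply hD hG (1, 0)).congr fun _ hp => partialX_univ_eq_fderiv hD hG hp

lemma contDiffOn_partialY (hD : IsOpen D) (hG : ContDiffOn ℝ ∞ G D) :
    ContDiffOn ℝ ∞ (partialY univ G) D :=
  (contDiffOn_fderiv_apply hD hG (0, 1)).congr fun _ hp => partialY_univ_eq_fderiv hD hG hp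

lemma contDiffOn_iterate_partialY (hD : IsOpen D) (hG : ContDiffOn ℝ ∞ G D) (n : ℕ) :
    ContDiffOn ℝ ∞ ((partialY univ)^[n] G) D := by
  induction n with
  | zero => exact hG
  | succ n ih =>
    rw [Function.iterate_succ_apply']
    exact contDiffOn_partialY hD ih

lemma contDiffOn_iterate_partialX (hD : IsOpen D) (hG : ContDiffOn ℝ ∞ G D) (n : ℕ) :
    ContDiffOn ℝ ∞ ((partialX univ)^[n] G) D := by
  induction n with
  | zero => exact hG
  | succ n ih =>
    rw [Function.iterate_succ_apply']
    exact contDiffOn_partialX hD ih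

lemma contDiffOn_mixedPartial (hD : IsOpen D) (hG : ContDiffOn ℝ ∞ G D) (a b : ℕ) :
    ContDiffOn ℝ ∞ (mixedPartial univ a b G) D :=
  contDiffOn_iterate_partialX hD (contDiffOn_iterate_partialY hD hG b) a

lemma contDiffOn_mixedHessian (hD : IsOpen D) (hG : ContDiffOn ℝ ∞ G D) :
    ContDiffOn ℝ ∞ (mixedHessian univ G) D :=
  contDiffOn_partialX hD (contDiffOn_partialY hD hG)

lemma eqOn_partialX (hD : IsOpen D) {J : Set ℝ} (hJ : ∀ p ∈ D, J ∈ 𝓝 p.1) (h : EqOn G G' D) :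
    EqOn (partialX J G) (partialX univ G') D := by
  intro p hp
  rw [partialX, partialX, derivWithin_univ, derivWithin_of_mem_nhds (hJ p hp)]
  refine Filter.EventuallyEq.deriv_eq ?_
  have hc : ContinuousAt (fun t : ℝ => (t, p.2)) p.1 := by fun_prop
  filter_upwards [hc.preimage_mem_nhds (hD.mem_nhds hp)] with t ht using h ht

lemma eqOn_partialY (hD : IsOpen D) {J : Set ℝ} (hJ : ∀ p ∈ D, J ∈ 𝓝 p.2) (h : EqOn G G' D) :
    EqOn (partialY J G) (partialY univ G') D := by
  intro p hp
  rw [partialY, partialY, derivWithin_univ, derivWithin_of_mem_nhds (hJ p hp)]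
  refine Filter.EventuallyEq.deriv_eq ?_
  have hc : ContinuousAt (fun t : ℝ => (p.1, t)) p.2 := by fun_prop
  filter_upwards [hc.preimage_mem_nhds (hD.mem_nhds hp)] with t ht using h ht

/-- One-sided derivatives differ from ordinary ones only at the boundary, and each derivative at a
point of an open set depends only on nearby values, so equality propagates through iteration. -/
lemma eqOn_mixedPartial (hD : IsOpen D) {J : Set ℝ} (hJ : ∀ p ∈ D, J ∈ 𝓝 p.1 ∧ J ∈ 𝓝 p.2)
    (h : EqOn G G' D) (a b : ℕ) : EqOn (mixedPartial J a b G) (mixedPartial univ a b G') D := by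
  have hb : EqOn ((partialY J)^[b] G) ((partialY univ)^[b] G') D := by
    induction b with
    | zero => exact h
    | succ b ih =>
      rw [Function.iterate_succ_apply', Function.iterate_succ_apply']
      exact eqOn_partialY hD (fun p hp => (hJ p hp).2) ih
  unfold mixedPartial
  induction a with
  | zero => exact hb
  | succ a ih =>
    rw [Function.iterate_succ_apply', Function.iterate_succ_apply']
    exact eqOn_partialX hD (fun p hp => (hJ p hp).1) ih

lemma partialX_partialY_comm (hD : IsOpen D) (hG : ContDiffOn ℝ ∞ G D) :
    EqOn (partialX univ (partialY univ G)) (partialY univ (partialX univ G)) D := by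
  intro p hp
  have hat := hG.contDiffAt (hD.mem_nhds hp)
  have hd : DifferentiableAt ℝ (fderiv ℝ G) p :=
    ((hG.fderiv_of_isOpen hD (m := 1) (by norm_cast)).contDiffAt (hD.mem_nhds hp)).differentiableAt
      (by simp)
  have e : ∀ v w : ℝ × ℝ, fderiv ℝ (fun q => fderiv ℝ G q v) p w = fderiv ℝ (fderiv ℝ G) p w v := by
    intro v w
    rw [fderiv_clm_apply hd (differentiableAt_const v)]
    simp
  have h1 : EqOn (partialY univ G) (fun q => fderiv ℝ G q (0, 1)) D :=
    fun q hq => partialY_univ_eq_fderiv hD hG hq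
  have h2 : EqOn (partialX univ G) (fun q => fderiv ℝ G q (1, 0)) D :=
    fun q hq => partialX_univ_eq_fderiv hD hG hq
  rw [eqOn_partialX hD (fun _ _ => univ_mem) h1 hp, eqOn_partialY hD (fun _ _ => univ_mem) h2 hp,
    partialX_univ_eq_fderiv hD (contDiffOn_fderiv_apply hD hG _) hp,
    partialY_univ_eq_fderiv hD (contDiffOn_fderiv_apply hD hG _) hp, e, e]
  exact (hat.isSymmSndFDerivAt (by
    rw [minSmoothness_of_isRCLikeNormedField]; exact WithTop.coe_le_coe.2 le_top)) (1, 0) (0, 1)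

/-- Needed because the phase differentiates S in y first, while the hypotheses concern y-derivatives
of F = ∂ₓ∂_y S. -/
lemma partialX_iterate_partialY_comm (hD : IsOpen D) (hG : ContDiffOn ℝ ∞ G D) (n : ℕ) :
    EqOn (partialX univ ((partialY univ)^[n] G)) ((partialY univ)^[n] (partialX univ G)) D := by
  induction n with
  | zero => exact fun _ _ => rfl
  | succ n ih =>
    rw [Function.iterate_succ_apply', Function.iterate_succ_apply']
    exact (partialX_partialY_comm hD (contDiffOn_iterate_partialY hD hG n)).trans
      (eqOn_partialY hD (fun _ _ => univ_mem) ih)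

end Partials

/-! ### Uniform bounds from compactness of the closed square -/

section ClosedSquare

variable {G : ℝ × ℝ → ℝ} {p : ℝ × ℝ}

lemma uniqueDiffOn_unitSquare : UniqueDiffOn ℝ unitSquare :=
  (uniqueDiffOn_Icc zero_lt_one).prod (uniqueDiffOn_Icc zero_lt_one)

lemma hasFDerivWithinAt_unitSquare (hG : ContDiffOn ℝ ∞ G unitSquare) (hp : p ∈ unitSquare) :
    HasFDerivWithinAt G (fderivWithin ℝ G unitSquare p) unitSquare p :=
  ((hG.differentiableOn (by simp)) p hp).hasFDerivWithinAt

lemma contDiffOn_partialX_unitSquare (hG : ContDiffOn ℝ ∞ G unitSquare) :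
    ContDiffOn ℝ ∞ (partialX (Icc 0 1) G) unitSquare := by
  refine ((hG.fderivWithin uniqueDiffOn_unitSquare (m := ∞) (by norm_num)).clm_apply
    (contDiffOn_const (c := ((1, 0) : ℝ × ℝ)))).congr fun p hp => ?_
  refine HasDerivWithinAt.derivWithin ?_ (uniqueDiffOn_Icc zero_lt_one p.1 hp.1)
  exact (hasFDerivWithinAt_unitSquare hG hp).comp_hasDerivWithinAt p.1
    (hasDerivAt_mk_left p.1 p.2).hasDerivWithinAt fun t ht => (⟨ht, hp.2⟩ : (t, p.2) ∈ unitSquare)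

lemma contDiffOn_partialY_unitSquare (hG : ContDiffOn ℝ ∞ G unitSquare) :
    ContDiffOn ℝ ∞ (partialY (Icc 0 1) G) unitSquare := by
  refine ((hG.fderivWithin uniqueDiffOn_unitSquare (m := ∞) (by norm_num)).clm_apply
    (contDiffOn_const (c := ((0, 1) : ℝ × ℝ)))).congr fun p hp => ?_
  refine HasDerivWithinAt.derivWithin ?_ (uniqueDiffOn_Icc zero_lt_one p.2 hp.2)
  exact (hasFDerivWithinAt_unitSquare hG hp).comp_hasDerivWithinAt p.2
    (hasDerivAt_mk_right p.1 p.2).hasDerivWithinAt fun t ht => (⟨hp.1, ht⟩ : (p.1, t) ∈ unitSquare)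

lemma contDiffOn_mixedPartial_unitSquare (hG : ContDiffOn ℝ ∞ G unitSquare) (a b : ℕ) :
    ContDiffOn ℝ ∞ (mixedPartial (Icc 0 1) a b G) unitSquare := by
  have hb : ContDiffOn ℝ ∞ ((partialY (Icc 0 1))^[b] G) unitSquare := by
    induction b with
    | zero => exact hG
    | succ b ih =>
      rw [Function.iterate_succ_apply']
      exact contDiffOn_partialY_unitSquare ih
  unfold mixedPartial
  induction a with
  | zero => exact hb
  | succ a ih =>
    rw [Function.iterate_succ_apply']
    exact contDiffOn_partialX_unitSquare ih

/-- A continuous nonvanishing function on a compact connected set stays away from zero. -/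
lemma exists_away {X : Type*} [TopologicalSpace X] {K : Set X} (hK : IsCompact K)
    (hc : IsPreconnected K) (hne : K.Nonempty) {f : X → ℝ} (hf : ContinuousOn f K)
    (h0 : ∀ p ∈ K, f p ≠ 0) : ∃ c > 0, Away K f c := by
  obtain ⟨p₀, hp₀, hmin⟩ := hK.exists_isMinOn hne hf.abs
  refine ⟨|f p₀|, abs_pos.2 (h0 p₀ hp₀), ?_⟩
  have hsign : (∀ p ∈ K, 0 < f p) ∨ (∀ p ∈ K, f p < 0) := by
    by_contra! hcon
    obtain ⟨⟨p, hp, hp0⟩, q, hq, hq0⟩ := hcon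
    obtain ⟨r, hr, hr0⟩ := hc.intermediate_value hp hq hf ⟨hp0, hq0⟩
    exact h0 r hr hr0
  refine hsign.imp (fun h p hp => ?_) (fun h p hp => ?_)
  · have := hmin hp
    simpa [abs_of_pos (h p hp)] using this
  · have : |f p₀| ≤ |f p| := hmin hp
    rw [abs_of_neg (h p hp)] at this
    linarith

lemma exists_abs_le {X : Type*} [TopologicalSpace X] {K : Set X} (hK : IsCompact K) {f : X → ℝ}
    (hf : ContinuousOn f K) : ∃ C > 0, ∀ p ∈ K, |f p| ≤ C := by
  obtain ⟨C, hC⟩ := hK.exists_bound_of_continuousOn hf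
  exact ⟨max C 1, by positivity, fun p hp => (hC p hp).trans (le_max_left _ _)⟩

end ClosedSquare

/-! ### The kernel of T T* on an open square -/

/-- The open square `(α, β)²`. -/
def openBox (α β : ℝ) : Set (ℝ × ℝ) := Ioo α β ×ˢ Ioo α β

lemma isOpen_openBox (α β : ℝ) : IsOpen (openBox α β) := isOpen_Ioo.prod isOpen_Ioo

/-- A phase which is smooth on an open square, and a smooth amplitude which vanishes off it. -/
structure BoxData (α β : ℝ) (S : ℝ × ℝ → ℝ) (χ : ℝ × ℝ → ℂ) : Prop where
  lt : α < β
  smooth : ContDiffOn ℝ ∞ S (openBox α β)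
  amp : ContDiff ℝ ∞ χ
  cpt : HasCompactSupport χ
  supp : ∀ p, χ p ≠ 0 → p ∈ openBox α β

/-- The integrand `e^{iλ(S(x,y) - S(x',y))} χ(x,y) conj χ(x',y)` of the kernel of `T T*`. -/
noncomputable def phaseDiff (S : ℝ × ℝ → ℝ) (χ : ℝ × ℝ → ℂ) (l x x' y : ℝ) : ℂ :=
  Complex.exp (Complex.I * (l : ℂ) * ((S (x, y) - S (x', y) : ℝ) : ℂ)) *
    (χ (x, y) * (starRingEnd ℂ) (χ (x', y)))

lemma norm_setIntegral_le_card_mul {ι : Type*} {f : ℝ → ℂ} {A : Set ℝ} {b : ℝ} (hb : 0 ≤ b)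
    (s : Finset ι) (l : ℝ → ι) (hl : ∀ y ∈ A, l y ∈ s)
    (hm : ∀ k ∈ s, MeasurableSet (A ∩ l ⁻¹' {k}))
    (h : ∀ k ∈ s, ‖∫ y in A ∩ l ⁻¹' {k}, f y‖ ≤ b) : ‖∫ y in A, f y‖ ≤ s.card * b := by
  by_cases hf : IntegrableOn f A
  · have e : A = ⋃ k ∈ s, A ∩ l ⁻¹' {k} := by
      ext y
      simp only [mem_iUnion, mem_inter_iff, mem_preimage, mem_singleton_iff, exists_prop]
      exact ⟨fun hy => ⟨l y, hl y hy, hy, rfl⟩, fun ⟨k, _, hy, _⟩ => hy⟩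
    have e2 : ∫ y in A, f y = ∑ k ∈ s, ∫ y in A ∩ l ⁻¹' {k}, f y := by
      conv_lhs => rw [e]
      refine integral_biUnion_finset s hm (fun i _ j _ hij => ?_)
        fun k _ => hf.mono_set inter_subset_left
      refine Set.disjoint_left.2 fun y hy hy' => hij ?_
      exact hy.2.symm.trans hy'.2
    rw [e2]
    refine (norm_sum_le_of_le s h).trans ?_
    rw [Finset.sum_const, nsmul_eq_mul]
  -- Without integrability the integral is 0 by convention.
  · rw [integral_undef hf, norm_zero]; positivity

namespace BoxData

variable {α β : ℝ} {S : ℝ × ℝ → ℝ} {χ : ℝ × ℝ → ℂ}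

lemma bddKernel (hd : BoxData α β S χ) (l : ℝ) : BddKernel fun x y => oscKernel S χ l (x, y) := by
  refine ⟨?_, ?_⟩
  · have hD := isOpen_openBox α β
    -- Nothing is known about S off the box, not even measurability, but there χ kills the kernel.
    have e : Function.uncurry (fun x y => oscKernel S χ l (x, y)) =
        (openBox α β).indicator (oscKernel S χ l) := by
      funext p
      by_cases hp : p ∈ openBox α β
      · rw [indicator_of_mem hp]; rfl
      · have : χ p = 0 := by by_contra h; exact hp (hd.supp p h)
        rw [indicator_of_notMem hp]
        simp [Function.uncurry, oscKernel, this]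
    rw [e]
    classical
    rw [← Set.piecewise_eq_indicator]
    refine ContinuousOn.measurable_piecewise ?_ continuousOn_const hD.measurableSet
    refine ContinuousOn.mul ?_ hd.amp.continuous.continuousOn
    refine Complex.continuous_exp.comp_continuousOn (continuousOn_const.mul ?_)
    exact Complex.continuous_ofReal.comp_continuousOn hd.smooth.continuousOn
  · obtain ⟨M, hM⟩ := hd.cpt.exists_bound_of_continuous hd.amp.continuous
    refine ⟨M, fun x y => ?_⟩
    rw [oscKernel, norm_mul, norm_exp_phase, one_mul]
    exact hM _

/-- A sharp cutoff on a region shrinks only the domain of the y-integral, to the y for which both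
points lie in the region; phase and amplitude stay smooth. -/
lemma ttStar_indicator (l : ℝ) {R : Set (ℝ × ℝ)} (hR : MeasurableSet R) (x x' : ℝ) :
    ttStar (volume.restrict (Ioo α β))
      (fun x y => R.indicator (Function.uncurry fun x y => oscKernel S χ l (x, y)) (x, y)) x x' =
      ∫ y in Ioo α β ∩ {y | (x, y) ∈ R ∧ (x', y) ∈ R}, phaseDiff S χ l x x' y := by
  have hY : MeasurableSet {y | (x, y) ∈ R ∧ (x', y) ∈ R} :=
    (measurable_prodMk_left hR).inter (measurable_prodMk_left hR)
  rw [inter_comm, ← Measure.restrict_restrict hY, ← integral_indicator hY, ttStar]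
  congr 1; funext y
  by_cases h1 : (x, y) ∈ R
  · by_cases h2 : (x', y) ∈ R
    · rw [indicator_of_mem h1, indicator_of_mem h2, indicator_of_mem (by exact ⟨h1, h2⟩)]
      simp only [Function.uncurry, oscKernel, phaseDiff, map_mul, ← Complex.exp_conj,
        Complex.conj_I, Complex.conj_ofReal, Complex.ofReal_sub, mul_sub, Complex.exp_sub]
      rw [show -Complex.I * (l : ℂ) * (S (x', y) : ℂ) = -(Complex.I * l * S (x', y)) by ring,
        Complex.exp_neg]
      ring
    · have h3 : y ∉ {y | (x, y) ∈ R ∧ (x', y) ∈ R} := fun h => h2 h.2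
      rw [indicator_of_notMem h2, indicator_of_notMem h3]; simp
  · have h3 : y ∉ {y | (x, y) ∈ R ∧ (x', y) ∈ R} := fun h => h1 h.1
    rw [indicator_of_notMem h1, indicator_of_notMem h3]; simp

/-- Uniform bounds for the amplitude of the kernel of `T T*` and its derivatives. -/
lemma exists_amp_bound (hd : BoxData α β S χ) : ∃ M : ℝ, 0 < M ∧ ∀ x x' : ℝ, ∃ ψ₁ ψ₂ : ℝ → ℂ,
    (∀ y, HasDerivAt (fun y => χ (x, y) * (starRingEnd ℂ) (χ (x', y))) (ψ₁ y) y) ∧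
    (∀ y, HasDerivAt ψ₁ (ψ₂ y) y) ∧ Continuous ψ₁ ∧ Continuous ψ₂ ∧
    (∀ y, ‖χ (x, y) * (starRingEnd ℂ) (χ (x', y))‖ ≤ M) ∧ (∀ y, ‖ψ₁ y‖ ≤ M) ∧
    (∀ y, ‖ψ₂ y‖ ≤ M) := by
  set χ₁ : ℝ × ℝ → ℂ := fun p => fderiv ℝ χ p (0, 1) with hχ₁
  set χ₂ : ℝ × ℝ → ℂ := fun p => fderiv ℝ χ₁ p (0, 1) with hχ₂
  have hc₁ : ContDiff ℝ ∞ χ₁ := (hd.amp.fderiv_right (by norm_num)).clm_apply contDiff_const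
  have hc₂ : ContDiff ℝ ∞ χ₂ := (hc₁.fderiv_right (by norm_num)).clm_apply contDiff_const
  have hs₁ : HasCompactSupport χ₁ := hd.cpt.fderiv_apply ℝ (0, 1)
  have hs₂ : HasCompactSupport χ₂ := hs₁.fderiv_apply ℝ (0, 1)
  obtain ⟨M₀, hM₀⟩ := hd.cpt.exists_bound_of_continuous hd.amp.continuous
  obtain ⟨M₁, hM₁⟩ := hs₁.exists_bound_of_continuous hc₁.continuous
  obtain ⟨M₂, hM₂⟩ := hs₂.exists_bound_of_continuous hc₂.continuous
  set N := max 1 (max M₀ (max M₁ M₂)) with hN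
  have hN1 : 1 ≤ N := le_max_left _ _
  have b₀ : ∀ p, ‖χ p‖ ≤ N := fun p => (hM₀ p).trans (by simp [hN])
  have b₁ : ∀ p, ‖χ₁ p‖ ≤ N := fun p => (hM₁ p).trans (by simp [hN])
  have b₂ : ∀ p, ‖χ₂ p‖ ≤ N := fun p => (hM₂ p).trans (by simp [hN])
  have d₀ : ∀ x y : ℝ, HasDerivAt (fun y => χ (x, y)) (χ₁ (x, y)) y := fun x y =>
    ((hd.amp.differentiable (by simp)) (x, y)).hasFDerivAt.comp_hasDerivAt y
      (hasDerivAt_mk_right x y)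
  have d₁ : ∀ x y : ℝ, HasDerivAt (fun y => χ₁ (x, y)) (χ₂ (x, y)) y := fun x y =>
    ((hc₁.differentiable (by simp)) (x, y)).hasFDerivAt.comp_hasDerivAt y
      (hasDerivAt_mk_right x y)
  have dc : ∀ {f : ℝ → ℂ} {f' : ℂ} {y : ℝ}, HasDerivAt f f' y →
      HasDerivAt (fun y => (starRingEnd ℂ) (f y)) ((starRingEnd ℂ) f') y := fun h => h.star
  have bm : ∀ {a b : ℂ}, ‖a‖ ≤ N → ‖b‖ ≤ N → ‖a * (starRingEnd ℂ) b‖ ≤ N * N := fun ha hb => by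
    rw [norm_mul, RCLike.norm_conj]
    exact mul_le_mul ha hb (norm_nonneg _) (by linarith)
  have cx : ∀ x : ℝ, Continuous fun y : ℝ => (x, y) := fun x => by fun_prop
  refine ⟨4 * (N * N), by positivity, fun x x' => ⟨
    fun y => χ₁ (x, y) * (starRingEnd ℂ) (χ (x', y)) + χ (x, y) * (starRingEnd ℂ) (χ₁ (x', y)),
    fun y => (χ₂ (x, y) * (starRingEnd ℂ) (χ (x', y)) + χ₁ (x, y) * (starRingEnd ℂ) (χ₁ (x', y))) +
      (χ₁ (x, y) * (starRingEnd ℂ) (χ₁ (x', y)) + χ (x, y) * (starRingEnd ℂ) (χ₂ (x', y))),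
    fun y => (d₀ x y).mul (dc (d₀ x' y)), fun y => ((d₁ x y).mul (dc (d₀ x' y))).add
      ((d₀ x y).mul (dc (d₁ x' y))), ?_, ?_, fun y => ?_, fun y => ?_, fun y => ?_⟩⟩
  · have h0 : ∀ x : ℝ, Continuous fun y => χ (x, y) := fun x => hd.amp.continuous.comp (cx x)
    have h1 : ∀ x : ℝ, Continuous fun y => χ₁ (x, y) := fun x => hc₁.continuous.comp (cx x)
    exact ((h1 x).mul (Complex.continuous_conj.comp (h0 x'))).add
      ((h0 x).mul (Complex.continuous_conj.comp (h1 x')))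
  · have h0 : ∀ x : ℝ, Continuous fun y => χ (x, y) := fun x => hd.amp.continuous.comp (cx x)
    have h1 : ∀ x : ℝ, Continuous fun y => χ₁ (x, y) := fun x => hc₁.continuous.comp (cx x)
    have h2 : ∀ x : ℝ, Continuous fun y => χ₂ (x, y) := fun x => hc₂.continuous.comp (cx x)
    exact (((h2 x).mul (Complex.continuous_conj.comp (h0 x'))).add
      ((h1 x).mul (Complex.continuous_conj.comp (h1 x')))).add
      (((h1 x).mul (Complex.continuous_conj.comp (h1 x'))).add
      ((h0 x).mul (Complex.continuous_conj.comp (h2 x'))))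
  · have := bm (b₀ (x, y)) (b₀ (x', y))
    nlinarith
  · refine (norm_add_le _ _).trans ?_
    have h1 := bm (b₁ (x, y)) (b₀ (x', y))
    have h2 := bm (b₀ (x, y)) (b₁ (x', y))
    nlinarith
  · refine (norm_add_le _ _).trans ?_
    have h1 := bm (b₂ (x, y)) (b₀ (x', y))
    have h2 := bm (b₀ (x, y)) (b₂ (x', y))
    have h3 := bm (b₁ (x, y)) (b₁ (x', y))
    have h4 := norm_add_le (χ₂ (x, y) * (starRingEnd ℂ) (χ (x', y)))
      (χ₁ (x, y) * (starRingEnd ℂ) (χ₁ (x', y)))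
    have h5 := norm_add_le (χ₁ (x, y) * (starRingEnd ℂ) (χ₁ (x', y)))
      (χ (x, y) * (starRingEnd ℂ) (χ₂ (x', y)))
    linarith

lemma smooth_partialY (hd : BoxData α β S χ) : ContDiffOn ℝ ∞ (partialY univ S) (openBox α β) :=
  contDiffOn_partialY (isOpen_openBox α β) hd.smooth

lemma smooth_hessian (hd : BoxData α β S χ) :
    ContDiffOn ℝ ∞ (mixedHessian univ S) (openBox α β) :=
  contDiffOn_mixedHessian (isOpen_openBox α β) hd.smooth

/-- The derivatives in `y` of `S'_y`, and of `F = S''_{xy}`. -/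
lemma derivChain_partialY (hd : BoxData α β S χ) {x : ℝ} (hx : x ∈ Ioo α β) :
    DerivChain (Ioo α β) fun i y => (partialY univ)^[i] (partialY univ S) (x, y) := fun i y hy => by
  simp only
  rw [Function.iterate_succ_apply']
  exact hasDerivAt_partialY (isOpen_openBox α β)
    (contDiffOn_iterate_partialY (isOpen_openBox α β) hd.smooth_partialY i) ⟨hx, hy⟩

lemma derivChain_hessian_y (hd : BoxData α β S χ) {x : ℝ} (hx : x ∈ Ioo α β) :
    DerivChain (Ioo α β) fun i y => mixedPartial univ 0 i (mixedHessian univ S) (x, y) :=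
  fun i y hy => by
    simp only [mixedPartial, Function.iterate_zero, id]
    rw [Function.iterate_succ_apply']
    exact hasDerivAt_partialY (isOpen_openBox α β)
      (contDiffOn_iterate_partialY (isOpen_openBox α β) hd.smooth_hessian i) ⟨hx, hy⟩

lemma derivChain_hessian_x (hd : BoxData α β S χ) {y : ℝ} (hy : y ∈ Ioo α β) :
    DerivChain (Ioo α β) fun i x => mixedPartial univ i 0 (mixedHessian univ S) (x, y) :=
  fun i x hx => by
    simp only [mixedPartial, Function.iterate_zero, id]
    rw [Function.iterate_succ_apply']
    exact hasDerivAt_partialX (isOpen_openBox α β)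
      (contDiffOn_iterate_partialX (isOpen_openBox α β) hd.smooth_hessian i) ⟨hx, hy⟩

/-- Commuting ∂ₓ past the y-derivatives turns x-differences of y-derivatives of S'_y into values of
y-derivatives of F, by the mean value theorem. -/
lemma hasDerivAt_iterate_x (hd : BoxData α β S χ) {x y : ℝ} (hx : x ∈ Ioo α β)
    (hy : y ∈ Ioo α β) (i : ℕ) :
    HasDerivAt (fun t => (partialY univ)^[i] (partialY univ S) (t, y))
      (mixedPartial univ 0 i (mixedHessian univ S) (x, y)) x := by
  have h := hasDerivAt_partialX (isOpen_openBox α β)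
    (contDiffOn_iterate_partialY (isOpen_openBox α β) hd.smooth_partialY i)
    (show (x, y) ∈ openBox α β from ⟨hx, hy⟩)
  rwa [partialX_iterate_partialY_comm (isOpen_openBox α β) hd.smooth_partialY i
    (show (x, y) ∈ openBox α β from ⟨hx, hy⟩)] at h

/-- The mean value theorem in `x` for the difference of the `y`-derivatives of `S'_y`. -/
lemma exists_iterate_sub_eq (hd : BoxData α β S χ) {x x' y : ℝ} (hx : x ∈ Ioo α β)
    (hx' : x' ∈ Ioo α β) (hy : y ∈ Ioo α β) (i : ℕ) : ∃ ξ ∈ uIcc x x', ξ ∈ Ioo α β ∧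
      (partialY univ)^[i] (partialY univ S) (x, y) - (partialY univ)^[i] (partialY univ S) (x', y) =
        (x - x') * mixedPartial univ 0 i (mixedHessian univ S) (ξ, y) := by
  have main : ∀ {u v : ℝ}, u ∈ Ioo α β → v ∈ Ioo α β → u < v → ∃ ξ ∈ Icc u v, ξ ∈ Ioo α β ∧
      (partialY univ)^[i] (partialY univ S) (v, y) - (partialY univ)^[i] (partialY univ S) (u, y) =
        (v - u) * mixedPartial univ 0 i (mixedHessian univ S) (ξ, y) := by
    intro u v hu hv huv
    have hsub : Icc u v ⊆ Ioo α β := ordConnected_Ioo.out hu hv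
    obtain ⟨ξ, hξ, e⟩ := exists_hasDerivAt_eq_slope
      (fun t => (partialY univ)^[i] (partialY univ S) (t, y))
      (fun t => mixedPartial univ 0 i (mixedHessian univ S) (t, y)) huv
      (fun t ht => (hd.hasDerivAt_iterate_x (hsub ht) hy i).continuousAt.continuousWithinAt)
      (fun t ht => hd.hasDerivAt_iterate_x (hsub (Ioo_subset_Icc_self ht)) hy i)
    refine ⟨ξ, Ioo_subset_Icc_self hξ, hsub (Ioo_subset_Icc_self hξ), ?_⟩
    have : v - u ≠ 0 := by linarith
    rw [e]; field_simp
  rcases lt_trichotomy x x' with h | h | h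
  · obtain ⟨ξ, hξ, hξI, e⟩ := main hx hx' h
    refine ⟨ξ, by rwa [uIcc_of_le h.le], hξI, ?_⟩
    linarith
  · subst h
    exact ⟨x, left_mem_uIcc, hx, by simp⟩
  · obtain ⟨ξ, hξ, hξI, e⟩ := main hx' hx h
    exact ⟨ξ, by rwa [uIcc_of_ge h.le], hξI, e⟩

/-- The oscillatory estimate for the kernel of `T T*` with a sharp cutoff of the values of `F`. -/
lemma exists_osc_bound (hd : BoxData α β S χ) (n : ℕ)
    (hF : Away (openBox α β) (mixedPartial univ 0 (n + 1) (mixedHessian univ S)) 0) :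
    ∃ C : ℝ, 0 < C ∧ ∀ l : ℝ, 0 < l → ∀ T : Set ℝ, OrdConnected T → ∀ m : ℝ, 0 < m →
      ∀ x ∈ Ioo α β, ∀ x' ∈ Ioo α β,
      (∀ y ∈ Ioo α β, mixedHessian univ S (x, y) ∈ T → mixedHessian univ S (x', y) ∈ T →
        m ≤ |partialY univ S (x, y) - partialY univ S (x', y)|) →
      ‖∫ y in Ioo α β ∩ {y | mixedHessian univ S (x, y) ∈ T ∧ mixedHessian univ S (x', y) ∈ T},
        phaseDiff S χ l x x' y‖ ≤ C / (l * m) := by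
  obtain ⟨M, hM0, hM⟩ := hd.exists_amp_bound
  have hβα : 0 < β - α := sub_pos.2 hd.lt
  refine ⟨((2 : ℝ) ^ n * (2 ^ n * 2 ^ n)) * ((4 + (β - α)) * M), by positivity, ?_⟩
  intro l hl T hT m hm x hx x' hx' hg
  obtain ⟨ψ₁, ψ₂, hψ, hψ₁, hψ₁c, -, bψ, bψ₁, -⟩ := hM x x'
  set I := Ioo α β with hI
  have hIo : OrdConnected I := ordConnected_Ioo
  -- H 0 is the derivative of the phase difference, and H (n + 1) equals x - x' times a value of
  -- F^{(0,n+1)}, so it has one sign.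
  set H : ℕ → ℝ → ℝ := fun i y => (partialY univ)^[i] (partialY univ S) (x, y) -
    (partialY univ)^[i] (partialY univ S) (x', y) with hH
  have hHc : DerivChain I H := fun i y hy =>
    (hd.derivChain_partialY hx i y hy).sub (hd.derivChain_partialY hx' i y hy)
  have hHs : Away I (H (n + 1)) 0 := by
    have key : ∀ y ∈ I, ∃ ξ ∈ I, H (n + 1) y =
        (x - x') * mixedPartial univ 0 (n + 1) (mixedHessian univ S) (ξ, y) := fun y hy => by
      obtain ⟨ξ, -, hξ, e⟩ := hd.exists_iterate_sub_eq hx hx' hy (n + 1)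
      exact ⟨ξ, hξ, e⟩
    rcases le_total x x' with hxx | hxx <;> rcases hF with hF | hF
    · refine Or.inr fun y hy => ?_
      obtain ⟨ξ, hξ, e⟩ := key y hy
      have := hF (ξ, y) ⟨hξ, hy⟩
      rw [e]; nlinarith
    · refine Or.inl fun y hy => ?_
      obtain ⟨ξ, hξ, e⟩ := key y hy
      have := hF (ξ, y) ⟨hξ, hy⟩
      rw [e]; nlinarith
    · refine Or.inl fun y hy => ?_
      obtain ⟨ξ, hξ, e⟩ := key y hy
      have := hF (ξ, y) ⟨hξ, hy⟩
      rw [e]; nlinarith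
    · refine Or.inr fun y hy => ?_
      obtain ⟨ξ, hξ, e⟩ := key y hy
      have := hF (ξ, y) ⟨hξ, hy⟩
      rw [e]; nlinarith
  have hFs : ∀ x ∈ I, Away I (fun y => mixedPartial univ 0 (n + 1) (mixedHessian univ S) (x, y)) 0 :=
    fun x hx => hF.imp (fun h y hy => h (x, y) ⟨hx, hy⟩) (fun h y hy => h (x, y) ⟨hx, hy⟩)
  -- Three partitions are intersected: one makes the phase derivative monotone, the other two make
  -- F(x,·) and F(x',·) monotone, so that the cutoffs to T leave intervals. The count (2 ^ n)³ is
  -- independent of x, x' and T.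
  obtain ⟨l₁, hl₁, hp₁⟩ := exists_sign_partition hIo n H hHc hHs
  obtain ⟨l₂, hl₂, hp₂⟩ := exists_sign_partition hIo n _ (hd.derivChain_hessian_y hx) (hFs x hx)
  obtain ⟨l₃, hl₃, hp₃⟩ := exists_sign_partition hIo n _ (hd.derivChain_hessian_y hx') (hFs x' hx')
  set A := I ∩ {y | mixedHessian univ S (x, y) ∈ T ∧ mixedHessian univ S (x', y) ∈ T} with hA
  have hpiece : ∀ k : ℕ × ℕ × ℕ, OrdConnected (A ∩ (fun y => (l₁ y, l₂ y, l₃ y)) ⁻¹' {k}) := by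
    rintro ⟨k₁, k₂, k₃⟩
    have o₂ := ordConnected_inter_preimage (hp₂ k₂).1 hT (monotoneOn_or_antitoneOn (hp₂ k₂).1
      (fun y hy => hd.derivChain_hessian_y hx 0 y hy.1) (hp₂ k₂).2)
    have o₃ := ordConnected_inter_preimage (hp₃ k₃).1 hT (monotoneOn_or_antitoneOn (hp₃ k₃).1
      (fun y hy => hd.derivChain_hessian_y hx' 0 y hy.1) (hp₃ k₃).2)
    have e : A ∩ (fun y => (l₁ y, l₂ y, l₃ y)) ⁻¹' {(k₁, k₂, k₃)} = (I ∩ l₁ ⁻¹' {k₁}) ∩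
        ((I ∩ l₂ ⁻¹' {k₂} ∩ (fun y => mixedPartial univ 0 0 (mixedHessian univ S) (x, y)) ⁻¹' T) ∩
        (I ∩ l₃ ⁻¹' {k₃} ∩ (fun y => mixedPartial univ 0 0 (mixedHessian univ S) (x', y)) ⁻¹' T)) := by
      ext y
      simp only [hA, mem_inter_iff, mem_preimage, mem_singleton_iff, Prod.mk.injEq, mem_ofPred_eq,
        mixedPartial, Function.iterate_zero, id]
      tauto
    rw [e]
    exact (hp₁ k₁).1.inter (o₂.inter o₃)
  have := norm_setIntegral_le_card_mul (f := phaseDiff S χ l x x') (A := A)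
    (b := (4 + (β - α)) * M / (l * m)) (by positivity)
    (Finset.range (2 ^ n) ×ˢ Finset.range (2 ^ n) ×ˢ Finset.range (2 ^ n))
    (fun y => (l₁ y, l₂ y, l₃ y)) (fun y _ => by simp [hl₁ y, hl₂ y, hl₃ y])
    (fun k _ => (hpiece k).measurableSet) (fun k _ => ?_)
  · refine this.trans (le_of_eq ?_)
    simp only [Finset.card_product, Finset.card_range]
    push_cast; ring
  · have hsub : A ∩ (fun y => (l₁ y, l₂ y, l₃ y)) ⁻¹' {k} ⊆ I := fun y hy => hy.1.1
    refine norm_setIntegral_exp_le (hpiece k) (hsub.trans Ioo_subset_Icc_self)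
      (φ := fun y => S (x, y) - S (x', y)) (g := H 0) (g₁ := H 1) (fun y hy => ?_)
      (fun y hy => hHc 0 y (hsub hy))
      (fun y hy => (hHc 1 y (hsub hy)).continuousAt.continuousWithinAt)
      ((hp₁ k.1).2.subset fun y hy => ⟨hsub hy, ?_⟩) hm (fun y hy => hg y hy.1.1 hy.1.2.1 hy.1.2.2)
      hψ hψ₁c bψ bψ₁ hd.lt.le hl
    · exact (hasDerivAt_partialY (isOpen_openBox α β) hd.smooth ⟨hx, hsub hy⟩).sub
        (hasDerivAt_partialY (isOpen_openBox α β) hd.smooth ⟨hx', hsub hy⟩)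
    · have := hy.2
      simp only [mem_preimage, mem_singleton_iff] at this ⊢
      rw [← this]

end BoxData

/-! ### Bounds for the pieces and their dyadic sum -/

/-- Schur's test. -/
theorem opBound_of_schur {μ : Measure ℝ} [IsFiniteMeasure μ] {K : ℝ → ℝ → ℂ} (hK : BddKernel K)
    {a b : ℝ} (ha : 0 ≤ a) (hb : 0 ≤ b) (h₁ : ∀ x, ∫⁻ y, ‖K x y‖ₑ ∂μ ≤ ENNReal.ofReal a)
    (h₂ : ∀ y, ∫⁻ x, ‖K x y‖ₑ ∂μ ≤ ENNReal.ofReal b) : OpBound μ K (Real.sqrt (a * b)) := by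
  -- Taking absolute values inside the kernel of T T* and using Tonelli, each of its row integrals
  -- is at most ab.
  refine opBound_of_ttStar hK fun x => ?_
  rw [integral_eq_lintegral_of_nonneg_ae (Eventually.of_forall fun _ => norm_nonneg _)
    (show Measurable fun x' => ‖ttStar μ K x x'‖ from
      (hK.ttStar.meas.comp measurable_prodMk_left).norm).aestronglyMeasurable]
  refine ENNReal.toReal_le_of_le_ofReal (by positivity) ?_
  have hm : Measurable fun q : ℝ × ℝ => ‖K x q.2‖ₑ * ‖K q.1 q.2‖ₑ :=
    ((hK.meas.comp (measurable_const.prodMk measurable_snd)).enorm).mul hK.meas.enorm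
  calc ∫⁻ x', ENNReal.ofReal ‖ttStar μ K x x'‖ ∂μ
      ≤ ∫⁻ x', ∫⁻ y, ‖K x y‖ₑ * ‖K x' y‖ₑ ∂μ ∂μ := by
        refine lintegral_mono fun x' => ?_
        rw [ofReal_norm]
        refine (enorm_integral_le_lintegral_enorm _).trans (lintegral_mono fun y => ?_)
        rw [enorm_mul]
        gcongr
        simp [enorm_eq_nnnorm]
    _ = ∫⁻ y, ∫⁻ x', ‖K x y‖ₑ * ‖K x' y‖ₑ ∂μ ∂μ := lintegral_lintegral_swap hm.aemeasurable
    _ ≤ ∫⁻ y, ‖K x y‖ₑ * ENNReal.ofReal b ∂μ := by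
        refine lintegral_mono fun y => ?_
        simp only
        rw [lintegral_const_mul']
        · gcongr; exact h₂ y
        · simp
    _ ≤ ENNReal.ofReal a * ENNReal.ofReal b := by
        rw [lintegral_mul_const' _ _ ENNReal.ofReal_ne_top]
        gcongr; exact h₁ x
    _ = ENNReal.ofReal (a * b) := (ENNReal.ofReal_mul ha).symm

/-- The kernel of `T_λ`, restricted to the region `R`. -/
noncomputable def cutKernel (S : ℝ × ℝ → ℝ) (χ : ℝ × ℝ → ℂ) (R : Set (ℝ × ℝ)) (l x y : ℝ) : ℂ :=
  R.indicator (Function.uncurry fun x y => oscKernel S χ l (x, y)) (x, y)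

lemma cutKernel_union {S : ℝ × ℝ → ℝ} {χ : ℝ × ℝ → ℂ} {R R' : Set (ℝ × ℝ)} (h : Disjoint R R')
    (l x y : ℝ) :
    cutKernel S χ (R ∪ R') l x y = cutKernel S χ R l x y + cutKernel S χ R' l x y := by
  unfold cutKernel
  rw [indicator_union_of_disjoint h]

namespace BoxData

variable {α β : ℝ} {S : ℝ × ℝ → ℝ} {χ : ℝ × ℝ → ℂ}

lemma bddKernel_cut (hd : BoxData α β S χ) {R : Set (ℝ × ℝ)} (hR : MeasurableSet R) (l : ℝ) :
    BddKernel (cutKernel S χ R l) := (hd.bddKernel l).indicator hR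

lemma measurableSet_region (hd : BoxData α β S χ) {X T : Set ℝ} (hX : MeasurableSet X)
    (hT : MeasurableSet T) :
    MeasurableSet (openBox α β ∩ {p | p.1 ∈ X ∧ mixedHessian univ S p ∈ T}) := by
  classical
  have hD := (isOpen_openBox α β).measurableSet
  -- F is continuous only on the box; off it, F is replaced by 0.
  have hm : Measurable ((openBox α β).piecewise (mixedHessian univ S) 0) :=
    hd.smooth_hessian.continuousOn.measurable_piecewise continuousOn_const hD
  have e : openBox α β ∩ {p | p.1 ∈ X ∧ mixedHessian univ S p ∈ T} =
      openBox α β ∩ (Prod.fst ⁻¹' X ∩ ((openBox α β).piecewise (mixedHessian univ S) 0) ⁻¹' T) := by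
    ext p
    simp only [mem_inter_iff, mem_ofPred_eq, mem_preimage]
    refine and_congr_right fun hp => ?_
    rw [piecewise_eq_of_mem _ _ _ hp]
  rw [e]
  exact hD.inter ((measurable_fst hX).inter (hm hT))

/-- The trivial bound for a region with short sections. -/
lemma exists_opBound_schur (hd : BoxData α β S χ) : ∃ N : ℝ, 0 < N ∧
    ∀ (l : ℝ) (R : Set (ℝ × ℝ)) (lx ly : ℝ), MeasurableSet R → 0 ≤ lx → 0 ≤ ly →
      (∀ x ∈ Ioo α β, volume (Ioo α β ∩ {y | (x, y) ∈ R}) ≤ ENNReal.ofReal ly) →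
      (∀ y ∈ Ioo α β, volume (Ioo α β ∩ {x | (x, y) ∈ R}) ≤ ENNReal.ofReal lx) →
      OpBound (volume.restrict (Ioo α β)) (cutKernel S χ R l) (Real.sqrt (N * (lx * ly))) := by
  obtain ⟨N, hN⟩ := hd.cpt.exists_bound_of_continuous hd.amp.continuous
  set N' := max N 1
  refine ⟨N' * N', by positivity, fun l R lx ly hR hlx hly hy hx => ?_⟩
  have hN'0 : 0 ≤ N' := by positivity
  have hz : ∀ x y, (x, y) ∉ openBox α β → cutKernel S χ R l x y = 0 := fun x y h => by
    have : χ (x, y) = 0 := by by_contra h'; exact h (hd.supp _ h')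
    unfold cutKernel
    simp [Function.uncurry, oscKernel, this]
  have hb : ∀ x y, ‖cutKernel S χ R l x y‖ₑ ≤ R.indicator (fun _ => ENNReal.ofReal N') (x, y) := by
    intro x y
    unfold cutKernel
    by_cases h : (x, y) ∈ R
    · rw [indicator_of_mem h, indicator_of_mem h, ← ofReal_norm]
      refine ENNReal.ofReal_le_ofReal ?_
      simp only [Function.uncurry, oscKernel, norm_mul, norm_exp_phase, one_mul]
      exact (hN _).trans (le_max_left _ _)
    · rw [indicator_of_notMem h]; simp
  have key : N' * N' * (lx * ly) = (N' * ly) * (N' * lx) := by ring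
  rw [key]
  refine opBound_of_schur (hd.bddKernel_cut hR l) (by positivity) (by positivity) (fun x => ?_)
    (fun y => ?_)
  · by_cases hxI : x ∈ Ioo α β
    · have hs : MeasurableSet {y | (x, y) ∈ R} := measurable_prodMk_left hR
      calc ∫⁻ y in Ioo α β, ‖cutKernel S χ R l x y‖ₑ
          ≤ ∫⁻ y in Ioo α β, {y | (x, y) ∈ R}.indicator (fun _ => ENNReal.ofReal N') y :=
            lintegral_mono fun y => hb x y
        _ = ENNReal.ofReal N' * volume (Ioo α β ∩ {y | (x, y) ∈ R}) := by
            rw [lintegral_indicator_const hs, Measure.restrict_apply hs, inter_comm]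
        _ ≤ ENNReal.ofReal (N' * ly) := by
            rw [ENNReal.ofReal_mul hN'0]; gcongr; exact hy x hxI
    · have : ∀ y, cutKernel S χ R l x y = 0 := fun y => hz x y fun h => hxI h.1
      simp [this]
  · by_cases hyI : y ∈ Ioo α β
    · have hs : MeasurableSet {x | (x, y) ∈ R} := measurable_prodMk_right hR
      calc ∫⁻ x in Ioo α β, ‖cutKernel S χ R l x y‖ₑ
          ≤ ∫⁻ x in Ioo α β, {x | (x, y) ∈ R}.indicator (fun _ => ENNReal.ofReal N') x :=
            lintegral_mono fun x => hb x y
        _ = ENNReal.ofReal N' * volume (Ioo α β ∩ {x | (x, y) ∈ R}) := by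
            rw [lintegral_indicator_const hs, Measure.restrict_apply hs, inter_comm]
        _ ≤ ENNReal.ofReal (N' * lx) := by
            rw [ENNReal.ofReal_mul hN'0]; gcongr; exact hx y hyI
    · have : ∀ x, cutKernel S χ R l x y = 0 := fun x => hz x y fun h => hyI h.2
      simp [this]

lemma exists_volume_sublevel_y (hd : BoxData α β S χ) (n : ℕ) {c : ℝ} (hc : 0 < c)
    (hF : Away (openBox α β) (mixedPartial univ 0 (n + 1) (mixedHessian univ S)) c) :
    ∃ C : ℝ, 0 < C ∧ ∀ x ∈ Ioo α β, ∀ a, 0 < a →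
      volume (Ioo α β ∩ {y | |mixedHessian univ S (x, y)| ≤ a}) ≤
        ENNReal.ofReal (C * a ^ ((n + 1 : ℝ)⁻¹)) := by
  obtain ⟨C, hC, h⟩ := exists_sublevel_measure n c hc
  exact ⟨C, hC, fun x hx a ha => h _ _ ordConnected_Ioo (hd.derivChain_hessian_y hx)
    (hF.imp (fun h y hy => h (x, y) ⟨hx, hy⟩) fun h y hy => h (x, y) ⟨hx, hy⟩) a ha⟩

lemma exists_volume_sublevel_x (hd : BoxData α β S χ) (n : ℕ) {c : ℝ} (hc : 0 < c)
    (hF : Away (openBox α β) (mixedPartial univ (n + 1) 0 (mixedHessian univ S)) c) :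
    ∃ C : ℝ, 0 < C ∧ ∀ y ∈ Ioo α β, ∀ a, 0 < a →
      volume (Ioo α β ∩ {x | |mixedHessian univ S (x, y)| ≤ a}) ≤
        ENNReal.ofReal (C * a ^ ((n + 1 : ℝ)⁻¹)) := by
  obtain ⟨C, hC, h⟩ := exists_sublevel_measure n c hc
  exact ⟨C, hC, fun y hy a ha => h _ _ ordConnected_Ioo (hd.derivChain_hessian_x hy)
    (hF.imp (fun h x hx => h (x, y) ⟨hx, hy⟩) fun h x hx => h (x, y) ⟨hx, hy⟩) a ha⟩

/-- The oscillatory bound for the piece of the operator on which `F` is of size `a`. -/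
lemma exists_opBound_piece (hd : BoxData α β S χ) (n : ℕ) {c : ℝ} (hc : 0 < c)
    (hF : Away (openBox α β) (mixedPartial univ 0 (n + 1) (mixedHessian univ S)) c)
    (ρ : ℝ) {C₀ κ : ℝ} (hC₀ : 0 < C₀) (hκ : 0 < κ) : ∃ C : ℝ, 0 < C ∧ ∀ l : ℝ, 0 < l →
    ∀ a : ℝ, 0 < a → 1 ≤ l * a * (a ^ ρ * a ^ ((n + 1 : ℝ)⁻¹)) →
    ∀ X T : Set ℝ, MeasurableSet X → OrdConnected T → T ⊆ Icc (-(2 * a)) (2 * a) →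
    (∀ x ∈ Ioo α β ∩ X, ∀ x' ∈ Ioo α β ∩ X, ∀ y ∈ Ioo α β, mixedHessian univ S (x, y) ∈ T →
      mixedHessian univ S (x', y) ∈ T →
      (|x - x'| ≤ C₀ * a ^ ρ ∧
        κ * a * |x - x'| ≤ |partialY univ S (x, y) - partialY univ S (x', y)|) ∨
      (Real.sqrt a < |x - x'| ∧
        κ * |x - x'| ^ 3 ≤ |partialY univ S (x, y) - partialY univ S (x', y)|)) →
    OpBound (volume.restrict (Ioo α β))
      (cutKernel S χ (openBox α β ∩ {p | p.1 ∈ X ∧ mixedHessian univ S p ∈ T}) l)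
      (Real.sqrt (C * ((l * a)⁻¹ * (l * a * (a ^ ρ * a ^ ((n + 1 : ℝ)⁻¹))) ^ (1 / 4 : ℝ)))) := by
  obtain ⟨C₁, hC₁, hosc⟩ := hd.exists_osc_bound n (hF.weaken hc.le)
  obtain ⟨C₂, hC₂, hvol⟩ := hd.exists_volume_sublevel_y n hc hF
  obtain ⟨M, hM, hamp⟩ := hd.exists_amp_bound
  set τ : ℝ := (n + 1 : ℝ)⁻¹ with hτ
  refine ⟨8 * ((M * (C₂ * 2 ^ τ)) ^ (1 / 4 : ℝ) * (C₁ / κ) ^ (3 / 4 : ℝ) * C₀ ^ (1 / 4 : ℝ)) + C₁ / κ,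
    by positivity, ?_⟩
  intro l hl a ha hs X T hX hT hT2 hg
  have hRm := hd.measurableSet_region hX hT.measurableSet
  set R := openBox α β ∩ {p | p.1 ∈ X ∧ mixedHessian univ S p ∈ T} with hR
  -- A and Bc are the coefficients of the near majorant |t|^{-3/4} and the far majorant |t|⁻³. A is
  -- the weighted geometric mean of the trivial bound and the van der Corput bound.
  set A : ℝ := (M * (C₂ * (2 * a) ^ τ)) ^ (1 / 4 : ℝ) * (C₁ / (l * κ * a)) ^ (3 / 4 : ℝ) with hA
  set Bc : ℝ := C₁ / (l * κ) with hBc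
  have hA0 : 0 ≤ A := by positivity
  have hB0 : 0 ≤ Bc := by positivity
  have hℓ : 0 < C₀ * a ^ ρ := by positivity
  have hsa : 0 < Real.sqrt a := Real.sqrt_pos.2 ha
  obtain ⟨in1, iv1⟩ := integral_abs_rpow_near hℓ
  obtain ⟨in2, iv2⟩ := integral_abs_rpow_far hsa
  set W : ℝ → ℝ := fun t =>
    A * (Iic (C₀ * a ^ ρ)).indicator (fun s : ℝ => s ^ (-(3 / 4) : ℝ)) |t| +
    Bc * (Ioi (Real.sqrt a)).indicator (fun s : ℝ => s ^ (-3 : ℝ)) |t| with hW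
  have hn1 : ∀ t : ℝ, 0 ≤ (Iic (C₀ * a ^ ρ)).indicator (fun s : ℝ => s ^ (-(3 / 4) : ℝ)) |t| :=
    fun t => by
      rw [indicator_apply]; split_ifs
      · positivity
      · exact le_rfl
  have hn2 : ∀ t : ℝ, 0 ≤ (Ioi (Real.sqrt a)).indicator (fun s : ℝ => s ^ (-3 : ℝ)) |t| :=
    fun t => by
      rw [indicator_apply]; split_ifs
      · positivity
      · exact le_rfl
  have hWi : Integrable W := (in1.const_mul A).add (in2.const_mul Bc)
  have hW0 : ∀ t, 0 ≤ W t := fun t => by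
    have h1 := hn1 t
    have h2 := hn2 t
    positivity
  have hWv : ∫ t, W t = A * (8 * (C₀ * a ^ ρ) ^ (1 / 4 : ℝ)) + Bc * (1 / a) := by
    rw [hW, integral_add (in1.const_mul A) (in2.const_mul Bc), integral_const_mul,
      integral_const_mul, iv1, iv2, Real.sq_sqrt ha.le]
  -- the pointwise bound for the kernel of `T T*`
  have hL : ∀ x, ∀ x' ∈ Ioo α β, x' ≠ x →
      ‖ttStar (volume.restrict (Ioo α β)) (cutKernel S χ R l) x x'‖ ≤ W (x - x') := by
    intro x x' hx' hne
    have e0 := ttStar_indicator (α := α) (β := β) (S := S) (χ := χ) l hRm x x'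
    change ttStar (volume.restrict (Ioo α β)) (cutKernel S χ R l) x x' = _ at e0
    rw [e0]
    set Y := Ioo α β ∩ {y | (x, y) ∈ R ∧ (x', y) ∈ R} with hY
    -- A point of Y puts x in the box and in X; it also yields the inequality √a < |x - x'| in the
    -- far case.
    rcases Y.eq_empty_or_nonempty with hYe | ⟨y₀, hy₀⟩
    · rw [hYe]; simpa using hW0 _
    have hx : x ∈ Ioo α β := hy₀.2.1.1.1
    have hxX : x ∈ X := hy₀.2.1.2.1
    have hxX' : x' ∈ X := hy₀.2.2.2.1
    have hd0 : 0 < |x - x'| := abs_pos.2 (sub_ne_zero.2 (Ne.symm hne))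
    have hYT : Y = Ioo α β ∩
        {y | mixedHessian univ S (x, y) ∈ T ∧ mixedHessian univ S (x', y) ∈ T} := by
      ext y
      simp only [hY, hR, openBox, mem_inter_iff, mem_ofPred_eq, mem_prod]
      tauto
    have hg' := hg x ⟨hx, hxX⟩ x' ⟨hx', hxX'⟩
    by_cases hcase : |x - x'| ≤ C₀ * a ^ ρ
    · have b1 : ‖∫ y in Y, phaseDiff S χ l x x' y‖ ≤ C₁ / (l * (κ * a * |x - x'|)) := by
        rw [hYT]
        refine hosc l hl T hT _ (by positivity) x hx x' hx' fun y hy h1 h2 => ?_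
        rcases hg' y hy h1 h2 with ⟨-, h⟩ | ⟨h3, h⟩
        · exact h
        -- At distance beyond √a the cubic bound implies the linear one, so the near estimate holds
        -- whichever alternative a given y satisfies.
        · refine le_trans ?_ h
          have h4 : a ≤ |x - x'| ^ 2 := by
            have := pow_le_pow_left₀ hsa.le h3.le 2
            rwa [Real.sq_sqrt ha.le] at this
          have : a * |x - x'| ≤ |x - x'| ^ 3 := by nlinarith
          nlinarith
      have b2 : ‖∫ y in Y, phaseDiff S χ l x x' y‖ ≤ M * (C₂ * (2 * a) ^ τ) := by
        obtain ⟨ψ₁, ψ₂, -, -, -, -, bψ, -, -⟩ := hamp x x'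
        have hv : volume Y ≤ ENNReal.ofReal (C₂ * (2 * a) ^ τ) := by
          refine (measure_mono ?_).trans (hvol x hx (2 * a) (by positivity))
          intro y hy
          exact ⟨hy.1, abs_le.2 (hT2 hy.2.1.2.2)⟩
        refine (norm_setIntegral_le_of_norm_le_const (C := M)
          (hv.trans_lt ENNReal.ofReal_lt_top) fun y _ => ?_).trans ?_
        · rw [phaseDiff, norm_mul, norm_exp_phase, one_mul]; exact bψ y
        · refine mul_le_mul_of_nonneg_left ?_ hM.le
          exact ENNReal.toReal_le_of_le_ofReal (by positivity) hv
      set N := ‖∫ y in Y, phaseDiff S χ l x x' y‖ with hN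
      have hN0 : 0 ≤ N := norm_nonneg _
      have b3 : N ≤ A * |x - x'| ^ (-(3 / 4) : ℝ) := by
        have e1 : C₁ / (l * (κ * a * |x - x'|)) = C₁ / (l * κ * a) * |x - x'|⁻¹ := by
          field_simp
        have e2 : N = N ^ (1 / 4 : ℝ) * N ^ (3 / 4 : ℝ) := by
          rw [← Real.rpow_add_of_nonneg hN0 (by norm_num) (by norm_num)]; norm_num
        rw [e2]
        calc N ^ (1 / 4 : ℝ) * N ^ (3 / 4 : ℝ)
            ≤ (M * (C₂ * (2 * a) ^ τ)) ^ (1 / 4 : ℝ) *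
              (C₁ / (l * κ * a) * |x - x'|⁻¹) ^ (3 / 4 : ℝ) := by
              rw [e1] at b1
              gcongr
          _ = A * |x - x'| ^ (-(3 / 4) : ℝ) := by
              rw [Real.mul_rpow (x := C₁ / (l * κ * a)) (by positivity) (by positivity),
                Real.inv_rpow (abs_nonneg _),
                ← Real.rpow_neg (abs_nonneg _), hA]
              ring
      refine b3.trans ?_
      rw [hW]
      simp only
      rw [indicator_of_mem (show |x - x'| ∈ Iic (C₀ * a ^ ρ) from hcase)]
      exact le_add_of_nonneg_right (mul_nonneg hB0 (hn2 _))
    · have hfar : ∀ y ∈ Ioo α β, mixedHessian univ S (x, y) ∈ T → mixedHessian univ S (x', y) ∈ T →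
          Real.sqrt a < |x - x'| ∧
          κ * |x - x'| ^ 3 ≤ |partialY univ S (x, y) - partialY univ S (x', y)| :=
        fun y hy h1 h2 => (hg' y hy h1 h2).resolve_left fun h => hcase h.1
      have hsd : Real.sqrt a < |x - x'| := (hfar y₀ hy₀.1 hy₀.2.1.2.2 hy₀.2.2.2.2).1
      have b1 : ‖∫ y in Y, phaseDiff S χ l x x' y‖ ≤ C₁ / (l * (κ * |x - x'| ^ 3)) := by
        rw [hYT]
        exact hosc l hl T hT _ (by positivity) x hx x' hx' fun y hy h1 h2 => (hfar y hy h1 h2).2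
      refine b1.trans ?_
      rw [hW]
      simp only
      rw [indicator_of_mem (show |x - x'| ∈ Ioi (Real.sqrt a) from hsd)]
      refine le_trans (le_of_eq ?_) (le_add_of_nonneg_left (mul_nonneg hA0 (hn1 _)))
      rw [Real.rpow_neg (abs_nonneg _), show (3 : ℝ) = ((3 : ℕ) : ℝ) by norm_num,
        Real.rpow_natCast, hBc]
      field_simp
  have hfin := opBound_of_ttStar (μ := volume.restrict (Ioo α β)) (hd.bddKernel_cut hRm l)
    (fun x => setIntegral_norm_le_of_majorant measurableSet_Ioo hWi hW0 (hL x))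
  refine hfin.mono (Real.sqrt_le_sqrt ?_)
  rw [hWv]
  set w := a ^ ρ * a ^ τ with hw
  have hw0 : 0 < w := by positivity
  have hla : 0 < l * a := by positivity
  have e3 : A * (8 * (C₀ * a ^ ρ) ^ (1 / 4 : ℝ)) =
      8 * ((M * (C₂ * 2 ^ τ)) ^ (1 / 4 : ℝ) * (C₁ / κ) ^ (3 / 4 : ℝ) * C₀ ^ (1 / 4 : ℝ)) *
        ((l * a)⁻¹ * (l * a * w) ^ (1 / 4 : ℝ)) := by
    have h1 : M * (C₂ * (2 * a) ^ τ) = M * (C₂ * 2 ^ τ) * a ^ τ := by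
      rw [Real.mul_rpow (by norm_num) ha.le]; ring
    have h2 : C₁ / (l * κ * a) = C₁ / κ * (l * a)⁻¹ := by field_simp
    have h3 : ((l * a)⁻¹) ^ (3 / 4 : ℝ) = (l * a)⁻¹ * (l * a) ^ (1 / 4 : ℝ) := by
      have h4 : (l * a)⁻¹ ^ (3 / 4 : ℝ) * (l * a)⁻¹ ^ (1 / 4 : ℝ) = (l * a)⁻¹ := by
        rw [← Real.rpow_add (by positivity)]; norm_num
      have h5 : (l * a)⁻¹ ^ (1 / 4 : ℝ) * (l * a) ^ (1 / 4 : ℝ) = 1 := by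
        rw [← Real.mul_rpow (by positivity) hla.le, inv_mul_cancel₀ hla.ne', Real.one_rpow]
      calc ((l * a)⁻¹) ^ (3 / 4 : ℝ) = ((l * a)⁻¹) ^ (3 / 4 : ℝ) *
            ((l * a)⁻¹ ^ (1 / 4 : ℝ) * (l * a) ^ (1 / 4 : ℝ)) := by rw [h5, mul_one]
        _ = _ := by rw [← mul_assoc, h4]
    rw [hA, h1, h2, Real.mul_rpow (by positivity) (by positivity : 0 ≤ a ^ τ),
      Real.mul_rpow (by positivity) (by positivity : 0 ≤ (l * a)⁻¹), h3,
      Real.mul_rpow hC₀.le (by positivity : 0 ≤ a ^ ρ), Real.mul_rpow hla.le hw0.le, hw,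
      Real.mul_rpow (by positivity) (by positivity : 0 ≤ a ^ τ)]
    ring
  -- The far part contributes (la)⁻¹, absorbed because l a w ≥ 1 on the shells in use.
  have e4 : Bc * (1 / a) ≤ C₁ / κ * ((l * a)⁻¹ * (l * a * w) ^ (1 / 4 : ℝ)) := by
    have h1 : 1 ≤ (l * a * w) ^ (1 / 4 : ℝ) := Real.one_le_rpow hs (by norm_num)
    have h2 : Bc * (1 / a) = C₁ / κ * ((l * a)⁻¹ * 1) := by rw [hBc]; field_simp
    rw [h2]
    gcongr
  rw [e3, add_mul]
  gcongr

/-- Dyadic summation of the pieces. -/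
lemma normDecay_of_pieces (hd : BoxData α β S χ) {σ C A : ℝ} (hσ : 0 < σ) (hσ2 : σ ≤ 2)
    (hC : 0 < C) (hA : ∀ p ∈ openBox α β, |mixedHessian univ S p| ≤ A)
    (hcore : ∀ l : ℝ, 0 < l → ∀ a : ℝ, 0 < a → OpBound (volume.restrict (Ioo α β))
      (cutKernel S χ (openBox α β ∩ {p | |mixedHessian univ S p| < a}) l)
      (Real.sqrt (C * a ^ σ)))
    (hdy : ∀ l : ℝ, 0 < l → ∀ a : ℝ, 0 < a → 1 ≤ l * a * a ^ σ →
      OpBound (volume.restrict (Ioo α β))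
      (cutKernel S χ (openBox α β ∩
        {p | a ≤ |mixedHessian univ S p| ∧ |mixedHessian univ S p| < 2 * a}) l)
      (C * Real.sqrt ((l * a)⁻¹ * (l * a * a ^ σ) ^ (1 / 4 : ℝ)))) :
    NormDecay S χ (σ / (2 * (1 + σ))) := by
  -- The ratio of the geometric series: the squared norm bounds of consecutive shells fall by
  -- 2^{-1/4}.
  set q : ℝ := Real.sqrt ((2 : ℝ) ^ (-(1 / 4) : ℝ)) with hq
  have hq0 : 0 ≤ q := Real.sqrt_nonneg _
  have hq1 : q < 1 := by
    rw [hq, Real.sqrt_lt' one_pos, one_pow]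
    exact Real.rpow_lt_one_of_one_lt_of_neg (by norm_num) (by norm_num)
  refine ⟨Real.sqrt C + C * (1 - q)⁻¹, fun l hl => ?_⟩
  -- The threshold l a₀^{1+σ} = 1, where the Schur bound and the oscillatory bound agree.
  set a₀ : ℝ := l ^ (-(1 / (1 + σ))) with ha₀
  have ha₀0 : 0 < a₀ := by positivity
  have hσ1 : 1 + σ ≠ 0 := by positivity
  have hnorm : l * a₀ * a₀ ^ σ = 1 := by
    rw [mul_assoc, ← Real.rpow_one_add' ha₀0.le hσ1, ha₀, ← Real.rpow_mul hl.le,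
      show -(1 / (1 + σ)) * (1 + σ) = -1 by field_simp, Real.rpow_neg_one, mul_inv_cancel₀ hl.ne']
  have hroot : Real.sqrt (a₀ ^ σ) = l ^ (-(σ / (2 * (1 + σ)))) := by
    rw [Real.sqrt_eq_rpow, ha₀, ← Real.rpow_mul hl.le, ← Real.rpow_mul hl.le]
    congr 1; field_simp
  have hmeas : ∀ T : Set ℝ, MeasurableSet T →
      MeasurableSet (openBox α β ∩ {p | mixedHessian univ S p ∈ T}) := fun T hT => by
    simpa using hd.measurableSet_region MeasurableSet.univ hT
  have hm1 : ∀ a : ℝ, MeasurableSet (openBox α β ∩ {p | |mixedHessian univ S p| < a}) := fun a =>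
    hmeas {t | |t| < a} (measurableSet_lt measurable_norm measurable_const)
  have hm2 : ∀ a : ℝ, MeasurableSet (openBox α β ∩
      {p | a ≤ |mixedHessian univ S p| ∧ |mixedHessian univ S p| < 2 * a}) := fun a =>
    hmeas {t | a ≤ |t| ∧ |t| < 2 * a} ((measurableSet_le measurable_const measurable_norm).inter
      (measurableSet_lt measurable_norm measurable_const))
  have hstep : ∀ j : ℕ, OpBound (volume.restrict (Ioo α β))
      (cutKernel S χ (openBox α β ∩ {p | (2 : ℝ) ^ j * a₀ ≤ |mixedHessian univ S p| ∧
        |mixedHessian univ S p| < 2 * (2 ^ j * a₀)}) l) (C * Real.sqrt (a₀ ^ σ) * q ^ j) := by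
    intro j
    have h2j : (1 : ℝ) ≤ 2 ^ j := one_le_pow₀ (by norm_num)
    have e1 : l * (2 ^ j * a₀) * (2 ^ j * a₀) ^ σ = 2 ^ j * ((2 : ℝ) ^ j) ^ σ := by
      rw [Real.mul_rpow (by positivity) ha₀0.le]
      calc _ = 2 ^ j * ((2 : ℝ) ^ j) ^ σ * (l * a₀ * a₀ ^ σ) := by ring
        _ = _ := by rw [hnorm, mul_one]
    have h1 : 1 ≤ ((2 : ℝ) ^ j) ^ σ := Real.one_le_rpow h2j hσ.le
    refine (hdy l hl (2 ^ j * a₀) (by positivity) (by rw [e1]; nlinarith)).mono ?_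
    rw [e1, mul_assoc]
    refine mul_le_mul_of_nonneg_left ?_ hC.le
    have e2 : Real.sqrt (a₀ ^ σ) * q ^ j = Real.sqrt (a₀ ^ σ * ((2 : ℝ) ^ (-(1 / 4) : ℝ)) ^ j) := by
      have hqj : 0 ≤ q ^ j := by positivity
      rw [Real.sqrt_mul (by positivity), ← Real.sqrt_sq hqj, ← pow_mul, mul_comm j, pow_mul, hq,
        Real.sq_sqrt (by positivity)]
    rw [e2]
    refine Real.sqrt_le_sqrt ?_
    have e3 : (l * (2 ^ j * a₀))⁻¹ = a₀ ^ σ * ((2 : ℝ) ^ j)⁻¹ := by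
      have : a₀ ^ σ = (l * a₀)⁻¹ := eq_inv_of_mul_eq_one_right hnorm
      rw [this]
      rw [← mul_inv]; congr 1; ring
    rw [e3, mul_assoc]
    refine mul_le_mul_of_nonneg_left ?_ (by positivity)
    -- Here σ ≤ 2 enters: the growth 2^{j(1+σ)/4} is at most 2^{3j/4} and loses to the factor
    -- 2^{-j}.
    have e4 : (2 : ℝ) ^ j * ((2 : ℝ) ^ j) ^ σ ≤ ((2 : ℝ) ^ j) ^ (3 : ℝ) := by
      rw [← Real.rpow_one_add' (by positivity) hσ1]
      exact Real.rpow_le_rpow_of_exponent_le h2j (by linarith)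
    calc ((2 : ℝ) ^ j)⁻¹ * ((2 : ℝ) ^ j * ((2 : ℝ) ^ j) ^ σ) ^ (1 / 4 : ℝ)
        ≤ ((2 : ℝ) ^ j)⁻¹ * (((2 : ℝ) ^ j) ^ (3 : ℝ)) ^ (1 / 4 : ℝ) := by gcongr
      _ = ((2 : ℝ) ^ j) ^ (-(1 / 4) : ℝ) := by
          rw [← Real.rpow_mul (by positivity), ← Real.rpow_neg_one, ← Real.rpow_add (by positivity)]
          norm_num
      _ = ((2 : ℝ) ^ (-(1 / 4) : ℝ)) ^ j := by
          rw [← Real.rpow_natCast, ← Real.rpow_natCast, ← Real.rpow_mul (by norm_num),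
            ← Real.rpow_mul (by norm_num), mul_comm]
  have hsum : ∀ J : ℕ, OpBound (volume.restrict (Ioo α β))
      (cutKernel S χ (openBox α β ∩ {p | |mixedHessian univ S p| < 2 ^ J * a₀}) l)
      (Real.sqrt (C * a₀ ^ σ) + C * Real.sqrt (a₀ ^ σ) * ∑ j ∈ Finset.range J, q ^ j) := by
    intro J
    induction J with
    | zero => simpa using hcore l hl a₀ ha₀0
    | succ J ih =>
      have hdisj : Disjoint (openBox α β ∩ {p | |mixedHessian univ S p| < 2 ^ J * a₀})
          (openBox α β ∩ {p | (2 : ℝ) ^ J * a₀ ≤ |mixedHessian univ S p| ∧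
            |mixedHessian univ S p| < 2 * (2 ^ J * a₀)}) :=
        Set.disjoint_left.2 fun p hp hp' => absurd hp'.2.1 (not_le.2 hp.2)
      have e : openBox α β ∩ {p | |mixedHessian univ S p| < 2 ^ (J + 1) * a₀} =
          (openBox α β ∩ {p | |mixedHessian univ S p| < 2 ^ J * a₀}) ∪
          (openBox α β ∩ {p | (2 : ℝ) ^ J * a₀ ≤ |mixedHessian univ S p| ∧
            |mixedHessian univ S p| < 2 * (2 ^ J * a₀)}) := by
        rw [← inter_union_distrib_left]
        congr 1
        ext p
        have h3 : (2 : ℝ) ^ J * a₀ ≤ 2 ^ (J + 1) * a₀ := by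
          rw [pow_succ]; nlinarith [show 0 < (2 : ℝ) ^ J * a₀ by positivity]
        have h4 : (2 : ℝ) ^ (J + 1) * a₀ = 2 * (2 ^ J * a₀) := by ring
        simp only [mem_ofPred_eq, mem_union]
        rw [← h4]
        constructor
        · intro h
          rcases lt_or_ge |mixedHessian univ S p| (2 ^ J * a₀) with h5 | h5
          · exact Or.inl h5
          · exact Or.inr ⟨h5, h⟩
        · rintro (h | h)
          · exact h.trans_le h3
          · exact h.2
      rw [e, Finset.sum_range_succ, mul_add, ← add_assoc]
      refine (OpBound.add (hd.bddKernel_cut (hm1 _) l) (hd.bddKernel_cut (hm2 _) l)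
        (by positivity) (by positivity) ih (hstep J)).congr fun x y => ?_
      exact cutKernel_union hdisj l x y
  -- F is bounded, so finitely many shells exhaust the box and no limit of operators is needed.
  obtain ⟨J, hJ⟩ : ∃ J : ℕ, A < 2 ^ J * a₀ := by
    obtain ⟨J, hJ⟩ := pow_unbounded_of_one_lt (A / a₀) (one_lt_two (α := ℝ))
    exact ⟨J, by rwa [div_lt_iff₀ ha₀0] at hJ⟩
  have hfull : OpBound (volume.restrict (Ioo α β)) (fun x y => oscKernel S χ l (x, y))
      ((Real.sqrt C + C * (1 - q)⁻¹) * l ^ (-(σ / (2 * (1 + σ))))) := by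
    refine ((hsum J).mono ?_).congr fun x y => ?_
    · rw [Real.sqrt_mul hC.le, hroot, add_mul]
      have hgeo : ∑ j ∈ Finset.range J, q ^ j ≤ (1 - q)⁻¹ := by
        rw [← tsum_geometric_of_lt_one hq0 hq1]
        exact (summable_geometric_of_lt_one hq0 hq1).sum_le_tsum _ fun j _ => by positivity
      have hl0 : 0 ≤ l ^ (-(σ / (2 * (1 + σ)))) := by positivity
      nlinarith [mul_le_mul_of_nonneg_left hgeo (mul_nonneg hC.le hl0)]
    · unfold cutKernel
      by_cases hp : (x, y) ∈ openBox α β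
      · rw [indicator_of_mem (by exact ⟨hp, (hA _ hp).trans_lt hJ⟩)]; rfl
      · have : χ (x, y) = 0 := by by_contra h; exact hp (hd.supp _ h)
        rw [indicator_of_notMem (fun h => hp h.1)]
        simp [oscKernel, this]
  have h1q : 0 ≤ (1 - q)⁻¹ := inv_nonneg.2 (by linarith)
  refine exists_isIntegralOperator measurableSet_Ioo (hd.bddKernel l) (fun x y h => ?_)
    (by positivity) hfull
  have : χ (x, y) ≠ 0 := fun h0 => h (by simp [oscKernel, h0])
  exact hd.supp _ this

end BoxData

/-! ### Near and far pairs of points on a level shell -/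

/-- If `|F| ≥ a` at both endpoints with the same sign and `|F''| ≤ C` with `C d² ≤ 4 a`, then
`|F| ≥ a / 2` on the whole interval. -/
lemma half_le_abs_of_endpoints {x x' a C : ℝ} {F F₁ F₂ : ℝ → ℝ}
    (hF : ∀ u ∈ Icc x x', HasDerivAt F (F₁ u) u) (hF₁ : ∀ u ∈ Icc x x', HasDerivAt F₁ (F₂ u) u)
    (hC : ∀ u ∈ Icc x x', |F₂ u| ≤ C) (hd : C * (x' - x) ^ 2 ≤ 4 * a) (hC0 : 0 ≤ C)
    (h : (a ≤ F x ∧ a ≤ F x') ∨ (F x ≤ -a ∧ F x' ≤ -a)) : ∀ u ∈ Icc x x', a / 2 ≤ |F u| := by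
  intro u hu
  -- By the parabola bound with constant -C, the value of F moves toward 0 by at most C d²/8, hence
  -- by at most a/2.
  have hq : (u - x) * (x' - u) ≤ (x' - x) ^ 2 / 4 := by nlinarith [sq_nonneg ((u - x) - (x' - u))]
  have hq2 : C / 2 * ((u - x) * (x' - u)) ≤ a / 2 := by
    have := mul_le_mul_of_nonneg_left hq (show 0 ≤ C / 2 by positivity)
    nlinarith
  rcases h with ⟨h, h'⟩ | ⟨h, h'⟩
  · have := le_sub_parabola (F := fun u => -F u) (F₁ := fun u => -F₁ u) (F₂ := fun u => -F₂ u)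
      (b := -a) (c := -C) (fun u hu => (hF u hu).neg) (fun u hu => (hF₁ u hu).neg)
      (fun u hu => neg_le_neg ((le_abs_self _).trans (hC u hu))) (neg_le_neg h) (neg_le_neg h') u hu
    refine le_trans ?_ (le_abs_self _)
    linarith
  · have := le_sub_parabola (F := F) (F₁ := F₁) (F₂ := F₂) (b := -a) (c := -C) hF hF₁
      (fun u hu => (abs_le.1 (hC u hu)).1) h h' u hu
    refine le_trans ?_ (neg_le_abs _)
    linarith

/-- If `|F| ≤ 2 a` at both endpoints and `|F''| ≥ c` with `48 a ≤ c d²`, then the integral of `F`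
over the interval is at least `c d³ / 24` in absolute value. -/
lemma cube_le_abs_sub {x x' a c : ℝ} (hxx : x ≤ x') {G F F₁ F₂ : ℝ → ℝ}
    (hG : ∀ u ∈ Icc x x', HasDerivAt G (F u) u) (hF : ∀ u ∈ Icc x x', HasDerivAt F (F₁ u) u)
    (hF₁ : ∀ u ∈ Icc x x', HasDerivAt F₁ (F₂ u) u) (hc : Away (Icc x x') F₂ c)
    (hd : 48 * a ≤ c * (x' - x) ^ 2) (h : |F x| ≤ 2 * a) (h' : |F x'| ≤ 2 * a) :
    c / 24 * (x' - x) ^ 3 ≤ |G x' - G x| := by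
  have hxx' : 0 ≤ x' - x := sub_nonneg.2 hxx
  -- The endpoint values contribute at most 2ad ≤ c d³/24, half of the trapezoidal gain c d³/12.
  have hd3 : 48 * a * (x' - x) ≤ c * (x' - x) ^ 3 := by
    have := mul_le_mul_of_nonneg_right hd hxx'
    nlinarith
  rcases hc with hc | hc
  · have := sub_le_trapezoid hxx hG hF hF₁ hc (abs_le.1 h).2 (abs_le.1 h').2
    refine le_trans ?_ (neg_le_abs _)
    linarith
  · have := sub_le_trapezoid (G := fun u => -G u) (F := fun u => -F u) (F₁ := fun u => -F₁ u)
      (F₂ := fun u => -F₂ u) (b := 2 * a) (c := c) hxx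
      (fun u hu => (hG u hu).neg) (fun u hu => (hF u hu).neg)
      (fun u hu => (hF₁ u hu).neg) (fun u hu => by linarith [hc u hu])
      (by linarith [(abs_le.1 h).1]) (by linarith [(abs_le.1 h').1])
    refine le_trans ?_ (le_abs_self _)
    linarith

/-- The points whose cell in a grid of mesh `h` has index congruent to `r` modulo `N`. -/
def gridClass (h : ℝ) (N r : ℕ) : Set ℝ := {x | ⌊x / h⌋ % (N : ℤ) = r}

lemma measurableSet_gridClass (h : ℝ) (N r : ℕ) : MeasurableSet (gridClass h N r) := by
  have : Measurable fun x : ℝ => ⌊x / h⌋ % (N : ℤ) :=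
    (measurable_from_top (f := fun k : ℤ => k % (N : ℤ))).comp
      (Int.measurable_floor.comp (measurable_id.div_const h))
  exact this (measurableSet_singleton _)

/-- Cell indices in one class are equal or differ by at least N; in the second case at least N - 1
full cells separate the points. -/
lemma abs_sub_gridClass {h : ℝ} (hh : 0 < h) {N r : ℕ} {x x' : ℝ} (hx : x ∈ gridClass h N r)
    (hx' : x' ∈ gridClass h N r) : |x - x'| ≤ h ∨ ((N : ℝ) - 1) * h ≤ |x - x'| := by
  have f1 := Int.floor_le (x / h)
  have f2 := Int.lt_floor_add_one (x / h)
  have f3 := Int.floor_le (x' / h)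
  have f4 := Int.lt_floor_add_one (x' / h)
  have hmod : ⌊x / h⌋ ≡ ⌊x' / h⌋ [ZMOD N] := Eq.trans hx (Eq.symm hx')
  set k := ⌊x / h⌋
  set k' := ⌊x' / h⌋
  have e : |x - x'| = |x / h - x' / h| * h := by
    rw [← sub_div, abs_div, abs_of_pos hh]; field_simp
  rw [e]
  by_cases hk : k = k'
  · left
    rw [hk] at f1 f2
    have : |x / h - x' / h| ≤ 1 := abs_le.2 ⟨by linarith, by linarith⟩
    nlinarith
  · right
    have hN : (N : ℤ) ≤ |k' - k| :=
      Int.le_of_dvd (abs_pos.2 (sub_ne_zero.2 (Ne.symm hk))) ((dvd_abs _ _).2 hmod.dvd)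
    have hN' : (N : ℝ) ≤ |(k' : ℝ) - k| := by exact_mod_cast hN
    refine mul_le_mul_of_nonneg_right ?_ hh.le
    rcases le_total (k : ℝ) k' with h1 | h1
    · rw [abs_of_nonneg (by linarith)] at hN'
      have := neg_le_abs (x / h - x' / h)
      linarith
    · rw [abs_of_nonpos (by linarith)] at hN'
      have := le_abs_self (x / h - x' / h)
      linarith

/-! ### The upper bounds on an open square -/

namespace BoxData

variable {α β : ℝ} {S : ℝ × ℝ → ℝ} {χ : ℝ × ℝ → ℂ}

/-- Splitting a dyadic region according to the sign of `F`. -/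
lemma opBound_of_signs (hd : BoxData α β S χ) {a l A : ℝ} (ha : 0 < a) (hA : 0 ≤ A)
    (h₁ : OpBound (volume.restrict (Ioo α β))
      (cutKernel S χ (openBox α β ∩ {p | p.1 ∈ univ ∧ mixedHessian univ S p ∈ Ico a (2 * a)}) l) A)
    (h₂ : OpBound (volume.restrict (Ioo α β))
      (cutKernel S χ
        (openBox α β ∩ {p | p.1 ∈ univ ∧ mixedHessian univ S p ∈ Ioc (-(2 * a)) (-a)}) l) A) :
    OpBound (volume.restrict (Ioo α β)) (cutKernel S χ (openBox α β ∩
      {p | a ≤ |mixedHessian univ S p| ∧ |mixedHessian univ S p| < 2 * a}) l) (2 * A) := by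
  -- The set a ≤ |t| < 2a is not an interval but its two halves are. One sign of F at both points is
  -- also what the mean value and convexity arguments need.
  have hdisj : Disjoint
      (openBox α β ∩ {p | p.1 ∈ univ ∧ mixedHessian univ S p ∈ Ico a (2 * a)})
      (openBox α β ∩ {p | p.1 ∈ univ ∧ mixedHessian univ S p ∈ Ioc (-(2 * a)) (-a)}) :=
    Set.disjoint_left.2 fun p hp hp' => by
      have h1 := hp.2.2.1
      have h2 := hp'.2.2.2
      linarith
  have e : openBox α β ∩ {p | a ≤ |mixedHessian univ S p| ∧ |mixedHessian univ S p| < 2 * a} =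
      (openBox α β ∩ {p | p.1 ∈ univ ∧ mixedHessian univ S p ∈ Ico a (2 * a)}) ∪
      (openBox α β ∩ {p | p.1 ∈ univ ∧ mixedHessian univ S p ∈ Ioc (-(2 * a)) (-a)}) := by
    rw [← inter_union_distrib_left]
    congr 1
    ext p
    simp only [mem_ofPred_eq, mem_union, mem_univ, true_and, mem_Ico, mem_Ioc, le_abs, abs_lt]
    constructor
    · rintro ⟨h | h, h1, h2⟩
      · exact Or.inl ⟨h, h2⟩
      · exact Or.inr ⟨h1, by linarith⟩
    · rintro (⟨h1, h2⟩ | ⟨h1, h2⟩)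
      · exact ⟨Or.inl h1, by linarith, h2⟩
      · exact ⟨Or.inr (by linarith), h1, by linarith⟩
  rw [e, two_mul A]
  exact (OpBound.add (hd.bddKernel_cut (hd.measurableSet_region MeasurableSet.univ
    measurableSet_Ico) l) (hd.bddKernel_cut (hd.measurableSet_region MeasurableSet.univ
    measurableSet_Ioc) l) hA hA h₁ h₂).congr fun x y => cutKernel_union hdisj l x y

/-- Splitting a region according to the residue classes of a grid in the `x`-variable. -/
lemma opBound_of_gridClass (hd : BoxData α β S χ) {l A h : ℝ} {T : Set ℝ} (hT : MeasurableSet T)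
    {N : ℕ} (hN : 0 < N) (hA : 0 ≤ A) (H : ∀ r : ℕ, OpBound (volume.restrict (Ioo α β))
      (cutKernel S χ
        (openBox α β ∩ {p | p.1 ∈ gridClass h N r ∧ mixedHessian univ S p ∈ T}) l) A) :
    OpBound (volume.restrict (Ioo α β))
      (cutKernel S χ (openBox α β ∩ {p | p.1 ∈ univ ∧ mixedHessian univ S p ∈ T}) l) (N * A) := by
  have := OpBound.finset_sum (μ := volume.restrict (Ioo α β)) (Finset.range N)
    (fun r => cutKernel S χ
      (openBox α β ∩ {p | p.1 ∈ gridClass h N r ∧ mixedHessian univ S p ∈ T}) l) (fun _ => A)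
    (fun r _ => hd.bddKernel_cut (hd.measurableSet_region (measurableSet_gridClass h N r) hT) l)
    (fun _ _ => hA) (fun r _ => H r)
  rw [Finset.sum_const, Finset.card_range, nsmul_eq_mul] at this
  refine this.congr fun x y => ?_
  have hN' : (N : ℤ) ≠ 0 := by exact_mod_cast hN.ne'
  have h0 : 0 ≤ ⌊x / h⌋ % (N : ℤ) := Int.emod_nonneg _ hN'
  have h1 : ⌊x / h⌋ % (N : ℤ) < N := Int.emod_lt_of_pos _ (by exact_mod_cast hN)
  obtain ⟨r, hr⟩ := Int.eq_ofNat_of_zero_le h0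
  have hrN : r < N := by exact_mod_cast hr ▸ h1
  rw [Finset.sum_eq_single r]
  · unfold cutKernel
    by_cases hp : (x, y) ∈ openBox α β ∩ {p | p.1 ∈ univ ∧ mixedHessian univ S p ∈ T}
    · have hp' : (x, y) ∈ openBox α β ∩
          {p | p.1 ∈ gridClass h N r ∧ mixedHessian univ S p ∈ T} := ⟨hp.1, hr, hp.2.2⟩
      rw [indicator_of_mem hp, indicator_of_mem hp']
    · have hp' : (x, y) ∉ openBox α β ∩
          {p | p.1 ∈ gridClass h N r ∧ mixedHessian univ S p ∈ T} :=
        fun h' => hp ⟨h'.1, mem_univ _, h'.2.2⟩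
      rw [indicator_of_notMem hp, indicator_of_notMem hp']
  · intro r' _ hne
    unfold cutKernel
    refine indicator_of_notMem (fun h' => hne ?_) _
    have h2 : ⌊x / h⌋ % (N : ℤ) = r' := h'.2.1
    have : (r' : ℤ) = r := h2.symm.trans hr
    exact_mod_cast this
  · intro h'; exact absurd (Finset.mem_range.2 hrN) h'

/-- No oscillation is used: by Schur's test the squared norm is at most a constant times the product
of the two section lengths. -/
lemma core_bound_of_sections (hd : BoxData α β S χ) {Cx Cy ρ τ : ℝ} (hCx : 0 < Cx) (hCy : 0 < Cy)
    (hy : ∀ x ∈ Ioo α β, ∀ a, 0 < a →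
      volume (Ioo α β ∩ {y | |mixedHessian univ S (x, y)| ≤ a}) ≤ ENNReal.ofReal (Cy * a ^ τ))
    (hx : ∀ y ∈ Ioo α β, ∀ a, 0 < a →
      volume (Ioo α β ∩ {x | |mixedHessian univ S (x, y)| ≤ a}) ≤ ENNReal.ofReal (Cx * a ^ ρ)) :
    ∃ C : ℝ, 0 < C ∧ ∀ l : ℝ, 0 < l → ∀ a : ℝ, 0 < a → OpBound (volume.restrict (Ioo α β))
      (cutKernel S χ (openBox α β ∩ {p | |mixedHessian univ S p| < a}) l)
      (Real.sqrt (C * (a ^ ρ * a ^ τ))) := by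
  obtain ⟨N, hN, h⟩ := hd.exists_opBound_schur
  refine ⟨N * (Cx * Cy), by positivity, fun l _ a ha => ?_⟩
  have hm : MeasurableSet (openBox α β ∩ {p | |mixedHessian univ S p| < a}) := by
    simpa using hd.measurableSet_region MeasurableSet.univ
      (show MeasurableSet {t : ℝ | |t| < a} from measurableSet_lt measurable_norm measurable_const)
  refine (h l _ (Cx * a ^ ρ) (Cy * a ^ τ) hm (by positivity) (by positivity)
    (fun x hxI => ?_) (fun y hyI => ?_)).mono (Real.sqrt_le_sqrt (le_of_eq (by ring)))
  · refine (measure_mono ?_).trans (hy x hxI a ha)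
    exact fun y hy' => ⟨hy'.1, (show |mixedHessian univ S (x, y)| < a from hy'.2.2).le⟩
  · refine (measure_mono ?_).trans (hx y hyI a ha)
    exact fun x hx' => ⟨hx'.1, (show |mixedHessian univ S (x, y)| < a from hx'.2.2).le⟩

/-- One nonvanishing first derivative: the exponent `(B + 1) / (2 (2 B + 1))` with `B = n + 1`. -/
theorem normDecay_of_first (hd : BoxData α β S χ) (n : ℕ) {c c' A : ℝ} (hc : 0 < c) (hc' : 0 < c')
    (hA : ∀ p ∈ openBox α β, |mixedHessian univ S p| ≤ A)
    (hFx : Away (openBox α β) (mixedPartial univ 1 0 (mixedHessian univ S)) c)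
    (hFy : Away (openBox α β) (mixedPartial univ 0 (n + 1) (mixedHessian univ S)) c') :
    NormDecay S χ ((((n + 1 : ℕ) : ℝ) + 1) / (2 * (2 * ((n + 1 : ℕ) : ℝ) + 1))) := by
  set τ : ℝ := (n + 1 : ℝ)⁻¹ with hτ
  have hτ0 : 0 < τ := by positivity
  have hτ1 : τ ≤ 1 := inv_le_one_of_one_le₀ (by linarith [(Nat.cast_nonneg n : (0 : ℝ) ≤ n)])
  obtain ⟨Cy, hCy, hvy⟩ := hd.exists_volume_sublevel_y n hc' hFy
  obtain ⟨Cx, hCx, hvx⟩ := hd.exists_volume_sublevel_x 0 hc hFx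
  have hvx' : ∀ y ∈ Ioo α β, ∀ a, 0 < a →
      volume (Ioo α β ∩ {x | |mixedHessian univ S (x, y)| ≤ a}) ≤
        ENNReal.ofReal (Cx * a ^ (1 : ℝ)) := by
    simpa using hvx
  obtain ⟨C₁, hC₁, hcore⟩ := hd.core_bound_of_sections hCx hCy hvy hvx'
  -- Here ρ = 1: F changes in x at rate at least c, so two points whose values lie in an interval of
  -- length a are within a/c. Only the near alternative occurs.
  obtain ⟨C₂, hC₂, hpiece⟩ := hd.exists_opBound_piece n hc' hFy 1 (C₀ := 1 / c) (κ := 1)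
    (by positivity) one_pos
  have hpow : ∀ a : ℝ, 0 < a → a ^ (1 : ℝ) * a ^ τ = a ^ (1 + τ) := fun a ha =>
    (Real.rpow_add ha 1 τ).symm
  -- separation and the lower bound for the derivative of the phase difference
  have hsep : ∀ (a : ℝ) (T : Set ℝ), 0 < a → OrdConnected T → (∀ s ∈ T, a ≤ |s|) →
      (∀ s ∈ T, ∀ t ∈ T, |s - t| ≤ a) → ∀ x ∈ Ioo α β, ∀ x' ∈ Ioo α β, ∀ y ∈ Ioo α β,
      mixedHessian univ S (x, y) ∈ T → mixedHessian univ S (x', y) ∈ T →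
      |x - x'| ≤ 1 / c * a ^ (1 : ℝ) ∧
        1 * a * |x - x'| ≤ |partialY univ S (x, y) - partialY univ S (x', y)| := by
    intro a T ha hT hTa hTd x hx x' hx' y hy h1 h2
    have hmono : MonotoneOn (fun t => mixedHessian univ S (t, y)) (Ioo α β) ∨
        AntitoneOn (fun t => mixedHessian univ S (t, y)) (Ioo α β) :=
      monotoneOn_or_antitoneOn ordConnected_Ioo (fun t ht => hd.derivChain_hessian_x hy 0 t ht)
        ((hFx.weaken hc.le).imp (fun h t ht => h (t, y) ⟨ht, hy⟩) fun h t ht => h (t, y) ⟨ht, hy⟩)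
    -- Monotonicity in x keeps F inside T between x and x', so the mean value point also satisfies
    -- |F| ≥ a.
    have hoc := ordConnected_inter_preimage ordConnected_Ioo hT hmono
    constructor
    · have hmv : c * |x - x'| ≤ |mixedHessian univ S (x, y) - mixedHessian univ S (x', y)| := by
        have key : ∀ u ∈ Ioo α β, ∀ v ∈ Ioo α β, u < v → c * |v - u| ≤
            |mixedHessian univ S (v, y) - mixedHessian univ S (u, y)| := by
          intro u hu v hv huv
          have hsub : Icc u v ⊆ Ioo α β := ordConnected_Ioo.out hu hv
          obtain ⟨ξ, hξ, e⟩ := exists_hasDerivAt_eq_slope _ _ huv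
            (fun t ht => (hd.derivChain_hessian_x hy 0 t
              (hsub ht)).continuousAt.continuousWithinAt)
            (fun t ht => hd.derivChain_hessian_x hy 0 t (hsub (Ioo_subset_Icc_self ht)))
          have h3 : c ≤ |mixedPartial univ 1 0 (mixedHessian univ S) (ξ, y)| :=
            hFx.le_abs ⟨hsub (Ioo_subset_Icc_self hξ), hy⟩
          have h4 : mixedHessian univ S (v, y) - mixedHessian univ S (u, y) =
              mixedPartial univ 1 0 (mixedHessian univ S) (ξ, y) * (v - u) := by
            have hne : v - u ≠ 0 := by linarith
            have e' : mixedPartial univ 1 0 (mixedHessian univ S) (ξ, y) =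
              (mixedHessian univ S (v, y) - mixedHessian univ S (u, y)) / (v - u) := e
            rw [e']; field_simp
          rw [h4, abs_mul]
          exact mul_le_mul_of_nonneg_right h3 (abs_nonneg _)
        rcases lt_trichotomy x x' with h | h | h
        · rw [abs_sub_comm, abs_sub_comm (mixedHessian univ S (x, y))]
          exact key x hx x' hx' h
        · subst h; simp
        · exact key x' hx' x hx h
      have := hmv.trans (hTd _ h1 _ h2)
      rw [Real.rpow_one, one_div, inv_mul_eq_div, le_div_iff₀ hc]
      linarith
    · obtain ⟨ξ, hξ, hξI, e⟩ := hd.exists_iterate_sub_eq hx hx' hy 0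
      have hξT : ξ ∈ Ioo α β ∩ (fun t => mixedHessian univ S (t, y)) ⁻¹' T :=
        hoc.uIcc_subset ⟨hx, h1⟩ ⟨hx', h2⟩ hξ
      have e' : partialY univ S (x, y) - partialY univ S (x', y) =
        (x - x') * mixedHessian univ S (ξ, y) := e
      rw [e', abs_mul, one_mul, mul_comm]
      exact mul_le_mul_of_nonneg_left (hTa _ hξT.2) (abs_nonneg _)
  have hmain := hd.normDecay_of_pieces (σ := 1 + τ) (C := max C₁ (2 * Real.sqrt C₂)) (A := A)
    (by positivity) (by linarith) (by positivity) hA (fun l hl a ha => ?_) (fun l hl a ha h1 => ?_)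
  · convert hmain using 1
    rw [hτ]
    push_cast
    have : (n + 1 : ℝ) ≠ 0 := by positivity
    field_simp
    ring
  · refine (hcore l hl a ha).mono (Real.sqrt_le_sqrt ?_)
    rw [hpow a ha]
    gcongr
    exact le_max_left _ _
  · have h1' : 1 ≤ l * a * (a ^ (1 : ℝ) * a ^ τ) := by rwa [hpow a ha]
    have key := hd.opBound_of_signs (l := l) ha (Real.sqrt_nonneg _)
      (hpiece l hl a ha h1' univ (Ico a (2 * a)) MeasurableSet.univ ordConnected_Ico
        (fun s hs => ⟨by linarith [hs.1], hs.2.le⟩)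
        fun x hx x' hx' y hy h2 h3 => Or.inl (hsep a _ ha ordConnected_Ico
          (fun s hs => hs.1.trans (le_abs_self _))
          (fun s hs t ht => abs_le.2 ⟨by linarith [hs.1, ht.2], by linarith [hs.2, ht.1]⟩)
          x hx.1 x' hx'.1 y hy h2 h3))
      (hpiece l hl a ha h1' univ (Ioc (-(2 * a)) (-a)) MeasurableSet.univ ordConnected_Ioc
        (fun s hs => ⟨hs.1.le, by linarith [hs.2]⟩)
        fun x hx x' hx' y hy h2 h3 => Or.inl (hsep a _ ha ordConnected_Ioc
          (fun s hs => (le_neg.2 hs.2).trans (neg_le_abs _))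
          (fun s hs t ht => abs_le.2 ⟨by linarith [hs.1, ht.2], by linarith [hs.2, ht.1]⟩)
          x hx.1 x' hx'.1 y hy h2 h3))
    refine key.mono ?_
    rw [hpow a ha, Real.sqrt_mul hC₂.le, ← mul_assoc]
    gcongr
    exact le_max_right _ _

/-- Two nonvanishing second derivatives: the exponent `1 / 4`. -/
theorem normDecay_of_second (hd : BoxData α β S χ) {c c' A C : ℝ} (hc : 0 < c) (hc' : 0 < c')
    (hA : ∀ p ∈ openBox α β, |mixedHessian univ S p| ≤ A)
    (hC : ∀ p ∈ openBox α β, |mixedPartial univ 2 0 (mixedHessian univ S) p| ≤ C)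
    (hFx : Away (openBox α β) (mixedPartial univ 2 0 (mixedHessian univ S)) c)
    (hFy : Away (openBox α β) (mixedPartial univ 0 2 (mixedHessian univ S)) c') :
    NormDecay S χ (1 / 4) := by
  have hC0 : 0 ≤ C := by
    obtain ⟨x, hx⟩ := nonempty_Ioo.2 hd.lt
    exact (abs_nonneg _).trans (hC (x, x) ⟨hx, hx⟩)
  obtain ⟨Cy, hCy, hvy⟩ := hd.exists_volume_sublevel_y 1 hc' hFy
  obtain ⟨Cx, hCx, hvx⟩ := hd.exists_volume_sublevel_x 1 hc hFx
  set τ : ℝ := (((1 : ℕ) : ℝ) + 1)⁻¹ with hτ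
  have hτ2 : τ = 1 / 2 := by rw [hτ]; norm_num
  obtain ⟨C₁, hC₁, hcore⟩ := hd.core_bound_of_sections hCx hCy hvy hvx
  -- Four constants: δ makes C(δ√a)² ≤ 4a for near pairs, E makes c(E√a)² ≥ 48a for far pairs, with
  -- E ≥ 2 so that far means beyond √a. N separates distinct cells of one class by E√a, and κ is the
  -- worse of the two resulting constants.
  set δ : ℝ := 1 / (1 + C) with hδ
  have hδ0 : 0 < δ := by positivity
  have hδC : C * δ ^ 2 ≤ 4 := by
    rw [hδ, div_pow, one_pow, mul_one_div, div_le_iff₀ (by positivity)]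
    nlinarith
  set E : ℝ := 2 + 48 / c with hE
  have hE0 : 2 ≤ E := by rw [hE]; linarith [show 0 ≤ 48 / c by positivity]
  have hEc : 48 ≤ c * E ^ 2 := by
    have h1 : 48 / c ≤ E := by rw [hE]; linarith
    rw [div_le_iff₀ hc] at h1
    nlinarith
  obtain ⟨N, hN⟩ := exists_nat_ge (E / δ + 1)
  have hN0 : 0 < N := by
    have : (0 : ℝ) < N := lt_of_lt_of_le (by positivity) hN
    exact_mod_cast this
  have hNE : E ≤ (N - 1) * δ := by
    have : E / δ ≤ N - 1 := by linarith
    rwa [div_le_iff₀ hδ0] at this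
  set κ : ℝ := min (1 / 2) (c / 24) with hκ
  have hκ0 : 0 < κ := lt_min (by norm_num) (by positivity)
  obtain ⟨C₂, hC₂, hpiece⟩ := hd.exists_opBound_piece 1 hc' hFy τ hδ0 hκ0
  have hpow : ∀ a : ℝ, 0 < a → a ^ τ * a ^ τ = a ^ (1 : ℝ) := fun a ha => by
    rw [← Real.rpow_add ha, hτ2]; norm_num
  have hsq : ∀ a : ℝ, a ^ τ = Real.sqrt a := fun a => by rw [Real.sqrt_eq_rpow, hτ2]
  have hsep : ∀ (a : ℝ) (T : Set ℝ), 0 < a → T ⊆ Icc (-(2 * a)) (2 * a) →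
      ((∀ s ∈ T, a ≤ s) ∨ (∀ s ∈ T, s ≤ -a)) → ∀ r : ℕ,
      ∀ x ∈ Ioo α β ∩ gridClass (δ * Real.sqrt a) N r,
      ∀ x' ∈ Ioo α β ∩ gridClass (δ * Real.sqrt a) N r, ∀ y ∈ Ioo α β,
      mixedHessian univ S (x, y) ∈ T → mixedHessian univ S (x', y) ∈ T →
      (|x - x'| ≤ δ * a ^ τ ∧
        κ * a * |x - x'| ≤ |partialY univ S (x, y) - partialY univ S (x', y)|) ∨
      (Real.sqrt a < |x - x'| ∧
        κ * |x - x'| ^ 3 ≤ |partialY univ S (x, y) - partialY univ S (x', y)|) := by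
    intro a T ha hT hTs r
    have hsa : 0 < Real.sqrt a := Real.sqrt_pos.2 ha
    have hsa2 : Real.sqrt a ^ 2 = a := Real.sq_sqrt ha.le
    have key : ∀ x ∈ Ioo α β ∩ gridClass (δ * Real.sqrt a) N r,
        ∀ x' ∈ Ioo α β ∩ gridClass (δ * Real.sqrt a) N r, x ≤ x' → ∀ y ∈ Ioo α β,
        mixedHessian univ S (x, y) ∈ T → mixedHessian univ S (x', y) ∈ T →
        (|x' - x| ≤ δ * a ^ τ ∧
          κ * a * |x' - x| ≤ |partialY univ S (x', y) - partialY univ S (x, y)|) ∨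
        (Real.sqrt a < |x' - x| ∧
          κ * |x' - x| ^ 3 ≤ |partialY univ S (x', y) - partialY univ S (x, y)|) := by
      intro x hx x' hx' hxx y hy h1 h2
      have hsub : Icc x x' ⊆ Ioo α β := ordConnected_Ioo.out hx.1 hx'.1
      have dG : ∀ u ∈ Icc x x', HasDerivAt (fun t => partialY univ S (t, y))
          (mixedHessian univ S (u, y)) u := fun u hu => hd.hasDerivAt_iterate_x (hsub hu) hy 0
      have dF : ∀ u ∈ Icc x x', HasDerivAt (fun t => mixedHessian univ S (t, y))
          (mixedPartial univ 1 0 (mixedHessian univ S) (u, y)) u :=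
        fun u hu => hd.derivChain_hessian_x hy 0 u (hsub hu)
      have dF₁ : ∀ u ∈ Icc x x', HasDerivAt
          (fun t => mixedPartial univ 1 0 (mixedHessian univ S) (t, y))
          (mixedPartial univ 2 0 (mixedHessian univ S) (u, y)) u :=
        fun u hu => hd.derivChain_hessian_x hy 1 u (hsub hu)
      have hxx0 : 0 ≤ x' - x := sub_nonneg.2 hxx
      -- Near pairs lie within δ√a, where F cannot fall below a/2. Far pairs are at least E√a apart,
      -- where the curvature outweighs the endpoint values.
      rcases abs_sub_gridClass (by positivity) hx'.2 hx.2 with hnear | hfar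
      · left
        refine ⟨by rwa [hsq], ?_⟩
        rw [abs_of_nonneg hxx0] at hnear
        have hd2 : C * (x' - x) ^ 2 ≤ 4 * a := by
          have h3 : (x' - x) ^ 2 ≤ (δ * Real.sqrt a) ^ 2 := pow_le_pow_left₀ hxx0 hnear 2
          rw [mul_pow, hsa2] at h3
          nlinarith [mul_le_mul_of_nonneg_left h3 hC0]
        have hhalf := half_le_abs_of_endpoints dF dF₁
          (fun u hu => hC (u, y) ⟨hsub hu, hy⟩) hd2 hC0
          (hTs.imp (fun h => ⟨h _ h1, h _ h2⟩) fun h => ⟨h _ h1, h _ h2⟩)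
        obtain ⟨ξ, hξ, hξI, e⟩ := hd.exists_iterate_sub_eq hx'.1 hx.1 hy 0
        rw [uIcc_of_ge hxx] at hξ
        have e' : partialY univ S (x', y) - partialY univ S (x, y) =
          (x' - x) * mixedHessian univ S (ξ, y) := e
        rw [e', abs_mul, mul_comm]
        refine mul_le_mul_of_nonneg_left ?_ (abs_nonneg _)
        refine le_trans ?_ (hhalf ξ hξ)
        have : κ ≤ 1 / 2 := min_le_left _ _
        nlinarith
      · right
        have hEd : E * Real.sqrt a ≤ |x' - x| := by
          refine le_trans ?_ hfar
          rw [← mul_assoc]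
          gcongr
        refine ⟨lt_of_lt_of_le (by nlinarith) hEd, ?_⟩
        rw [abs_of_nonneg hxx0] at hEd ⊢
        have h48 : 48 * a ≤ c * (x' - x) ^ 2 := by
          have h3 : (E * Real.sqrt a) ^ 2 ≤ (x' - x) ^ 2 :=
            pow_le_pow_left₀ (by positivity) hEd 2
          rw [mul_pow, hsa2] at h3
          nlinarith [mul_le_mul_of_nonneg_left h3 hc.le]
        have hcube := cube_le_abs_sub hxx dG dF dF₁
          ((hFx.imp (fun h u hu => h (u, y) ⟨hsub hu, hy⟩) fun h u hu => h (u, y) ⟨hsub hu, hy⟩) :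
            Away (Icc x x') (fun t => mixedPartial univ 2 0 (mixedHessian univ S) (t, y)) c)
          h48 (abs_le.2 (hT h1)) (abs_le.2 (hT h2))
        refine le_trans ?_ hcube
        gcongr
        exact min_le_right _ _
    intro x hx x' hx' y hy h1 h2
    rcases le_total x x' with h | h
    · rw [abs_sub_comm, abs_sub_comm (partialY univ S (x, y))]
      exact key x hx x' hx' h y hy h1 h2
    · exact key x' hx' x hx h y hy h2 h1
  have hmain := hd.normDecay_of_pieces (σ := 1) (C := max C₁ (2 * (N * Real.sqrt C₂))) (A := A)
    one_pos (by norm_num) (by positivity) hA (fun l hl a ha => ?_) (fun l hl a ha h1 => ?_)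
  · convert hmain using 1
    norm_num
  · refine (hcore l hl a ha).mono (Real.sqrt_le_sqrt ?_)
    rw [hpow a ha]
    gcongr
    exact le_max_left _ _
  · have h1' : 1 ≤ l * a * (a ^ τ * a ^ τ) := by rwa [hpow a ha]
    have key := hd.opBound_of_signs (l := l) ha (by positivity)
      (hd.opBound_of_gridClass (h := δ * Real.sqrt a) measurableSet_Ico hN0 (Real.sqrt_nonneg _)
        fun r => hpiece l hl a ha h1' _ (Ico a (2 * a)) (measurableSet_gridClass _ N r)
          ordConnected_Ico (fun s hs => ⟨by linarith [hs.1], hs.2.le⟩)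
          (hsep a _ ha (fun s hs => ⟨by linarith [hs.1], hs.2.le⟩) (Or.inl fun s hs => hs.1) r))
      (hd.opBound_of_gridClass (h := δ * Real.sqrt a) measurableSet_Ioc hN0 (Real.sqrt_nonneg _)
        fun r => hpiece l hl a ha h1' _ (Ioc (-(2 * a)) (-a)) (measurableSet_gridClass _ N r)
          ordConnected_Ioc (fun s hs => ⟨hs.1.le, by linarith [hs.2]⟩)
          (hsep a _ ha (fun s hs => ⟨hs.1.le, by linarith [hs.2]⟩) (Or.inr fun s hs => hs.2) r))
    refine key.mono ?_
    rw [hpow a ha, Real.sqrt_mul hC₂.le, ← mul_assoc, ← mul_assoc, mul_assoc (2 : ℝ)]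
    gcongr
    exact le_max_right _ _

/-- The nondegenerate case: the exponent `1 / 2`. -/
theorem normDecay_of_nondegenerate (hd : BoxData α β S χ) {c C : ℝ} (hc : 0 < c)
    (hF : Away (openBox α β) (mixedHessian univ S) c)
    (hF₁ : ∀ p ∈ openBox α β, |mixedPartial univ 0 1 (mixedHessian univ S) p| ≤ C)
    (hF₂ : ∀ p ∈ openBox α β, |mixedPartial univ 0 2 (mixedHessian univ S) p| ≤ C) :
    NormDecay S χ (1 / 2) := by
  obtain ⟨M, hM, hamp⟩ := hd.exists_amp_bound
  have hβα : 0 < β - α := sub_pos.2 hd.lt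
  have hC0 : 0 ≤ C := by
    obtain ⟨x, hx⟩ := nonempty_Ioo.2 hd.lt
    exact (abs_nonneg _).trans (hF₁ (x, x) ⟨hx, hx⟩)
  -- Adding the bound of order (l d)⁻² to the trivial one yields the majorant K/(1 + (l d)²), of
  -- integral Kπ/l. A single integration by parts would only give (l d)⁻¹, hence a logarithm.
  set K : ℝ := (4 + 6 * (β - α)) * M * (1 / c + C / c ^ 2 + 2 * C ^ 2 / c ^ 3) ^ 2 +
    M * (β - α) with hK
  have hK0 : 0 < K := by positivity
  refine ⟨Real.sqrt (K * Real.pi), fun l hl => ?_⟩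
  have hinv : Integrable fun t : ℝ => (1 + (l * t) ^ 2)⁻¹ :=
    integrable_inv_one_add_sq.comp_mul_left' hl.ne'
  have hW : Integrable fun t : ℝ => K * (1 + (l * t) ^ 2)⁻¹ := hinv.const_mul K
  have hWv : ∫ t : ℝ, K * (1 + (l * t) ^ 2)⁻¹ = K * Real.pi * l⁻¹ := by
    rw [integral_const_mul, Measure.integral_comp_mul_left (fun s : ℝ => (1 + s ^ 2)⁻¹) l,
      integral_univ_inv_one_add_sq, smul_eq_mul, abs_of_pos (by positivity)]
    ring
  have hL : ∀ x, ∀ x' ∈ Ioo α β, x' ≠ x → ‖ttStar (volume.restrict (Ioo α β))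
      (cutKernel S χ (openBox α β) l) x x'‖ ≤ K * (1 + (l * (x - x')) ^ 2)⁻¹ := by
    intro x x' hx' hne
    have hRm := (isOpen_openBox α β).measurableSet
    have e0 := ttStar_indicator (α := α) (β := β) (S := S) (χ := χ) l hRm x x'
    change ttStar (volume.restrict (Ioo α β)) (cutKernel S χ (openBox α β) l) x x' = _ at e0
    rw [e0]
    by_cases hx : x ∈ Ioo α β
    · have hYe : Ioo α β ∩ {y | (x, y) ∈ openBox α β ∧ (x', y) ∈ openBox α β} = Ioo α β := by
        ext y
        simp only [openBox, mem_inter_iff, mem_ofPred_eq, mem_prod]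
        tauto
      rw [hYe]
      obtain ⟨ψ₁, ψ₂, hψ, hψ₁, -, hψ₂c, bψ, bψ₁, bψ₂⟩ := hamp x x'
      -- Dividing the phase difference by d and using l d as parameter makes its y-derivatives
      -- absolute values of F and its y-derivatives, so the bounds are uniform in x and x'.
      set d := |x - x'| with hd'
      have hd0 : 0 < d := abs_pos.2 (sub_ne_zero.2 (Ne.symm hne))
      have hχ0 : ∀ y, y ∉ Ioo α β → χ (x, y) * (starRingEnd ℂ) (χ (x', y)) = 0 := fun y hy => by
        have : χ (x, y) = 0 := by by_contra h; exact hy (hd.supp _ h).2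
        rw [this, zero_mul]
      have b1 : ‖∫ y in Ioo α β, phaseDiff S χ l x x' y‖ ≤
          (4 + 6 * (β - α)) * M * (1 / c + C / c ^ 2 + 2 * C ^ 2 / c ^ 3) ^ 2 / (l * d) ^ 2 := by
        have hH : ∀ i, ∀ y ∈ Ioo α β, HasDerivAt
            (fun y => ((partialY univ)^[i] (partialY univ S) (x, y) -
              (partialY univ)^[i] (partialY univ S) (x', y)) / d)
            (((partialY univ)^[i + 1] (partialY univ S) (x, y) -
              (partialY univ)^[i + 1] (partialY univ S) (x', y)) / d) y := fun i y hy =>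
          ((hd.derivChain_partialY hx i y hy).sub (hd.derivChain_partialY hx' i y hy)).div_const d
        have hval : ∀ i, ∀ y ∈ Ioo α β, ∃ ξ ∈ Ioo α β,
            |((partialY univ)^[i] (partialY univ S) (x, y) -
              (partialY univ)^[i] (partialY univ S) (x', y)) / d| =
              |mixedPartial univ 0 i (mixedHessian univ S) (ξ, y)| := fun i y hy => by
          obtain ⟨ξ, -, hξ, e⟩ := hd.exists_iterate_sub_eq hx hx' hy i
          refine ⟨ξ, hξ, ?_⟩
          rw [e, abs_div, abs_mul, abs_of_pos hd0, ← hd']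
          field_simp
        have := norm_setIntegral_exp_le_sq hd.lt
          (φ := fun y => (S (x, y) - S (x', y)) / d) (fun y hy => ?_) (hH 0) (hH 1)
          (fun y hy => (hH 2 y hy).continuousAt.continuousWithinAt) hc (fun y hy => ?_)
          (fun y hy => ?_) (fun y hy => ?_) hψ hψ₁ hψ₂c (hχ0 α (by simp)) (hχ0 β (by simp))
          bψ bψ₁ bψ₂ (C := C) (l := l * d) (by positivity)
        · convert this using 4 with y
          rw [phaseDiff]
          congr 2
          have hdc : (d : ℂ) ≠ 0 := by exact_mod_cast hd0.ne'
          push_cast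
          field_simp
        · exact ((hasDerivAt_partialY (isOpen_openBox α β) hd.smooth ⟨hx, hy⟩).sub
            (hasDerivAt_partialY (isOpen_openBox α β) hd.smooth ⟨hx', hy⟩)).div_const d
        · obtain ⟨ξ, hξ, e⟩ := hval 0 y hy
          rw [e]
          exact hF.le_abs (show (ξ, y) ∈ openBox α β from ⟨hξ, hy⟩)
        · obtain ⟨ξ, hξ, e⟩ := hval 1 y hy
          rw [e]; exact hF₁ (ξ, y) ⟨hξ, hy⟩
        · obtain ⟨ξ, hξ, e⟩ := hval 2 y hy
          rw [e]; exact hF₂ (ξ, y) ⟨hξ, hy⟩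
      have b2 : ‖∫ y in Ioo α β, phaseDiff S χ l x x' y‖ ≤ M * (β - α) := by
        refine (norm_setIntegral_le_of_norm_le_const (C := M) (by simp) fun y _ => ?_).trans ?_
        · rw [phaseDiff, norm_mul, norm_exp_phase, one_mul]; exact bψ y
        · rw [Real.volume_real_Ioo_of_le hd.lt.le]
      rw [← div_eq_mul_inv, le_div_iff₀ (by positivity), ← sq_abs (l * (x - x')), abs_mul,
        abs_of_pos hl, ← hd']
      rw [le_div_iff₀ (by positivity)] at b1
      rw [hK]
      linarith
    · have hYe : Ioo α β ∩ {y | (x, y) ∈ openBox α β ∧ (x', y) ∈ openBox α β} = ∅ := by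
        ext y
        simp only [openBox, mem_inter_iff, mem_ofPred_eq, mem_prod, mem_empty_iff_false, iff_false]
        tauto
      rw [hYe]
      simp only [setIntegral_empty, norm_zero]
      positivity
  have hfin := opBound_of_ttStar (μ := volume.restrict (Ioo α β))
    (hd.bddKernel_cut (isOpen_openBox α β).measurableSet l)
    (fun x => setIntegral_norm_le_of_majorant (W := fun t => K * (1 + (l * t) ^ 2)⁻¹)
      measurableSet_Ioo hW (fun t => by positivity) (hL x))
  have hfull : OpBound (volume.restrict (Ioo α β)) (fun x y => oscKernel S χ l (x, y))
      (Real.sqrt (K * Real.pi) * l ^ (-(1 / 2 : ℝ))) := by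
    refine (hfin.mono (le_of_eq ?_)).congr fun x y => ?_
    · rw [hWv, Real.sqrt_mul (by positivity), Real.sqrt_inv, Real.rpow_neg hl.le,
        Real.sqrt_eq_rpow l]
    · unfold cutKernel
      by_cases hp : (x, y) ∈ openBox α β
      · rw [indicator_of_mem hp]; rfl
      · have : χ (x, y) = 0 := by by_contra h; exact hp (hd.supp _ h)
        rw [indicator_of_notMem hp]
        simp [oscKernel, this]
  refine exists_isIntegralOperator measurableSet_Ioo (hd.bddKernel l) (fun x y h => ?_)
    (by positivity) hfull
  have : χ (x, y) ≠ 0 := fun h0 => h (by simp [oscKernel, h0])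
  exact hd.supp _ this

end BoxData

/-! ### Transfer to the closed unit square -/

section UnitSquare

variable {S : ℝ × ℝ → ℝ} {χ : ℝ × ℝ → ℂ}

lemma isCompact_unitSquare : IsCompact unitSquare := isCompact_Icc.prod isCompact_Icc

lemma openBox_subset_unitSquare : openBox 0 1 ⊆ unitSquare :=
  prod_mono Ioo_subset_Icc_self Ioo_subset_Icc_self

/-- The set where χ ≠ 0 is open and contained in Q, hence in its interior, even if the closed
support touches the boundary. -/
lemma boxData_unitSquare (hS : ContDiffOn ℝ ∞ S unitSquare) (hχ : ContDiff ℝ ∞ χ)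
    (hs : tsupport χ ⊆ unitSquare) : BoxData 0 1 S χ where
  lt := zero_lt_one
  smooth := hS.mono openBox_subset_unitSquare
  amp := hχ
  cpt := isCompact_unitSquare.of_isClosed_subset (isClosed_tsupport χ) hs
  supp := by
    have ho : IsOpen (Function.support χ) := isOpen_ne_fun hχ.continuous continuous_const
    have h := interior_maximal ((subset_tsupport χ).trans hs) ho
    rw [unitSquare, interior_prod_eq, interior_Icc] at h
    exact fun p hp => h hp

/-- The Hessian is by definition a mixed partial of order (1,1), so the comparison of one-sided and
ordinary derivatives is applied twice. -/
lemma eqOn_mixedPartial_hessian_unitSquare (a b : ℕ) :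
    EqOn (mixedPartial (Icc 0 1) a b (mixedHessian (Icc 0 1) S))
      (mixedPartial univ a b (mixedHessian univ S)) (openBox 0 1) := by
  have hJ : ∀ p ∈ openBox 0 1, Icc (0 : ℝ) 1 ∈ 𝓝 p.1 ∧ Icc (0 : ℝ) 1 ∈ 𝓝 p.2 := fun p hp =>
    ⟨Icc_mem_nhds hp.1.1 hp.1.2, Icc_mem_nhds hp.2.1 hp.2.2⟩
  exact eqOn_mixedPartial (isOpen_openBox 0 1) hJ
    (eqOn_mixedPartial (isOpen_openBox 0 1) hJ (fun _ _ => rfl) 1 1) a b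

lemma exists_away_openBox (hS : ContDiffOn ℝ ∞ S unitSquare) (a b : ℕ)
    (h : ∀ p ∈ unitSquare, mixedPartial (Icc 0 1) a b (mixedHessian (Icc 0 1) S) p ≠ 0) :
    ∃ c > 0, Away (openBox 0 1) (mixedPartial univ a b (mixedHessian univ S)) c := by
  have hc := (contDiffOn_mixedPartial_unitSquare
    (contDiffOn_mixedPartial_unitSquare hS 1 1) a b).continuousOn
  obtain ⟨c, hc0, hA⟩ := exists_away isCompact_unitSquare
    (isPreconnected_Icc.prod isPreconnected_Icc) ⟨(0, 0), by simp [unitSquare]⟩ hc h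
  have e := eqOn_mixedPartial_hessian_unitSquare (S := S) a b
  exact ⟨c, hc0, hA.imp
    (fun h p hp => by rw [← e hp]; exact h p (openBox_subset_unitSquare hp))
    (fun h p hp => by rw [← e hp]; exact h p (openBox_subset_unitSquare hp))⟩

lemma exists_bound_openBox (hS : ContDiffOn ℝ ∞ S unitSquare) (a b : ℕ) :
    ∃ C > 0, ∀ p ∈ openBox 0 1, |mixedPartial univ a b (mixedHessian univ S) p| ≤ C := by
  have hc := (contDiffOn_mixedPartial_unitSquare
    (contDiffOn_mixedPartial_unitSquare hS 1 1) a b).continuousOn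
  obtain ⟨C, hC0, hC⟩ := exists_abs_le isCompact_unitSquare hc
  refine ⟨C, hC0, fun p hp => ?_⟩
  rw [← eqOn_mixedPartial_hessian_unitSquare a b hp]
  exact hC p (openBox_subset_unitSquare hp)

theorem normDecay_unitSquare_first (hS : ContDiffOn ℝ ∞ S unitSquare) (hχ : ContDiff ℝ ∞ χ)
    (hs : tsupport χ ⊆ unitSquare) (B : ℕ)
    (h : ∀ p ∈ unitSquare, mixedPartial (Icc 0 1) 1 0 (mixedHessian (Icc 0 1) S) p ≠ 0 ∧
      mixedPartial (Icc 0 1) 0 B (mixedHessian (Icc 0 1) S) p ≠ 0) :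
    NormDecay S χ (((B : ℝ) + 1) / (2 * (2 * (B : ℝ) + 1))) := by
  have hd := boxData_unitSquare hS hχ hs
  obtain ⟨c, hc, hFx⟩ := exists_away_openBox hS 1 0 fun p hp => (h p hp).1
  obtain ⟨c', hc', hFy⟩ := exists_away_openBox hS 0 B fun p hp => (h p hp).2
  -- For B = 0 the condition is F ≠ 0 and the exponent is 1/2; the shell argument, whose section
  -- exponent is 1/B, handles B = n + 1.
  rcases B with _ | n
  · obtain ⟨C₁, hC₁, h₁⟩ := exists_bound_openBox hS 0 1
    obtain ⟨C₂, hC₂, h₂⟩ := exists_bound_openBox hS 0 2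
    have := hd.normDecay_of_nondegenerate hc' hFy (C := max C₁ C₂)
      (fun p hp => (h₁ p hp).trans (le_max_left _ _))
      (fun p hp => (h₂ p hp).trans (le_max_right _ _))
    simpa using this
  · obtain ⟨A, hA, hFA⟩ := exists_bound_openBox hS 0 0
    exact hd.normDecay_of_first n hc hc' hFA hFx hFy

theorem normDecay_unitSquare_second (hS : ContDiffOn ℝ ∞ S unitSquare) (hχ : ContDiff ℝ ∞ χ)
    (hs : tsupport χ ⊆ unitSquare)
    (h : ∀ p ∈ unitSquare, mixedPartial (Icc 0 1) 2 0 (mixedHessian (Icc 0 1) S) p ≠ 0 ∧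
      mixedPartial (Icc 0 1) 0 2 (mixedHessian (Icc 0 1) S) p ≠ 0) :
    NormDecay S χ (1 / 4) := by
  have hd := boxData_unitSquare hS hχ hs
  obtain ⟨c, hc, hFx⟩ := exists_away_openBox hS 2 0 fun p hp => (h p hp).1
  obtain ⟨c', hc', hFy⟩ := exists_away_openBox hS 0 2 fun p hp => (h p hp).2
  obtain ⟨A, hA, hFA⟩ := exists_bound_openBox hS 0 0
  obtain ⟨C, hC, hFC⟩ := exists_bound_openBox hS 2 0
  exact hd.normDecay_of_second hc hc' hFA hFC hFx hFy

end UnitSquare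

/-! ### The 2-jet of an exceptionally degenerate Hessian -/

section Degenerate

lemma PowerSeries.coeff_two_mul' {R : Type*} [CommRing R] (a b : R⟦X⟧) :
    PowerSeries.coeff 2 (a * b) = PowerSeries.coeff 0 a * PowerSeries.coeff 2 b +
      PowerSeries.coeff 1 a * PowerSeries.coeff 1 b +
      PowerSeries.coeff 2 a * PowerSeries.coeff 0 b := by
  rw [PowerSeries.coeff_mul,
    Finset.Nat.sum_antidiagonal_eq_sum_range_succ
      (fun i j => PowerSeries.coeff i a * PowerSeries.coeff j b)]
  simp [Finset.sum_range_succ]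

lemma PowerSeries.coeff_one_mul' {R : Type*} [CommRing R] (a b : R⟦X⟧) :
    PowerSeries.coeff 1 (a * b) = PowerSeries.coeff 0 a * PowerSeries.coeff 1 b +
      PowerSeries.coeff 1 a * PowerSeries.coeff 0 b := by
  rw [PowerSeries.coeff_mul,
    Finset.Nat.sum_antidiagonal_eq_sum_range_succ
      (fun i j => PowerSeries.coeff i a * PowerSeries.coeff j b)]
  simp [Finset.sum_range_succ]

lemma PowerSeries.coeff_zero_mul' {R : Type*} [CommRing R] (a b : R⟦X⟧) :
    PowerSeries.coeff 0 (a * b) = PowerSeries.coeff 0 a * PowerSeries.coeff 0 b := by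
  rw [PowerSeries.coeff_mul]; simp

/-- The Taylor coefficients of order at most two of an exceptionally degenerate function. -/
lemma ExceptionallyDegenerate.partials {G : ℝ × ℝ → ℝ} (h : ExceptionallyDegenerate G 2) :
    G (0, 0) = 0 ∧ partialX univ G (0, 0) = 0 ∧ partialY univ G (0, 0) = 0 ∧
      mixedPartial univ 2 0 G (0, 0) ≠ 0 ∧ mixedPartial univ 0 2 G (0, 0) ≠ 0 := by
  obtain ⟨-, U, f, hU, hf0, hf1, e⟩ := h
  have hu : PowerSeries.coeff 0 (PowerSeries.coeff 0 U) ≠ 0 := by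
    have h1 : IsUnit (PowerSeries.constantCoeff U) := hU.map _
    have h2 : IsUnit (PowerSeries.constantCoeff (PowerSeries.constantCoeff U)) := h1.map _
    simpa using h2.ne_zero
  -- As a series in y, L has coefficients -f, 1, 0, and f starts at cx. So through order two U L² is
  -- u(y - cx)², with u the constant term of U, and the pure second coefficients are uc² and u.
  set L : ℝ⟦X⟧⟦X⟧ := PowerSeries.X - PowerSeries.C f with hL
  have L0 : PowerSeries.coeff 0 L = -f := by
    rw [hL, map_sub, PowerSeries.coeff_C]; simp [PowerSeries.coeff_X]
  have L1 : PowerSeries.coeff 1 L = 1 := by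
    rw [hL, map_sub, PowerSeries.coeff_C]; simp [PowerSeries.coeff_X]
  have L2 : PowerSeries.coeff 2 L = 0 := by
    rw [hL, map_sub, PowerSeries.coeff_C]; simp [PowerSeries.coeff_X]
  have hcoeff : ∀ p q : ℕ, mixedPartial univ p q G (0, 0) /
      ((Nat.factorial p : ℝ) * (Nat.factorial q : ℝ)) =
        PowerSeries.coeff p (PowerSeries.coeff q (U * L ^ 2)) := fun p q => by
    rw [← e, formalTaylor, PowerSeries.coeff_mk, PowerSeries.coeff_mk]
  have e00 := hcoeff 0 0
  have e10 := hcoeff 1 0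
  have e01 := hcoeff 0 1
  have e20 := hcoeff 2 0
  have e02 := hcoeff 0 2
  simp only [pow_two, PowerSeries.coeff_zero_mul', PowerSeries.coeff_one_mul',
    PowerSeries.coeff_two_mul', L0, L1, L2, map_add, map_neg, hf0, mul_zero, zero_mul, neg_zero,
    add_zero, zero_add, mul_one, Nat.factorial, Nat.cast_one, div_one] at e00 e10 e01 e20 e02
  refine ⟨?_, ?_, ?_, ?_, ?_⟩
  · simpa [mixedPartial] using e00
  · simpa [mixedPartial] using e10
  · simpa [mixedPartial] using e01
  · intro h0
    rw [h0] at e20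
    simp [hf1] at e20
    exact hu (by simpa using e20)
  · intro h0
    rw [h0] at e02
    simp at e02
    exact hu (by simpa using e02.symm)

end Degenerate

/-! ### Uniform bounds near the origin -/

section Quadratic

variable {S : ℝ × ℝ → ℝ} {W : Set (ℝ × ℝ)}

/-- In the sup metric this ball is a closed square, compact and convex, so bounds valid on it pass
to the open box. -/
lemma openBox_subset_closedBall (r : ℝ) : openBox (-r) r ⊆ Metric.closedBall (0, 0) r := by
  intro p hp
  rw [← Prod.mk.eta (p := p), ← closedBall_prod_same]
  simp only [mem_prod, Metric.mem_closedBall, Real.dist_eq, sub_zero, abs_le]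
  exact ⟨⟨hp.1.1.le, hp.1.2.le⟩, ⟨hp.2.1.le, hp.2.2.le⟩⟩

/-- Near the origin, a phase whose Hessian `F` has `F_{xx}, F_{yy} ≠ 0` at the origin satisfies
the hypotheses of the second bound. -/
lemma exists_openBox_nondegenerate (hW : IsOpen W) (h0 : ((0, 0) : ℝ × ℝ) ∈ W)
    (hS : ContDiffOn ℝ ∞ S W)
    (hx : mixedPartial univ 2 0 (mixedHessian univ S) (0, 0) ≠ 0)
    (hy : mixedPartial univ 0 2 (mixedHessian univ S) (0, 0) ≠ 0) :
    ∃ r > 0, openBox (-r) r ⊆ W ∧ ∃ c > 0, ∃ c' > 0, ∃ A C : ℝ,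
      (∀ p ∈ openBox (-r) r, |mixedHessian univ S p| ≤ A) ∧
      (∀ p ∈ openBox (-r) r, |mixedPartial univ 2 0 (mixedHessian univ S) p| ≤ C) ∧
      Away (openBox (-r) r) (mixedPartial univ 2 0 (mixedHessian univ S)) c ∧
      Away (openBox (-r) r) (mixedPartial univ 0 2 (mixedHessian univ S)) c' := by
  have hF := contDiffOn_mixedHessian hW hS
  have hFx := (contDiffOn_mixedPartial hW hF 2 0).continuousOn
  have hFy := (contDiffOn_mixedPartial hW hF 0 2).continuousOn
  have n1 := (hFx.continuousAt (hW.mem_nhds h0)).eventually_ne hx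
  have n2 := (hFy.continuousAt (hW.mem_nhds h0)).eventually_ne hy
  obtain ⟨r, hr, hsub⟩ := Metric.nhds_basis_closedBall.mem_iff.1
    (inter_mem (hW.mem_nhds h0) (inter_mem n1 n2))
  have hb := openBox_subset_closedBall r
  have hK : IsCompact (Metric.closedBall ((0, 0) : ℝ × ℝ) r) := isCompact_closedBall _ _
  have hP : IsPreconnected (Metric.closedBall ((0, 0) : ℝ × ℝ) r) :=
    (convex_closedBall _ _).isPreconnected
  have hN : (Metric.closedBall ((0, 0) : ℝ × ℝ) r).Nonempty := ⟨_, Metric.mem_closedBall_self hr.le⟩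
  have hKW : Metric.closedBall ((0, 0) : ℝ × ℝ) r ⊆ W := fun p hp => (hsub hp).1
  obtain ⟨c, hc, hA⟩ := exists_away hK hP hN (hFx.mono hKW) fun p hp => (hsub hp).2.1
  obtain ⟨c', hc', hA'⟩ := exists_away hK hP hN (hFy.mono hKW) fun p hp => (hsub hp).2.2
  obtain ⟨A, -, h1⟩ := exists_abs_le hK (hF.continuousOn.mono hKW)
  obtain ⟨C, -, h2⟩ := exists_abs_le hK (hFx.mono hKW)
  exact ⟨r, hr, hb.trans hKW, c, hc, c', hc', A, C, fun p hp => h1 p (hb hp),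
    fun p hp => h2 p (hb hp), hA.imp (fun h p hp => h p (hb hp)) (fun h p hp => h p (hb hp)),
    hA'.imp (fun h p hp => h p (hb hp)) (fun h p hp => h p (hb hp))⟩

/-- A function which vanishes to second order at the origin is quadratically small there. -/
lemma exists_quadratic_bound {G : ℝ × ℝ → ℝ} (hW : IsOpen W) (h0 : ((0, 0) : ℝ × ℝ) ∈ W)
    (hG : ContDiffOn ℝ ∞ G W) (hG0 : G (0, 0) = 0) (hx : partialX univ G (0, 0) = 0)
    (hy : partialY univ G (0, 0) = 0) :
    ∃ C : ℝ, 0 ≤ C ∧ ∃ s > 0, ∀ t ≤ s, ∀ x y : ℝ, |x| ≤ t → |y| ≤ t → |G (x, y)| ≤ C * t ^ 2 := by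
  -- The derivative vanishes at the origin and is Lipschitz near it, so it is O(t) on the ball of
  -- radius t. The mean value inequality then gains the second factor t.
  have hd : fderiv ℝ G (0, 0) = 0 := by
    rw [partialX_univ_eq_fderiv hW hG h0] at hx
    rw [partialY_univ_eq_fderiv hW hG h0] at hy
    ext
    · simpa using hx
    · simpa using hy
  have hc : ContDiffAt ℝ 1 (fderiv ℝ G) (0, 0) :=
    (hG.fderiv_of_isOpen hW (m := 1) (by norm_cast)).contDiffAt (hW.mem_nhds h0)
  obtain ⟨K, U, hU, hL⟩ := hc.exists_lipschitzOnWith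
  obtain ⟨s, hs, hsub⟩ := Metric.nhds_basis_closedBall.mem_iff.1 (inter_mem (hW.mem_nhds h0) hU)
  refine ⟨K, K.2, s, hs, fun t hts x y hx hy => ?_⟩
  have ht : 0 ≤ t := (abs_nonneg x).trans hx
  have hB : Metric.closedBall ((0, 0) : ℝ × ℝ) t ⊆ W ∩ U :=
    (Metric.closedBall_subset_closedBall hts).trans hsub
  have hm0 : ((0, 0) : ℝ × ℝ) ∈ Metric.closedBall ((0, 0) : ℝ × ℝ) t :=
    Metric.mem_closedBall_self ht
  have hm : (x, y) ∈ Metric.closedBall ((0, 0) : ℝ × ℝ) t := by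
    rw [← closedBall_prod_same]
    simpa [Real.dist_eq] using ⟨hx, hy⟩
  have hbd : ∀ p ∈ Metric.closedBall ((0, 0) : ℝ × ℝ) t, ‖fderiv ℝ G p‖ ≤ K * t := by
    intro p hp
    have h := hL.dist_le_mul p (hB hp).2 _ (hB hm0).2
    rw [dist_eq_norm, hd, sub_zero] at h
    exact h.trans (mul_le_mul_of_nonneg_left hp K.2)
  have h := (convex_closedBall ((0, 0) : ℝ × ℝ) t).norm_image_sub_le_of_norm_fderiv_le
    (fun p hp => (hG.hasFDerivAt_of_isOpen hW (hB hp).1).differentiableAt) hbd hm0 hm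
  rw [hG0, sub_zero, Real.norm_eq_abs, ← dist_eq_norm] at h
  calc |G (x, y)| ≤ K * t * dist (x, y) (0, 0) := h
    _ ≤ K * t * t := mul_le_mul_of_nonneg_left hm (mul_nonneg K.2 ht)
    _ = K * t ^ 2 := by ring

end Quadratic

/-! ### Sharpness of the exponent 1/4 -/

section LowerBound

variable {α β : ℝ} {S : ℝ × ℝ → ℝ} {χ : ℝ × ℝ → ℂ}

/-- The double difference is the integral of F over the rectangle with opposite corners (0,0) and
(x,y); it is estimated by a mean value bound in each variable. -/
lemma BoxData.abs_mixed_difference_le (hd : BoxData α β S χ) {t B : ℝ} (ht : 0 ≤ t)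
    (hI : Icc (-t) t ⊆ Ioo α β)
    (hF : ∀ x y : ℝ, |x| ≤ t → |y| ≤ t → |mixedHessian univ S (x, y)| ≤ B)
    {x y : ℝ} (hx : x ∈ Icc (-t) t) (hy : y ∈ Icc (-t) t) :
    |S (x, y) - S (0, y) - (S (x, 0) - S (0, 0))| ≤ B * t ^ 2 := by
  have h0 : (0 : ℝ) ∈ Icc (-t) t := ⟨by linarith, ht⟩
  have hB : 0 ≤ B := (abs_nonneg _).trans (hF 0 0 (by simpa using ht) (by simpa using ht))
  have key := (convex_Icc (-t) t).norm_image_sub_le_of_norm_hasDerivWithin_le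
    (f := fun u => S (x, u) - S (0, u))
    (f' := fun u => partialY univ S (x, u) - partialY univ S (0, u)) (C := t * B)
    (fun u hu => ((hasDerivAt_partialY (isOpen_openBox α β) hd.smooth ⟨hI hx, hI hu⟩).sub
      (hasDerivAt_partialY (isOpen_openBox α β) hd.smooth ⟨hI h0, hI hu⟩)).hasDerivWithinAt)
    (fun u hu => by
      obtain ⟨ξ, hξ, -, e⟩ := hd.exists_iterate_sub_eq (hI hx) (hI h0) (hI hu) 0
      simp only [Function.iterate_zero, id, sub_zero, mixedPartial] at e
      rw [e, norm_mul]
      have hξ' : ξ ∈ Icc (-t) t := (ordConnected_Icc.uIcc_subset hx h0) hξ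
      exact mul_le_mul (abs_le.2 hx) (hF ξ u (abs_le.2 hξ') (abs_le.2 hu)) (abs_nonneg _) ht)
    h0 hy
  simp only [sub_zero, Real.norm_eq_abs] at key
  calc _ ≤ t * B * |y| := key
    _ ≤ t * B * t := mul_le_mul_of_nonneg_left (abs_le.2 hy) (mul_nonneg ht hB)
    _ = B * t ^ 2 := by ring

/-- Testing against the wave packet `e^{-iλS(0,y)}` on `[-t,t]`. -/
lemma BoxData.le_norm_of_small_phase (hd : BoxData α β S χ) {t l : ℝ} (ht : 0 < t)
    (hI : Icc (-t) t ⊆ Ioo α β)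
    (hΦ : ∀ x ∈ Icc (-t) t, ∀ y ∈ Icc (-t) t,
      |l * (S (x, y) - S (0, y) - (S (x, 0) - S (0, 0)))| ≤ 1 / 4)
    (hχ : ∀ x ∈ Icc (-t) t, ∀ y ∈ Icc (-t) t, ‖χ (x, y) - χ (0, 0)‖ ≤ ‖χ (0, 0)‖ / 4)
    (hχ0 : χ (0, 0) ≠ 0)
    {T : Lp ℂ 2 (volume : Measure ℝ) →L[ℂ] Lp ℂ 2 (volume : Measure ℝ)}
    (hT : IsIntegralOperator (oscKernel S χ l) T) : t * ‖χ (0, 0)‖ / 2 ≤ ‖T‖ := by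
  have h0 : (0 : ℝ) ∈ Icc (-t) t := ⟨by linarith, ht.le⟩
  set I := Icc (-t) t with hIdef
  have hIm : MeasurableSet I := measurableSet_Icc
  have hIv : volume I ≠ ⊤ := by simp [hIdef]
  have hIr : volume.real I = 2 * t := by
    rw [hIdef, Real.volume_real_Icc_of_le (by linarith)]; ring
  set w : ℝ → ℂ := fun y => Complex.exp (-(Complex.I * (l : ℂ) * (S (0, y) : ℂ))) with hw
  have hwn : ∀ y, ‖w y‖ = 1 := fun y => by
    have : w y = Complex.exp (((-(l * S (0, y)) : ℝ) : ℂ) * Complex.I) := by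
      simp only [hw]; congr 1; push_cast; ring
    rw [this, Complex.norm_exp_ofReal_mul_I]
  have hwc : ContinuousOn w I := by
    have : ContinuousOn (fun y : ℝ => S (0, y)) I :=
      hd.smooth.continuousOn.comp (by fun_prop) fun y hy => ⟨hI h0, hI hy⟩
    have h2 : ContinuousOn (fun y : ℝ => (S (0, y) : ℂ)) I :=
      Complex.continuous_ofReal.comp_continuousOn this
    exact Complex.continuous_exp.comp_continuousOn ((continuousOn_const.mul h2).neg)
  have hg : MemLp (I.indicator w) 2 (volume : Measure ℝ) := by
    rw [memLp_indicator_iff_restrict hIm]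
    have : IsFiniteMeasure (volume.restrict I) := ⟨by simpa using hIv.lt_top⟩
    exact MemLp.of_bound (hwc.aestronglyMeasurable hIm) 1
      (Eventually.of_forall fun y => (hwn y).le)
  set f := hg.toLp _ with hf
  set e : Lp ℂ 2 (volume : Measure ℝ) := indicatorConstLp 2 hIm hIv (1 : ℂ) with he
  have hfe : (f : ℝ → ℂ) =ᵐ[volume] I.indicator w := hg.coeFn_toLp
  have hee : (e : ℝ → ℂ) =ᵐ[volume] I.indicator fun _ => (1 : ℂ) := indicatorConstLp_coeFn
  -- Both the test function and its image are compared with the indicator of [-t,t], so its norm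
  -- cancels at the end.
  have hle : ‖f‖ ≤ ‖e‖ := by
    refine Lp.norm_le_norm_of_ae_le ?_
    filter_upwards [hfe, hee] with y h1 h2
    rw [h1, h2, norm_indicator_eq_indicator_norm, norm_indicator_eq_indicator_norm]
    refine indicator_le_indicator ?_
    rw [hwn, norm_one]
  have he0 : 0 < ‖e‖ := by
    rw [he, norm_indicatorConstLp (by simp) (by simp), hIr, norm_one, one_mul]
    positivity
  set m := t * ‖χ (0, 0)‖ / 2 with hm
  have hm0 : 0 < m := by have := norm_pos_iff.2 hχ0; positivity
  obtain ⟨hint, hTf⟩ : (∀ x, Integrable fun y => oscKernel S χ l (x, y) * f y) ∧ _ := hT f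
  have hpt : ∀ x ∈ I, m ≤ ‖∫ y, oscKernel S χ l (x, y) * f y‖ := by
    intro x hx
    have hae : (fun y => oscKernel S χ l (x, y) * f y) =ᵐ[volume]
        I.indicator fun y => oscKernel S χ l (x, y) * w y := by
      filter_upwards [hfe] with y h1
      rw [h1]
      by_cases hy : y ∈ I <;> simp [hy]
    have hq : IntegrableOn (fun y => oscKernel S χ l (x, y) * w y) I :=
      (integrable_indicator_iff hIm).1 ((hint x).congr hae)
    rw [integral_congr_ae hae, integral_indicator hIm]
    set z : ℂ := Complex.exp (((l * (S (x, 0) - S (0, 0)) : ℝ) : ℂ) * Complex.I) with hz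
    have hz1 : ‖z‖ = 1 := Complex.norm_exp_ofReal_mul_I _
    -- After the unimodular factor z, depending on x alone, the remaining phase is the small double
    -- difference. The error 9/16 = (1/4)(5/4) + 1/4 leaves at least 2t·(7/16)·|χ(0,0)| of the
    -- integral, above the required t|χ(0,0)|/2.
    have hb : ∀ y ∈ I, ‖oscKernel S χ l (x, y) * w y - z * χ (0, 0)‖ ≤ 9 / 16 * ‖χ (0, 0)‖ := by
      intro y hy
      set θ := l * (S (x, y) - S (0, y) - (S (x, 0) - S (0, 0))) with hθ
      have hfac : oscKernel S χ l (x, y) * w y = z * (Complex.exp (Complex.I * (θ : ℂ)) * χ (x, y)) := by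
        simp only [oscKernel, hw, hz]
        rw [mul_right_comm, ← Complex.exp_add, ← mul_assoc, ← Complex.exp_add]
        congr 2
        rw [hθ]; push_cast; ring
      have hsplit : z * (Complex.exp (Complex.I * (θ : ℂ)) * χ (x, y)) - z * χ (0, 0) =
          z * ((Complex.exp (Complex.I * (θ : ℂ)) - 1) * χ (x, y) + (χ (x, y) - χ (0, 0))) := by ring
      have h1 : ‖Complex.exp (Complex.I * (θ : ℂ)) - 1‖ ≤ 1 / 4 :=
        (Real.norm_exp_I_mul_ofReal_sub_one_le).trans (hΦ x hx y hy)
      have h2 := hχ x hx y hy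
      have h3 : ‖χ (x, y)‖ ≤ 5 / 4 * ‖χ (0, 0)‖ := by
        have := norm_le_norm_add_norm_sub' (χ (x, y)) (χ (0, 0))
        linarith
      rw [hfac, hsplit, norm_mul, hz1, one_mul]
      calc _ ≤ ‖Complex.exp (Complex.I * (θ : ℂ)) - 1‖ * ‖χ (x, y)‖ + ‖χ (x, y) - χ (0, 0)‖ := by
            refine (norm_add_le _ _).trans ?_
            rw [norm_mul]
        _ ≤ 1 / 4 * (5 / 4 * ‖χ (0, 0)‖) + ‖χ (0, 0)‖ / 4 := by gcongr
        _ = 9 / 16 * ‖χ (0, 0)‖ := by ring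
    have hsub := norm_setIntegral_le_of_norm_le_const (μ := volume) hIv.lt_top hb
    have hci : IntegrableOn (fun _ : ℝ => z * χ (0, 0)) I := integrableOn_const hIv
    rw [integral_sub hq hci, setIntegral_const, hIr] at hsub
    have hn : ‖(2 * t) • (z * χ (0, 0))‖ = 2 * t * ‖χ (0, 0)‖ := by
      rw [norm_smul, norm_mul z, hz1, one_mul, Real.norm_of_nonneg (by positivity)]
    have := norm_sub_norm_le ((2 * t) • (z * χ (0, 0))) (∫ y in I, oscKernel S χ l (x, y) * w y)
    rw [norm_sub_rev, hn] at this
    have hp : 0 ≤ t * ‖χ (0, 0)‖ := by positivity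
    rw [hm]
    linarith
  have hlow : ‖e‖ ≤ m⁻¹ * ‖T f‖ := by
    refine Lp.norm_le_mul_norm_of_ae_le_mul ?_
    filter_upwards [hTf, hee] with x h1 h2
    rw [h1, h2]
    by_cases hx : x ∈ I
    · rw [indicator_of_mem hx, norm_one, inv_mul_eq_div, le_div_iff₀ hm0, one_mul]
      exact hpt x hx
    · rw [indicator_of_notMem hx, norm_zero]
      positivity
  have hfin : m * ‖e‖ ≤ ‖T‖ * ‖e‖ := by
    rw [inv_mul_eq_div, le_div_iff₀ hm0, mul_comm] at hlow
    exact hlow.trans ((T.le_opNorm f).trans (mul_le_mul_of_nonneg_left hle (norm_nonneg _)))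
  exact le_of_mul_le_mul_right hfin he0

/-- With t = ε l^{-1/4}, the bound |F| ≤ C t² makes the double difference at most C t⁴, so its
product with l is at most C ε⁴, uniformly in l. The wave packet test then gives a norm at least of
order t. -/
theorem BoxData.normLowerBound (hd : BoxData α β S χ) (hα : α < 0) (hβ : 0 < β) {C s : ℝ}
    (hC : 0 ≤ C) (hs : 0 < s)
    (hF : ∀ t ≤ s, ∀ x y : ℝ, |x| ≤ t → |y| ≤ t → |mixedHessian univ S (x, y)| ≤ C * t ^ 2)
    (hχ0 : χ (0, 0) ≠ 0) : NormLowerBound S χ (1 / 4) := by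
  have hn := norm_pos_iff.2 hχ0
  have hev : ∀ᶠ p in 𝓝 ((0, 0) : ℝ × ℝ), ‖χ p - χ (0, 0)‖ < ‖χ (0, 0)‖ / 4 := by
    have := (hd.amp.continuous.tendsto (0, 0)).eventually (Metric.ball_mem_nhds _ (by positivity :
      0 < ‖χ (0, 0)‖ / 4))
    filter_upwards [this] with p hp
    simpa [dist_eq_norm] using hp
  obtain ⟨δ, hδ, hball⟩ := Metric.nhds_basis_closedBall.mem_iff.1 hev
  -- In order: the test square stays in the box, the quadratic bound applies, χ is close to χ(0,0),
  -- and C ε⁴ ≤ (C + 1)ε ≤ 1/4.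
  obtain ⟨ε, hε, hε1⟩ : ∃ ε > 0, ε < min (min (-α) β) (min (min s δ) (min 1 (1 / (4 * (C + 1))))) :=
    exists_between (by
      have : 0 < -α := by linarith
      positivity)
  simp only [lt_min_iff] at hε1
  obtain ⟨⟨hεα, hεβ⟩, ⟨hεs, hεδ⟩, hε1, hεC⟩ := hε1
  refine ⟨ε * ‖χ (0, 0)‖ / 2, by positivity, fun l hl T hT => ?_⟩
  have hl0 : 0 < l := by linarith
  set q := l ^ (-(1 / 4) : ℝ) with hq
  have hq0 : 0 < q := Real.rpow_pos_of_pos hl0 _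
  have hq1 : q ≤ 1 := Real.rpow_le_one_of_one_le_of_nonpos hl (by norm_num)
  have hq4 : l * q ^ 4 = 1 := by
    rw [hq, ← Real.rpow_natCast, ← Real.rpow_mul hl0.le]
    norm_num [Real.rpow_neg_one]
    exact mul_inv_cancel₀ hl0.ne'
  have ht : 0 < ε * q := by positivity
  have htε : ε * q ≤ ε := mul_le_of_le_one_right hε.le hq1
  have hI : Icc (-(ε * q)) (ε * q) ⊆ Ioo α β := fun x hx =>
    ⟨by linarith [hx.1], by linarith [hx.2]⟩
  have := hd.le_norm_of_small_phase ht hI (fun x hx y hy => ?_) (fun x hx y hy => ?_) hχ0 hT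
  · calc _ = ε * q * ‖χ (0, 0)‖ / 2 := by ring
      _ ≤ _ := this
  · have h := hd.abs_mixed_difference_le ht.le hI (hF (ε * q) (by linarith)) hx hy
    rw [abs_mul, abs_of_pos hl0]
    have hε4 : ε ^ 4 ≤ ε := by
      simpa using pow_le_pow_of_le_one hε.le hε1.le (show 1 ≤ 4 by norm_num)
    have hCε : (C + 1) * ε ≤ 1 / 4 := by
      rw [lt_div_iff₀ (by positivity)] at hεC
      linarith
    calc _ ≤ l * (C * (ε * q) ^ 2 * (ε * q) ^ 2) := mul_le_mul_of_nonneg_left h hl0.le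
      _ = C * ε ^ 4 * (l * q ^ 4) := by ring
      _ = C * ε ^ 4 := by rw [hq4, mul_one]
      _ ≤ (C + 1) * ε := mul_le_mul (by linarith) hε4 (by positivity) (by linarith)
      _ ≤ 1 / 4 := hCε
  · refine (hball ?_ : ‖χ (x, y) - χ (0, 0)‖ < ‖χ (0, 0)‖ / 4).le
    rw [← closedBall_prod_same]
    have h1 := abs_le.2 hx
    have h2 := abs_le.2 hy
    simp only [mem_prod, Metric.mem_closedBall, Real.dist_eq, sub_zero]
    exact ⟨by linarith, by linarith⟩

end LowerBound

theorem theorem5p1 :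
    (∀ (S : ℝ × ℝ → ℝ) (χ : ℝ × ℝ → ℂ),
      ContDiffOn ℝ ∞ S unitSquare → ContDiff ℝ ∞ χ → tsupport χ ⊆ unitSquare →
      (∀ B : ℕ,
        (∀ p ∈ unitSquare,
          mixedPartial (Icc 0 1) 1 0 (mixedHessian (Icc 0 1) S) p ≠ 0 ∧
          mixedPartial (Icc 0 1) 0 B (mixedHessian (Icc 0 1) S) p ≠ 0) →
        NormDecay S χ (((B : ℝ) + 1) / (2 * (2 * (B : ℝ) + 1)))) ∧
      ((∀ p ∈ unitSquare,
          mixedPartial (Icc 0 1) 2 0 (mixedHessian (Icc 0 1) S) p ≠ 0 ∧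
          mixedPartial (Icc 0 1) 0 2 (mixedHessian (Icc 0 1) S) p ≠ 0) →
        NormDecay S χ (1 / 4))) ∧
    (∀ (S : ℝ × ℝ → ℝ) (W : Set (ℝ × ℝ)),
      IsOpen W → (0, 0) ∈ W → ContDiffOn ℝ ∞ S W →
      ExceptionallyDegenerate (mixedHessian univ S) 2 →
      ∃ V ∈ 𝓝 ((0, 0) : ℝ × ℝ), ∀ χ : ℝ × ℝ → ℂ,
        ContDiff ℝ ∞ χ → HasCompactSupport χ → tsupport χ ⊆ V →
        NormDecay S χ (1 / 4) ∧ (χ (0, 0) ≠ 0 → NormLowerBound S χ (1 / 4))) := by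
  refine ⟨fun S χ hS hχ hs => ⟨normDecay_unitSquare_first hS hχ hs,
    normDecay_unitSquare_second hS hχ hs⟩, fun S W hW h0 hS hE => ?_⟩
  obtain ⟨hF0, hFx, hFy, hFxx, hFyy⟩ := hE.partials
  obtain ⟨r, hr, hrW, c, hc, c', hc', A, C, hA, hC, hax, hay⟩ :=
    exists_openBox_nondegenerate hW h0 hS hFxx hFyy
  obtain ⟨K, hK, s, hs, hq⟩ :=
    exists_quadratic_bound hW h0 (contDiffOn_mixedHessian hW hS) hF0 hFx hFy
  have hmem : ((0, 0) : ℝ × ℝ) ∈ openBox (-r) r := ⟨⟨by simpa, by simpa⟩, ⟨by simpa, by simpa⟩⟩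
  refine ⟨openBox (-r) r, (isOpen_openBox _ _).mem_nhds hmem, fun χ hχ hcpt hsupp => ?_⟩
  have hd : BoxData (-r) r S χ := ⟨by linarith, hS.mono hrW, hχ, hcpt, fun p hp =>
    hsupp (subset_tsupport χ hp)⟩
  exact ⟨hd.normDecay_of_second hc hc' hA hC hax hay,
    hd.normLowerBound (by linarith) hr hK hs hq⟩
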